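/- An instance of \textsc{Equitable Connected Partition} (ECP) is a finite simple connected graph $G=(V,E)$ with $V=\{0,\dots,n-1\}$, $n\ge 1$, together with an integer $p\ge 1$; the question is whether $V$ can be partitioned into exactly $p$ non-empty parts $V_1,\dots,V_p$ such that every $G[V_i]$ is connected and $\bigl||V_i|-|V_j|\bigr|\le 1$ for all $i,j$. The input is the bit string that consists of $n$ in unary, the adjacency matrix of $G$ and $p$ in binary; let $N$ be its length. A tree-decomposition of $G$ is a finite tree $T$ with bags $\beta(x)\subseteq V$ ($x\in V(T)$) such that every vertex and both ends of every edge of $G$ lie in some bag and, for every $v\in V$, the nodes $x$ with $v\in\beta(x)$ induce a connected non-empty subtree of $T$; its width is $\max_x|\beta(x)|-1$, and $\operatorname{tw}(G)$ is the minimum width of a tree-decomposition of $G$. Algorithms are programs of a random access machine with addition and subtraction, at unit cost; they are given only $(G,p)$, and neither a tree-decomposition nor $\operatorname{tw}(G)$. **Theorem.** (i) ECP is in $\mathsf{XP}$ when parameterised by the tree-width: there are a computable function $f\colon\mathbb N\to\mathbb N$ and an algorithm that decides ECP in at most $N^{f(\operatorname{tw}(G))}$ steps. (ii) More precisely, there are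 a constant $C$ and an algorithm that decides ECP in at most $N^{C(\operatorname{tw}(G)+1)}$ steps. (iii) ECP is fixed-parameter tractable when parameterised by $\operatorname{tw}(G)+\lceil n/p\rceil$: there are a computable function $g\colon\mathbb N\to\mathbb N$, a constant $c$ and an algorithm that decides ECP in at most $g(\operatorname{tw}(G)+\lceil n/p\rceil)\cdot N^{c}$ steps. -/

import Mathlib

/-! ### Random access machines

A unit-cost random access machine with finitely many registers addressed by the program, an
unbounded memory that is addressed indirectly, and addition and truncated subtraction as the only
arithmetic.  Programs are structured (sequence, branch, loop); each elementary instruction and each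
test of a branch or a loop is one step.  The model is polynomially equivalent to Turing machines. -/

namespace RAM

/-- The contents of the registers and of the memory. -/
structure State where
  reg : ℕ → ℕ
  mem : ℕ → ℕ

/-- Assign the value `a` to the register `r`. -/
def State.setReg (σ : State) (r a : ℕ) : State :=
  { σ with reg := Function.update σ.reg r a }

/-- Write the value `a` into the memory cell with address `i`. -/
def State.setMem (σ : State) (i a : ℕ) : State :=
  { σ with mem := Function.update σ.mem i a }

/-- Programs.  All arguments are register numbers, except the constant `a` in `const r a`. -/
inductive Cmd where
  /-- do nothing -/
  | skip : Cmd
  /-- `reg r := a` -/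
  | const (r a : ℕ) : Cmd
  /-- `reg r := reg s + reg t` -/
  | add (r s t : ℕ) : Cmd
  /-- `reg r := reg s - reg t`, or `0` if this is negative -/
  | sub (r s t : ℕ) : Cmd
  /-- `reg r := mem (reg s)` -/
  | load (r s : ℕ) : Cmd
  /-- `mem (reg r) := reg s` -/
  | store (r s : ℕ) : Cmd
  /-- first `c`, then `d` -/
  | seq (c d : Cmd) : Cmd
  /-- if `reg r ≠ 0` then `c`, else `d` -/
  | ite (r : ℕ) (c d : Cmd) : Cmd
  /-- while `reg r ≠ 0` do `c` -/
  | loop (r : ℕ) (c : Cmd) : Cmd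

/-- `Exec c σ t τ`: started in the state `σ`, the program `c` halts after exactly `t` steps in the
state `τ`. -/
inductive Exec : Cmd → State → ℕ → State → Prop where
  | skip (σ : State) : Exec .skip σ 1 σ
  | const (σ : State) (r a : ℕ) : Exec (.const r a) σ 1 (σ.setReg r a)
  | add (σ : State) (r s t : ℕ) : Exec (.add r s t) σ 1 (σ.setReg r (σ.reg s + σ.reg t))
  | sub (σ : State) (r s t : ℕ) : Exec (.sub r s t) σ 1 (σ.setReg r (σ.reg s - σ.reg t))
  | load (σ : State) (r s : ℕ) : Exec (.load r s) σ 1 (σ.setReg r (σ.mem (σ.reg s)))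
  | store (σ : State) (r s : ℕ) : Exec (.store r s) σ 1 (σ.setMem (σ.reg r) (σ.reg s))
  | seq {c d : Cmd} {σ τ υ : State} {m n : ℕ} (h₁ : Exec c σ m τ) (h₂ : Exec d τ n υ) :
      Exec (.seq c d) σ (m + n) υ
  | ite_true {r : ℕ} {c d : Cmd} {σ τ : State} {m : ℕ} (h₀ : σ.reg r ≠ 0) (h₁ : Exec c σ m τ) :
      Exec (.ite r c d) σ (m + 1) τ
  | ite_false {r : ℕ} {c d : Cmd} {σ τ : State} {m : ℕ} (h₀ : σ.reg r = 0) (h₁ : Exec d σ m τ) :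
      Exec (.ite r c d) σ (m + 1) τ
  | loop_stop {r : ℕ} {c : Cmd} {σ : State} (h₀ : σ.reg r = 0) : Exec (.loop r c) σ 1 σ
  | loop_step {r : ℕ} {c : Cmd} {σ τ υ : State} {m n : ℕ} (h₀ : σ.reg r ≠ 0)
      (h₁ : Exec c σ m τ) (h₂ : Exec (.loop r c) τ n υ) : Exec (.loop r c) σ (m + n + 1) υ

/-- The state in which a program is started on a bit string `w`: register `0` holds the length of
`w`, memory cell `i` holds bit number `i` of `w`, and everything else is `0`. -/
def start (w : List Bool) : State where
  reg := fun r => if r = 0 then w.length else 0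
  mem := fun i => (w.getD i false).toNat

end RAM

/-! ### Parameterised problems -/

/-- A parameterised decision problem: its instances, their encoding by bit strings, the
yes-instances, and the parameter. -/
structure ParamProblem where
  Inst : Type
  encode : Inst → List Bool
  IsYes : Inst → Prop
  param : Inst → ℕ

namespace ParamProblem

/-- The length of the input. -/
def size (P : ParamProblem) (x : P.Inst) : ℕ := (P.encode x).length

/-- A single program halts on every instance `x` after at most `T x` steps, with `1` in register
`0` if `x` is a yes-instance and with `0` in register `0` otherwise. -/
def SolvableInTime (P : ParamProblem) (T : P.Inst → ℕ) : Prop :=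
  ∃ c : RAM.Cmd, ∀ x : P.Inst, ∃ (t : ℕ) (τ : RAM.State),
    RAM.Exec c (RAM.start (P.encode x)) t τ ∧ t ≤ T x ∧
      (P.IsYes x → τ.reg 0 = 1) ∧ (¬ P.IsYes x → τ.reg 0 = 0)

/-- Running time `n ^ f(k)` for a computable function `f`, where `n` is the length of the input and
`k` is the parameter. -/
def InXP (P : ParamProblem) : Prop :=
  ∃ f : ℕ → ℕ, Computable f ∧ P.SolvableInTime fun x => P.size x ^ f (P.param x)

/-- Running time `f(k) * n ^ O(1)` for a computable function `f`, where `n` is the length of the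
input and `k` is the parameter. -/
def InFPT (P : ParamProblem) : Prop :=
  ∃ (f : ℕ → ℕ) (c : ℕ), Computable f ∧
    P.SolvableInTime fun x => f (P.param x) * P.size x ^ c

end ParamProblem

/-! ### Tree-width -/

/-- A tree-decomposition of the graph `G`. -/
structure TreeDecomposition {V : Type} (G : SimpleGraph V) where
  numNodes : ℕ
  tree : SimpleGraph (Fin numNodes)
  isTree : tree.IsTree
  bag : Fin numNodes → Finset V
  exists_mem_bag : ∀ v : V, ∃ x, v ∈ bag x
  exists_edge_subset_bag : ∀ u v : V, G.Adj u v → ∃ x, u ∈ bag x ∧ v ∈ bag x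
  connected_nodes : ∀ v : V, (tree.induce {x | v ∈ bag x}).Connected

/-- The size of a largest bag, minus one. -/
def TreeDecomposition.width {V : Type} {G : SimpleGraph V} (D : TreeDecomposition G) : ℕ :=
  (Finset.univ.sup fun x => (D.bag x).card) - 1

/-- The minimum width of a tree-decomposition of `G`. -/
noncomputable def treewidth {V : Type} (G : SimpleGraph V) : ℕ :=
  sInf {w | ∃ D : TreeDecomposition G, D.width = w}

/-! ### Equitable connected partitions -/

/-- The vertex set of `G` has a partition into exactly `p` (non-empty) parts each of which induces
a connected subgraph and any two of which differ in size by at most one. -/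
def HasEquitableConnectedPartition {V : Type} [Fintype V] [DecidableEq V] (G : SimpleGraph V)
    (p : ℕ) : Prop :=
  ∃ π : Finpartition (Finset.univ : Finset V),
    π.parts.card = p ∧
    (∀ A ∈ π.parts, (G.induce (A : Set V)).Connected) ∧
    ∀ A ∈ π.parts, ∀ B ∈ π.parts, A.card ≤ B.card + 1

/-- The inputs of the problem Equitable Connected Partition: a connected graph with vertices
`0, …, n - 1` and a positive number `p` of parts.  (A connected graph has a vertex, so `0 < n`.) -/
structure ECPInstance where
  n : ℕ
  G : SimpleGraph (Fin n)
  connected : G.Connected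
  p : ℕ
  p_pos : 0 < p

namespace ECPInstance

open Classical in
/-- The number `n` of vertices in unary, closed by a zero; then the `n * n` entries of the adjacency
matrix, row by row; then `p` in binary, the least significant bit first. -/
noncomputable def encode (x : ECPInstance) : List Bool :=
  List.replicate x.n true ++ [false] ++
    List.ofFn (fun i : Fin (x.n * x.n) => decide (x.G.Adj i.divNat i.modNat)) ++
    Nat.bits x.p

/-- The answer to the instance is yes. -/
def IsYes (x : ECPInstance) : Prop := HasEquitableConnectedPartition x.G x.p

end ECPInstance

/-- Equitable Connected Partition with an arbitrary parameter. -/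
noncomputable def ECP (param : ECPInstance → ℕ) : ParamProblem where
  Inst := ECPInstance
  encode := ECPInstance.encode
  IsYes := ECPInstance.IsYes
  param := param

/-! An equitable connected partition into `p` parts amounts to a rooted spanning forest with `p`
trees whose sizes `z` satisfy `p * z < n + p` and `n < p * z + p`
(`hasEquitableConnectedPartition_iff`). Such a forest has a local description: every vertex is a
root or sends its number of descendants to its parent, and this number is one more than the sum of
the numbers received. Numbers grow towards the root, so no global condition is needed to exclude
cycles. The condition at a vertex can be packed into a single equation between natural numbers
(`exists_unique_out`). Hence the question is whether one vector can be chosen from each of a list of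
small tables, one per arc and one per vertex, so that the sum is a prescribed vector
(`mem_allTables_iff_hasPartition`); one further coordinate counts the roots.

Such vector sums are decided by eliminating coordinates. All tables that do not vanish at the
coordinate are joined, sums beyond the target are dropped, and only the sums that meet the target at
this coordinate are kept (`elimCoord_spec`). A joined table varies only at the current vertex, at
the remaining neighbours of a connected set of eliminated vertices, and at the root counter. With
`M` possible numbers of descendants and an order of width `b` it therefore has at most `(4 * M) ^ (b
+ 1) * (p + 1)` vectors (`length_le_of_constOff`, `TableBound.vecSum_ne_zero`).

An order of width linear in the tree-width `k` is built without a tree-decomposition. Vertices are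
placed starting with those eliminated last, so that every connected set of unplaced vertices has at
most `4 * k + 5` placed neighbours. If a component has fewer, any vertex of it may be placed.
Otherwise a bag of some tree-decomposition splits its neighbours well
(`TreeDecomposition.exists_isSeparation`), and placing the part of such a cut inside the component
leaves only connected sets with strictly fewer placed neighbours
(`IsComponent.card_lt_of_isSeparation`). A cut is found by running through the subsets of the
neighbourhood and augmenting a flow (`netCut_ne_nil`, `cutOf_sound`).

Neither the tree-width nor the table size is known in advance. The procedure `solveWith` truncates
all tables at `K` vectors, records whether this lost anything, and tries all candidates for the
tree-width. An answer other than failure is correct whatever order was used (`vecSum_spec`), and `K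
= bound` excludes failure. Trying `K = 0, 1, 2, …` costs a polynomial in `bound` plus the input
length (`RAM.exists_search_program`). From `M ≤ n + 1` the first two claims follow, from `M ≤ ⌈n /
p⌉ + 1` the third.

Programs are not written by hand: functions on nested pairs form a class `PolyTime` with closure
under composition, branching and folds, so the running time of `solveWith` follows from its
definition. Numbers count with their value there, which makes `K` a unary argument. -/

/-! ### Heap data

Nested pairs of numbers, stored in an immutable heap of two-cell blocks. -/

/-- Binary trees with numbers at the leaves. -/
inductive Data where
  | nat (n : ℕ) : Data
  | pair (a b : Data) : Data

namespace Data

/-- The size of a tree; a number counts with its value. -/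
def size : Data → ℕ
  | nat n => n + 1
  | pair a b => a.size + b.size + 1

/-- The value `a` represents the tree in the memory `m` below the address `h`. -/
def Stored (m : ℕ → ℕ) (h : ℕ) : Data → ℕ → Prop
  | nat n, a => a = n
  | pair x y, a => 0 < a ∧ a + 1 < h ∧ Stored m h x (m a) ∧ Stored m h y (m (a + 1))

/-- Allocated blocks are never overwritten, so a representation survives all later allocations and
may be shared without copying. -/
theorem Stored.mono {m m' : ℕ → ℕ} {h h' : ℕ} (hh : h ≤ h') (hm : ∀ i < h, m' i = m i) :
    ∀ {d : Data} {a : ℕ}, Stored m h d a → Stored m' h' d a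
  | nat _, _, H => H
  | pair x y, a, ⟨h0, h1, h2, h3⟩ => by
    refine ⟨h0, by omega, ?_, ?_⟩
    · rw [hm a (by omega)]; exact h2.mono hh hm
    · rw [hm (a + 1) h1]; exact h3.mono hh hm

end Data

/-- Types with an encoding by trees. -/
class Enc (α : Type) where
  enc : α → Data

open Enc

instance : Enc ℕ := ⟨Data.nat⟩

instance : Enc Bool := ⟨fun b => Data.nat b.toNat⟩

instance {α β : Type} [Enc α] [Enc β] : Enc (α × β) := ⟨fun x => Data.pair (enc x.1) (enc x.2)⟩

/-- The encoding of a list. -/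
def encList {α : Type} [Enc α] : List α → Data
  | [] => Data.nat 0
  | a :: l => Data.pair (enc a) (encList l)

instance {α : Type} [Enc α] : Enc (List α) := ⟨encList⟩

/-- The size of the encoding. -/
def sz {α : Type} [Enc α] (x : α) : ℕ := (enc x).size

section
variable {α β : Type} [Enc α] [Enc β]

@[simp] theorem sz_nat (n : ℕ) : sz n = n + 1 := rfl

theorem sz_bool_le (b : Bool) : sz b ≤ 2 := by cases b <;> simp [sz, enc, Data.size]

@[simp] theorem sz_pair (x : α × β) : sz x = sz x.1 + sz x.2 + 1 := rfl

@[simp] theorem sz_nil : sz ([] : List α) = 1 := rfl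

@[simp] theorem sz_cons (a : α) (l : List α) : sz (a :: l) = sz a + sz l + 1 := rfl

end

/-! ### Program combinators on heap data: register 0 is the argument, 1 the stack, 2 the first free
cell, 3 to 5 are scratch. -/

namespace RAM

open Data

theorem Exec.loop_halt {r : ℕ} {c : Cmd} {σ : State} (h : σ.reg r = 0) :
    Exec (.loop r c) σ 1 σ := by
  constructor
  exact h

/-- Between the states `σ` and `τ` the heap only grew, and the stack pointer is the same. -/
structure Ext (σ τ : State) : Prop where
  heap : σ.reg 2 ≤ τ.reg 2
  mem : ∀ i < σ.reg 2, τ.mem i = σ.mem i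
  stack : τ.reg 1 = σ.reg 1

theorem Ext.rfl' (σ : State) : Ext σ σ := ⟨le_rfl, fun _ _ => rfl, rfl⟩

theorem Ext.trans {σ τ υ : State} (h : Ext σ τ) (h' : Ext τ υ) : Ext σ υ :=
  ⟨h.heap.trans h'.heap,
    fun i hi => (h'.mem i (hi.trans_le h.heap)).trans (h.mem i hi), h'.stack.trans h.stack⟩

/-- The register `r` of `σ` represents `d`. -/
def Holds (σ : State) (r : ℕ) (d : Data) : Prop := Stored σ.mem (σ.reg 2) d (σ.reg r)

/-- The program `c` turns the tree `d` in register `0` into the tree `e`, in at most `T` steps. -/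
def Runs (c : Cmd) (d e : Data) (T : ℕ) : Prop :=
  ∀ σ : State, 0 < σ.reg 2 → Holds σ 0 d →
    ∃ t τ, Exec c σ t τ ∧ t ≤ T ∧ Holds τ 0 e ∧ Ext σ τ

theorem Runs.mono {c : Cmd} {d e : Data} {T T' : ℕ} (h : Runs c d e T) (hT : T ≤ T') :
    Runs c d e T' := fun σ h0 h1 =>
  let ⟨t, τ, a, b, c⟩ := h σ h0 h1
  ⟨t, τ, a, b.trans hT, c⟩

theorem runs_skip (d : Data) : Runs .skip d d 1 := fun σ _ h =>
  ⟨1, σ, .skip σ, le_rfl, h, .rfl' σ⟩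

theorem Runs.seq {c c' : Cmd} {d e f : Data} {T T' : ℕ} (h : Runs c d e T) (h' : Runs c' e f T') :
    Runs (.seq c c') d f (T + T') := by
  intro σ h0 h1
  obtain ⟨t, τ, a, b, c, x⟩ := h σ h0 h1
  obtain ⟨t', τ', a', b', c', x'⟩ := h' τ (h0.trans_le x.heap) c
  exact ⟨_, _, a.seq a', add_le_add b b', c', x.trans x'⟩

theorem runs_const (d : Data) (n : ℕ) : Runs (.const 0 n) d (nat n) 1 := fun σ _ _ =>
  ⟨1, _, .const σ 0 n, le_rfl, by simp [Holds, Stored, State.setReg],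
    ⟨by simp [State.setReg], fun _ _ => rfl, by simp [State.setReg]⟩⟩

theorem runs_fst (d e : Data) : Runs (.load 0 0) (pair d e) d 1 := fun σ _ h =>
  ⟨1, _, .load σ 0 0, le_rfl, by simpa [Holds, State.setReg] using h.2.2.1,
    ⟨by simp [State.setReg], fun _ _ => rfl, by simp [State.setReg]⟩⟩

/-- Load the second component of the pair in register `0` into register `r`. -/
def sndCmd (r : ℕ) : Cmd := .seq (.const 3 1) (.seq (.add 3 0 3) (.load r 3))

theorem runs_snd (d e : Data) : Runs (sndCmd 0) (pair d e) e 3 := fun σ _ h =>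
  ⟨_, _, (Exec.const σ 3 1).seq ((Exec.add _ 3 0 3).seq (Exec.load _ 0 3)), le_rfl,
    by simpa [Holds, State.setReg] using h.2.2.2,
    ⟨by simp [State.setReg], fun _ _ => rfl, by simp [State.setReg]⟩⟩

/-- Push register `r` onto the stack. -/
def pushCmd (r : ℕ) : Cmd :=
  .seq (.store 2 r) (.seq (.const 4 1) (.seq (.add 2 2 4) (.seq (.store 2 1)
    (.seq (.sub 1 2 4) (.add 2 2 4)))))

/-- The stack is a linked list in the same heap: a block holds the value and the previous stack
pointer. So saving a value is just another allocation and cannot damage stored trees. -/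
theorem exec_push (σ : State) {r : ℕ} (_ : r ≠ 1 ∧ r ≠ 2 ∧ r ≠ 4) :
    ∃ τ, Exec (pushCmd r) σ 6 τ ∧ τ.reg 1 = σ.reg 2 ∧ τ.reg 2 = σ.reg 2 + 2 ∧
      τ.reg 0 = σ.reg 0 ∧ τ.reg 3 = σ.reg 3 ∧ τ.reg 5 = σ.reg 5 ∧
      τ.mem (σ.reg 2) = σ.reg r ∧ τ.mem (σ.reg 2 + 1) = σ.reg 1 ∧
      ∀ i < σ.reg 2, τ.mem i = σ.mem i := by
  refine ⟨_, (Exec.store σ 2 r).seq ((Exec.const _ 4 1).seq ((Exec.add _ 2 2 4).seq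
    ((Exec.store _ 2 1).seq ((Exec.sub _ 1 2 4).seq (Exec.add _ 2 2 4))))), ?_⟩
  simp +contextual [State.setReg, State.setMem, Function.update_apply]
  intro i hi
  rw [if_neg (by omega), if_neg (by omega)]

/-- Pop the top of the stack into register `3`. -/
def popCmd : Cmd := .seq (.load 3 1) (.seq (.const 4 1) (.seq (.add 4 1 4) (.load 1 4)))

theorem exec_pop (σ : State) :
    ∃ τ, Exec popCmd σ 4 τ ∧ τ.reg 3 = σ.mem (σ.reg 1) ∧ τ.reg 1 = σ.mem (σ.reg 1 + 1) ∧
      τ.reg 0 = σ.reg 0 ∧ τ.reg 2 = σ.reg 2 ∧ τ.mem = σ.mem := by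
  refine ⟨_, (Exec.load σ 3 1).seq ((Exec.const _ 4 1).seq ((Exec.add _ 4 1 4).seq
    (Exec.load _ 1 4))), ?_⟩
  simp [State.setReg]

/-- Replace register `0` by a new pair of register `3` and register `0`. -/
def consCmd : Cmd :=
  .seq (.store 2 3) (.seq (.const 4 1) (.seq (.add 2 2 4) (.seq (.store 2 0)
    (.seq (.sub 0 2 4) (.add 2 2 4)))))

theorem exec_cons (σ : State) :
    ∃ τ, Exec consCmd σ 6 τ ∧ τ.reg 0 = σ.reg 2 ∧ τ.reg 2 = σ.reg 2 + 2 ∧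
      τ.mem (σ.reg 2) = σ.reg 3 ∧ τ.mem (σ.reg 2 + 1) = σ.reg 0 ∧
      (∀ i < σ.reg 2, τ.mem i = σ.mem i) ∧
      ∀ r, r ≠ 0 → r ≠ 2 → r ≠ 4 → τ.reg r = σ.reg r := by
  refine ⟨_, (Exec.store σ 2 3).seq ((Exec.const _ 4 1).seq ((Exec.add _ 2 2 4).seq
    ((Exec.store _ 2 0).seq ((Exec.sub _ 0 2 4).seq (Exec.add _ 2 2 4))))), ?_⟩
  simp +contextual [State.setReg, State.setMem, Function.update_apply]
  intro i hi
  rw [if_neg (by omega), if_neg (by omega)]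

theorem holds_cons {σ : State} {d e : Data} (h0 : 0 < σ.reg 2) (h3 : Holds σ 3 d)
    (h : Holds σ 0 e) : ∃ τ, Exec consCmd σ 6 τ ∧ Holds τ 0 (pair d e) ∧ Ext σ τ ∧
      ∀ r, r ≠ 0 → r ≠ 2 → r ≠ 4 → τ.reg r = σ.reg r := by
  obtain ⟨τ, x, e0, e2, e3, e4, e5, e6⟩ := exec_cons σ
  have hle : σ.reg 2 ≤ τ.reg 2 := by omega
  refine ⟨τ, x, ⟨by omega, by omega, ?_, ?_⟩, ⟨hle, e5, e6 1 (by simp) (by simp) (by simp)⟩, e6⟩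
  · rw [e0, e3]; exact h3.mono hle e5
  · rw [e0, e4]; exact h.mono hle e5

/-- Copy register `3` to register `0` and the old register `0` to register `5`. -/
def swapCmd : Cmd := .seq (.const 4 0) (.seq (.add 5 0 4) (.add 0 3 4))

theorem exec_swap (σ : State) :
    ∃ τ, Exec swapCmd σ 3 τ ∧ τ.reg 0 = σ.reg 3 ∧ τ.reg 5 = σ.reg 0 ∧ τ.reg 1 = σ.reg 1 ∧
      τ.reg 2 = σ.reg 2 ∧ τ.mem = σ.mem := by
  refine ⟨_, (Exec.const σ 4 0).seq ((Exec.add _ 5 0 4).seq (Exec.add _ 0 3 4)), ?_⟩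
  simp [State.setReg]

/-- Run two programs on the same argument and pair the results. -/
def pairCmd (c c' : Cmd) : Cmd :=
  .seq (pushCmd 0) (.seq c (.seq popCmd (.seq swapCmd (.seq (pushCmd 5) (.seq c'
    (.seq popCmd consCmd))))))

/-- The argument is saved on the stack during the first run, the first result during the second. The
overhead 29 consists of two pushes, two pops, one swap and one allocation. -/
theorem Runs.pair {c c' : Cmd} {d e f : Data} {T T' : ℕ} (h : Runs c d e T) (h' : Runs c' d f T') :
    Runs (pairCmd c c') d (pair e f) (T + T' + 29) := by
  intro σ h0 h1
  obtain ⟨σ₁, x₁, a1, a2, a3, -, -, a4, a5, a6⟩ := exec_push σ (r := 0) (by simp)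
  obtain ⟨t, σ₂, x₂, tt, b1, bx⟩ := h σ₁ (by omega)
    (by unfold Holds; rw [a3]; exact h1.mono (by omega) a6)
  have k1 := bx.mem (σ.reg 2) (by omega)
  have k2 := bx.mem (σ.reg 2 + 1) (by omega)
  have k3 := bx.heap
  obtain ⟨σ₃, x₃, c1, c2, c3, c4, c5⟩ := exec_pop σ₂
  rw [bx.stack, a1] at c1 c2
  have m3 : ∀ i < σ.reg 2, σ₃.mem i = σ.mem i := fun i hi => by
    rw [c5, bx.mem i (by omega), a6 i hi]
  obtain ⟨σ₄, x₄, d0, d5, d1, d2, dm⟩ := exec_swap σ₃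
  obtain ⟨σ₅, x₅, e1, e2, e3, -, -, e4, e5, e6⟩ := exec_push σ₄ (r := 5) (by simp)
  have m5 : ∀ i < σ₂.reg 2, σ₅.mem i = σ₂.mem i := fun i hi => by
    rw [e6 i (by omega), dm, c5]
  obtain ⟨t', σ₆, x₆, tt', f1, fx⟩ := h' σ₅ (by omega) (by
    unfold Holds; rw [e3, d0, c1, k1, a4]
    exact h1.mono (by omega) fun i hi => by rw [m5 i (by omega), ← m3 i hi, c5])
  obtain ⟨σ₇, x₇, g1, g2, g3, g4, g5⟩ := exec_pop σ₆
  have l3 := fx.heap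
  rw [fx.stack, e1, fx.mem _ (by omega)] at g1 g2
  obtain ⟨σ₈, y, z1, z2, -⟩ := holds_cons (σ := σ₇) (d := e) (e := f) (by omega) (by
      unfold Holds; rw [g1, e4, d5, c3]
      refine b1.mono (by omega) fun i hi => ?_
      rw [g5, fx.mem i (by omega), m5 i hi]) (by
      unfold Holds; rw [g3, g4, g5]; exact f1)
  refine ⟨_, σ₈, x₁.seq (x₂.seq (x₃.seq (x₄.seq (x₅.seq (x₆.seq (x₇.seq y)))))),
    by omega, z1, ?_, ?_, ?_⟩
  · have := z2.heap; omega
  · intro i hi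
    rw [z2.mem i (by omega), g5, fx.mem i (by omega), m5 i (by omega), ← m3 i hi, c5]
  · rw [z2.stack, g2, e5, d1, c2, k2, a5]

/-- Load both components of the pair in register `0` into the registers `0` and `3`. -/
def unpairCmd : Cmd := .seq (sndCmd 3) (.load 0 0)

theorem exec_unpair {σ : State} {d e : Data} (h : Holds σ 0 (pair d e)) :
    ∃ τ, Exec unpairCmd σ 4 τ ∧ Holds τ 0 d ∧ Holds τ 3 e ∧ Ext σ τ := by
  refine ⟨_, ((Exec.const σ 3 1).seq ((Exec.add _ 3 0 3).seq (Exec.load _ 3 3))).seq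
    (Exec.load _ 0 0), ?_, ?_, ?_, fun _ _ => rfl, ?_⟩
  · simpa [Holds, State.setReg, Function.update_apply] using h.2.2.1
  · simpa [Holds, State.setReg, Function.update_apply] using h.2.2.2
  · simp [State.setReg]
  · simp [State.setReg]

theorem runs_add (m n : ℕ) :
    Runs (.seq unpairCmd (.add 0 0 3)) (pair (nat m) (nat n)) (nat (m + n)) 5 := by
  intro σ h0 h
  obtain ⟨τ, x, a, b, e⟩ := exec_unpair h
  refine ⟨_, _, x.seq (Exec.add τ 0 0 3), le_rfl, ?_, e.trans ⟨?_, fun _ _ => rfl, ?_⟩⟩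
  · simp only [Holds, Stored] at a b
    simp [Holds, Stored, State.setReg, a, b]
  · simp [State.setReg]
  · simp [State.setReg]

theorem runs_sub (m n : ℕ) :
    Runs (.seq unpairCmd (.sub 0 0 3)) (pair (nat m) (nat n)) (nat (m - n)) 5 := by
  intro σ h0 h
  obtain ⟨τ, x, a, b, e⟩ := exec_unpair h
  refine ⟨_, _, x.seq (Exec.sub τ 0 0 3), le_rfl, ?_, e.trans ⟨?_, fun _ _ => rfl, ?_⟩⟩
  · simp only [Holds, Stored] at a b
    simp [Holds, Stored, State.setReg, a, b]
  · simp [State.setReg]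
  · simp [State.setReg]

/-- Trees that count as true in a test. -/
def Truthy : Data → Prop
  | nat n => n ≠ 0
  | .pair _ _ => True

theorem Holds.ne_zero_iff {σ : State} {r : ℕ} {d : Data} (h : Holds σ r d) :
    σ.reg r ≠ 0 ↔ Truthy d := by
  cases d with
  | nat n => simp only [Holds, Stored] at h; simp [h, Truthy]
  | pair x y => have := h.1; simp [Truthy]; omega

/-- Branch on the second component of the pair in register `0`. -/
def testCmd (c c' : Cmd) : Cmd := .seq (sndCmd 3) (.ite 3 c (.seq (.load 0 0) c'))

theorem exec_snd {σ : State} {d e : Data} (h : Holds σ 0 (pair d e)) :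
    ∃ τ, Exec (sndCmd 3) σ 3 τ ∧ Holds τ 0 (pair d e) ∧ Holds τ 3 e ∧ Ext σ τ := by
  refine ⟨_, (Exec.const σ 3 1).seq ((Exec.add _ 3 0 3).seq (Exec.load _ 3 3)), ?_, ?_, ?_,
    fun _ _ => rfl, ?_⟩
  · simpa [Holds, State.setReg, Function.update_apply] using h
  · simpa [Holds, State.setReg, Function.update_apply] using h.2.2.2
  · simp [State.setReg]
  · simp [State.setReg]

/-- This branch still has the tested value next to the argument, so a case distinction on a list can
go on to take it apart; the other branch drops the value. -/
theorem Runs.test_true {c c' : Cmd} {d e f : Data} {T : ℕ} (he : Truthy e)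
    (h : Runs c (.pair d e) f T) : Runs (testCmd c c') (.pair d e) f (T + 4) := by
  intro σ h0 h1
  obtain ⟨τ, x, a, b, e⟩ := exec_snd h1
  obtain ⟨t, υ, y, ht, z, w⟩ := h τ (h0.trans_le e.heap) a
  exact ⟨_, υ, x.seq (.ite_true (b.ne_zero_iff.2 he) y), by omega, z, e.trans w⟩

theorem Runs.test_false {c c' : Cmd} {d e f : Data} {T : ℕ} (he : ¬ Truthy e)
    (h : Runs c' d f T) : Runs (testCmd c c') (.pair d e) f (T + 5) := by
  intro σ h0 h1
  obtain ⟨τ, x, a, b, e⟩ := exec_snd h1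
  obtain ⟨t, υ, y, ht, z, w⟩ := (Runs.seq (runs_fst _ _) h) τ (h0.trans_le e.heap) a
  refine ⟨_, υ, x.seq (.ite_false (not_not.1 (mt b.ne_zero_iff.1 he)) y), by omega, z, e.trans w⟩

/-- Repeat `s` as long as `c` returns something true. -/
def whileCmd (c s : Cmd) : Cmd :=
  .seq (.seq (pairCmd .skip c) unpairCmd) (.loop 3 (.seq s (.seq (pairCmd .skip c) unpairCmd)))

theorem Runs.while {c s : Cmd} {m T T' : ℕ} {d e : ℕ → Data}
    (hc : ∀ j ≤ m, Runs c (d j) (e j) T) (hs : ∀ j < m, Runs s (d j) (d (j + 1)) T')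
    (ht : ∀ j < m, Truthy (e j)) (hf : ¬ Truthy (e m)) :
    Runs (whileCmd c s) (d 0) (d m) ((m + 1) * (T + T' + 40)) := by
  have test : ∀ j ≤ m, ∀ σ, 0 < σ.reg 2 → Holds σ 0 (d j) → ∃ t τ,
      Exec (.seq (pairCmd .skip c) unpairCmd) σ t τ ∧ t ≤ T + 34 ∧ Holds τ 0 (d j) ∧
        Holds τ 3 (e j) ∧ Ext σ τ := by
    intro j hj σ h0 h
    obtain ⟨t, τ, x, ht, y, z⟩ := ((runs_skip _).pair (hc j hj)) σ h0 h
    obtain ⟨υ, x', a, b, z'⟩ := exec_unpair y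
    exact ⟨_, _, x.seq x', by omega, a, b, z.trans z'⟩
  have loop : ∀ k j, j + k = m → ∀ σ, 0 < σ.reg 2 → Holds σ 0 (d j) → Holds σ 3 (e j) → ∃ t τ,
      Exec (.loop 3 (.seq s (.seq (pairCmd .skip c) unpairCmd))) σ t τ ∧
        t ≤ k * (T + T' + 40) + 1 ∧ Holds τ 0 (d m) ∧ Ext σ τ := by
    intro k
    induction k with
    | zero =>
      intro j hj σ h0 h h3
      obtain rfl : j = m := by omega
      exact ⟨1, σ, .loop_halt (not_not.1 (mt h3.ne_zero_iff.1 hf)), by omega, h, .rfl' σ⟩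
    | succ k ih =>
      intro j hj σ h0 h h3
      obtain ⟨t, τ, x, hx, y, z⟩ := hs j (by omega) σ h0 h
      obtain ⟨t', τ', x', hx', y', w', z'⟩ := test (j + 1) (by omega) τ (h0.trans_le z.heap) y
      have z'' := z.trans z'
      obtain ⟨t₂, υ, x₂, hx₂, y₂, z₂⟩ := ih (j + 1) (by omega) τ' (h0.trans_le z''.heap) y' w'
      refine ⟨_, υ, .loop_step (h3.ne_zero_iff.2 (ht j (by omega))) (x.seq x') x₂, ?_, y₂,
        z''.trans z₂⟩
      rw [Nat.succ_mul]; omega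
  intro σ h0 h
  obtain ⟨t, τ, x, hx, y, y', z⟩ := test 0 (Nat.zero_le _) σ h0 h
  obtain ⟨t', υ, x', hx', w, z'⟩ := loop m 0 (by omega) τ (h0.trans_le z.heap) y y'
  refine ⟨_, υ, x.seq x', ?_, w, z.trans z'⟩
  rw [Nat.succ_mul]; omega

end RAM

open Enc

/-! ### Polynomial-time functions -/

section
variable {α β γ δ : Type} [Enc α] [Enc β] [Enc γ] [Enc δ]

/-- A numerical function that is bounded by a polynomial in the size of its argument. -/
def PolyBounded (h : α → ℕ) : Prop := ∃ k, ∀ x, h x ≤ (sz x + 2) ^ k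

/-- A function that is computed by a program in polynomial time, with results of polynomial
size. -/
@[fun_prop]
def PolyTime (f : α → β) : Prop :=
  ∃ (c : RAM.Cmd) (k : ℕ), ∀ x, RAM.Runs c (enc x) (enc (f x)) ((sz x + 2) ^ k) ∧
    sz (f x) ≤ (sz x + 2) ^ k

/-- The base is at least 2, so one more factor absorbs the doubling. This keeps all polynomial
bounds in the form of a single power. -/
theorem two_pow_add_le {s a b k l : ℕ} (ha : a ≤ (s + 2) ^ k) (hb : b ≤ (s + 2) ^ l) :
    a + b ≤ (s + 2) ^ (k + l + 1) := by
  have h1 : (s + 2) ^ k ≤ (s + 2) ^ (k + l) := Nat.pow_le_pow_right (by omega) (by omega)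
  have h2 : (s + 2) ^ l ≤ (s + 2) ^ (k + l) := Nat.pow_le_pow_right (by omega) (by omega)
  rw [pow_succ]
  nlinarith [Nat.zero_le s, Nat.zero_le ((s + 2) ^ (k + l))]

theorem PolyBounded.add {g h : α → ℕ} : PolyBounded g → PolyBounded h →
    PolyBounded fun x => g x + h x
  | ⟨_, hk⟩, ⟨_, hl⟩ => ⟨_, fun x => two_pow_add_le (hk x) (hl x)⟩

theorem PolyBounded.mul {g h : α → ℕ} : PolyBounded g → PolyBounded h →
    PolyBounded fun x => g x * h x
  | ⟨k, hk⟩, ⟨l, hl⟩ => ⟨k + l, fun x => by rw [pow_add]; exact Nat.mul_le_mul (hk x) (hl x)⟩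

theorem PolyBounded.const (n : ℕ) : PolyBounded fun _ : α => n :=
  ⟨n, fun x => (Nat.lt_pow_self (by omega)).le⟩

theorem PolyBounded.pow {g : α → ℕ} (n : ℕ) : PolyBounded g → PolyBounded fun x => g x ^ n
  | ⟨k, hk⟩ => ⟨k * n, fun x => by rw [pow_mul]; exact Nat.pow_le_pow_left (hk x) n⟩

theorem PolyBounded.sz : PolyBounded fun x : α => sz x := ⟨1, fun x => by simp⟩

theorem PolyBounded.mono {g h : α → ℕ} (H : ∀ x, g x ≤ h x) : PolyBounded h → PolyBounded g
  | ⟨k, hk⟩ => ⟨k, fun x => (H x).trans (hk x)⟩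

theorem PolyTime.size {f : α → β} : PolyTime f → PolyBounded fun x => sz (f x)
  | ⟨_, k, hk⟩ => ⟨k, fun x => (hk x).2⟩

theorem PolyTime.val {f : α → ℕ} (h : PolyTime f) : PolyBounded f :=
  h.size.mono fun x => by simp

theorem PolyBounded.comp {h : β → ℕ} {f : α → β} : PolyBounded h → PolyTime f →
    PolyBounded fun x => h (f x)
  | ⟨k, hk⟩, hf => (((hf.size.add (.const 2)).pow k).mono fun x => hk (f x))

theorem PolyTime.of_runs {f : α → β} {T S : α → ℕ} (c : RAM.Cmd)
    (h : ∀ x, RAM.Runs c (enc x) (enc (f x)) (T x)) (hS : ∀ x, sz (f x) ≤ S x)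
    (h2 : PolyBounded T) (h3 : PolyBounded S) : PolyTime f := by
  obtain ⟨k, hk⟩ := h2.add h3
  exact ⟨c, k, fun x => ⟨(h x).mono ((Nat.le_add_right _ _).trans (hk x)),
    (hS x).trans ((Nat.le_add_left _ _).trans (hk x))⟩⟩

/-- Consing is pairing and a truth value is a number as far as encodings are concerned, so such
changes of type need no program. -/
theorem PolyTime.congr_enc {f : α → β} {g : α → γ} (hf : PolyTime f)
    (h : ∀ x, enc (g x) = enc (f x)) : PolyTime g := by
  obtain ⟨c, k, hk⟩ := hf
  refine ⟨c, k, fun x => ?_⟩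
  unfold sz
  rw [h]
  exact hk x

@[fun_prop]
theorem PolyTime.id' : PolyTime fun x : α => x :=
  .of_runs _ (fun _ => RAM.runs_skip _) (fun _ => le_rfl) (.const 1) .sz

@[fun_prop]
theorem PolyTime.comp {g : β → γ} {f : α → β} (hg : PolyTime g) (hf : PolyTime f) :
    PolyTime fun x => g (f x) := by
  have h := hg.size.comp hf
  obtain ⟨c, k, hk⟩ := hf
  obtain ⟨c', k', hk'⟩ := hg
  refine .of_runs (.seq c c') (fun x => (hk x).1.seq (hk' (f x)).1) (fun _ => le_rfl) ?_ h
  exact .add (.pow k (.add .sz (.const 2)))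
    (.pow k' (.add (PolyTime.size ⟨c, k, hk⟩) (.const 2)))

theorem Data.exists_runs_const (d : Data) : ∃ c T, ∀ d', RAM.Runs c d' d T := by
  induction d with
  | nat n => exact ⟨_, _, fun d' => RAM.runs_const d' n⟩
  | pair x y hx hy =>
    obtain ⟨c, T, h⟩ := hx
    obtain ⟨c', T', h'⟩ := hy
    exact ⟨_, _, fun d' => (h d').pair (h' d')⟩

@[fun_prop]
theorem PolyTime.const (b : β) : PolyTime fun _ : α => b := by
  obtain ⟨c, T, h⟩ := Data.exists_runs_const (enc b)
  exact .of_runs c (fun _ => h _) (fun _ => le_rfl) (.const T) (.const (sz b))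

@[fun_prop]
theorem PolyTime.fst' : PolyTime fun x : α × β => x.1 :=
  .of_runs _ (fun _ => RAM.runs_fst _ _) (fun x => by rw [sz_pair]; omega) (.const 1) .sz

@[fun_prop]
theorem PolyTime.snd' : PolyTime fun x : α × β => x.2 :=
  .of_runs _ (fun _ => RAM.runs_snd _ _) (fun x => by rw [sz_pair]; omega) (.const 3) .sz

@[fun_prop]
theorem PolyTime.prodMk {f : α → β} {g : α → γ} (hf : PolyTime f) (hg : PolyTime g) :
    PolyTime fun x => (f x, g x) := by
  have h := (hf.size.add hg.size).add (.const 1)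
  obtain ⟨c, k, hk⟩ := hf
  obtain ⟨c', k', hk'⟩ := hg
  exact .of_runs _ (fun x => (hk x).1.pair (hk' x).1) (fun _ => le_rfl)
    (.add (.add (.pow k (.add .sz (.const 2))) (.pow k' (.add .sz (.const 2)))) (.const 29)) h

@[fun_prop]
theorem PolyTime.add {f g : α → ℕ} (hf : PolyTime f) (hg : PolyTime g) :
    PolyTime fun x => f x + g x :=
  .comp (g := fun p : ℕ × ℕ => p.1 + p.2) (.of_runs (S := sz) _ (fun _ => RAM.runs_add _ _)
    (fun x => by simp; omega) (.const 5) .sz) (hf.prodMk hg)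

@[fun_prop]
theorem PolyTime.sub {f g : α → ℕ} (hf : PolyTime f) (hg : PolyTime g) :
    PolyTime fun x => f x - g x :=
  .comp (g := fun p : ℕ × ℕ => p.1 - p.2) (.of_runs (S := sz) _ (fun _ => RAM.runs_sub _ _)
    (fun x => by simp; omega) (.const 5) .sz) (hf.prodMk hg)

/-- The first branch needs a program only where the test succeeds. This is what destructuring a list
requires, since an empty list has no components to load. -/
theorem PolyTime.test {e : α → γ} {f g : α → β} (he : PolyTime e)
    (p : α → Prop) [DecidablePred p]
    (hp : ∀ x, p x ↔ RAM.Truthy (enc (e x)))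
    (hf : ∃ (c : RAM.Cmd) (T : α → ℕ), PolyBounded T ∧
      ∀ x, p x → RAM.Runs c (.pair (enc x) (enc (e x))) (enc (f x)) (T x))
    (hfs : PolyBounded fun x => sz (if p x then f x else g x))
    (hg : PolyTime g) : PolyTime fun x => if p x then f x else g x := by
  have := hg.size
  obtain ⟨c₀, k₀, hk₀⟩ := he
  obtain ⟨c, T, hT, hc⟩ := hf
  obtain ⟨c', k', hk'⟩ := hg
  refine .of_runs (.seq (RAM.pairCmd .skip c₀) (RAM.testCmd c c')) (fun x => ?_)
    (fun x => le_rfl) (T := fun x => (1 + (sz x + 2) ^ k₀ + 29) + (T x + (sz x + 2) ^ k' + 5))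
    (.add (.add (.add (.const 1) (.pow k₀ (.add .sz (.const 2)))) (.const 29))
      (.add (.add hT (.pow k' (.add .sz (.const 2)))) (.const 5))) hfs
  refine ((RAM.runs_skip _).pair (hk₀ x).1).seq ?_
  split_ifs with h
  · exact (RAM.Runs.test_true ((hp x).1 h) (hc x h)).mono (by omega)
  · exact (RAM.Runs.test_false (mt (hp x).2 h) (hk' x).1).mono (by omega)

@[fun_prop]
theorem PolyTime.ite {p : α → Prop} [DecidablePred p] {f g : α → β}
    (hp : PolyTime fun x => decide (p x)) (hf : PolyTime f) (hg : PolyTime g) :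
    PolyTime fun x => if p x then f x else g x := by
  have hs := hf.size
  have hs' := hg.size
  refine PolyTime.test hp p (fun x => ?_) ?_ ((hs.add hs').mono fun x => ?_) hg
  · by_cases h : p x <;> simp [h, enc, RAM.Truthy]
  · obtain ⟨c, k, hk⟩ := hf
    exact ⟨_, _, .add (.const 1) (.pow k (.add .sz (.const 2))), fun x _ =>
      (RAM.runs_fst _ _).seq (hk x).1⟩
  · split_ifs <;> omega

/-- Case distinction on a list. -/
def listCases (l : List α) (b : β) (f : α → List α → β) : β :=
  match l with
  | [] => b
  | a :: l => f a l

theorem PolyTime.listCases {l : γ → List α} {b : γ → β} {f : γ → α → List α → β}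
    (hl : PolyTime l) (hb : PolyTime b) (hf : PolyTime fun q : γ × α × List α => f q.1 q.2.1 q.2.2) :
    PolyTime fun x => listCases (l x) (b x) (f x) := by
  have hs := hf.size
  obtain ⟨k, hk⟩ := hs
  obtain ⟨k', hk'⟩ := hb.size
  have key : ∀ x, (if l x ≠ [] then _root_.listCases (l x) (b x) (f x) else b x) =
      _root_.listCases (l x) (b x) (f x) := fun x => by
    cases h : l x <;> simp [_root_.listCases]
  have hpl : PolyBounded fun x => (sz x + sz (l x) + 2 + 2) :=
    .add (.add (.add .sz hl.size) (.const 2)) (.const 2)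
  have := PolyTime.test (f := fun x => _root_.listCases (l x) (b x) (f x))
    hl (fun x => l x ≠ []) (fun x => ?_) ?_
    (((hpl.pow k).add hb.size).mono fun x => ?_) hb
  · simpa only [key] using this
  · cases h : l x <;> simp [enc, encList, RAM.Truthy]
  · obtain ⟨c, k, hk⟩ := hf
    refine ⟨c, _, hpl.pow k, fun x hx => ?_⟩
    cases h : l x with
    | nil => exact absurd h hx
    | cons a t =>
      refine (hk (x, a, t)).1.mono (Nat.pow_le_pow_left ?_ _)
      simp
  · rw [key]
    cases h : l x with
    | nil => simp [_root_.listCases]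
    | cons a t =>
      refine le_trans ((hk (x, a, t)).trans (Nat.pow_le_pow_left ?_ _)) (Nat.le_add_right _ _)
      simp

@[fun_prop]
theorem PolyTime.cons {f : γ → α} {g : γ → List α} (hf : PolyTime f) (hg : PolyTime g) :
    PolyTime fun x => f x :: g x :=
  (hf.prodMk hg).congr_enc fun _ => rfl

/-- The number of rounds `m` and the size bound `B` stay free instead of being polynomials in the
argument: the outermost search makes a number of rounds that no polynomial in the input length
bounds. -/
theorem PolyTime.exists_while {t : α → Bool} {s : α → α} (ht : PolyTime t) (hs : PolyTime s) :
    ∃ (c : RAM.Cmd) (k : ℕ), ∀ (x : α) (m B : ℕ), (∀ j < m, t (s^[j] x) = true) →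
      t (s^[m] x) = false → (∀ j ≤ m, sz (s^[j] x) ≤ B) →
      RAM.Runs c (enc x) (enc (s^[m] x)) ((m + 1) * (B + 2) ^ k) := by
  obtain ⟨c, k, hk⟩ := ht
  obtain ⟨c', k', hk'⟩ := hs
  -- One power for test plus body, and one for the constant overhead `40 ≤ 2 ^ 6` of a round.
  refine ⟨RAM.whileCmd c c', k + k' + 1 + 6 + 1, fun x m B h1 h2 h3 => ?_⟩
  have hp : ∀ j ≤ m, ∀ k, (sz (s^[j] x) + 2) ^ k ≤ (B + 2) ^ k := fun j hj k =>
    Nat.pow_le_pow_left (Nat.add_le_add_right (h3 j hj) 2) k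
  refine (RAM.Runs.while (m := m) (d := fun j => enc (s^[j] x)) (e := fun j => enc (t (s^[j] x)))
    (T' := (B + 2) ^ k') (fun j hj => (hk _).1.mono (hp j hj k)) (fun j hj => ?_)
    (fun j hj => ?_) ?_).mono ?_
  · simp only [Function.iterate_succ_apply']
    exact (hk' _).1.mono (hp j hj.le k')
  · simp [h1 j hj, enc, RAM.Truthy]
  · simp [h2, enc, RAM.Truthy]
  · refine Nat.mul_le_mul_left _ (two_pow_add_le (k := k + k' + 1) (l := 6)
      (two_pow_add_le le_rfl le_rfl) ?_)
    calc 40 ≤ 2 ^ 6 := by norm_num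
      _ ≤ _ := Nat.pow_le_pow_left (by omega) 6

theorem PolyTime.while {t : α → Bool} {s : α → α} (ht : PolyTime t) (hs : PolyTime s)
    {f : γ → α} (hf : PolyTime f) (m B : γ → ℕ) (hm : PolyBounded m) (hB : PolyBounded B)
    (h1 : ∀ x, ∀ j < m x, t (s^[j] (f x)) = true) (h2 : ∀ x, t (s^[m x] (f x)) = false)
    (h3 : ∀ x, ∀ j ≤ m x, sz (s^[j] (f x)) ≤ B x) : PolyTime fun x => s^[m x] (f x) := by
  obtain ⟨c, k, hk⟩ := PolyTime.exists_while ht hs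
  obtain ⟨c', k', hk'⟩ := hf
  exact .of_runs (.seq c' c) (fun x => (hk' x).1.seq (hk _ _ _ (h1 x) (h2 x) (h3 x)))
    (fun x => h3 x _ le_rfl) (.add (.pow k' (.add .sz (.const 2)))
      (.mul (.add hm (.const 1)) (.pow k (.add hB (.const 2))))) hB

/-! ### Sizes of lists, and folds in polynomial time. -/

theorem length_le_sz (l : List α) : l.length ≤ sz l := by
  induction l with
  | nil => simp
  | cons a l ih => simp; omega

theorem one_le_size (d : Data) : 1 ≤ d.size := by cases d <;> simp [Data.size]

theorem sz_append (l l' : List α) : sz (l ++ l') + 1 = sz l + sz l' := by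
  induction l with
  | nil => simp; omega
  | cons a l ih => simp; omega

theorem sz_le_of_prefix {l l' : List α} (h : l <+: l') : sz l ≤ sz l' := by
  obtain ⟨t, rfl⟩ := h
  have := sz_append l t
  have := one_le_size (enc t)
  unfold sz at *
  omega

theorem sz_le_of_suffix {l l' : List α} (h : l <:+ l') : sz l ≤ sz l' := by
  obtain ⟨t, rfl⟩ := h
  have := sz_append t l
  have := one_le_size (enc t)
  unfold sz at *
  omega

theorem sz_le_of_mem {a : α} {l : List α} (h : a ∈ l) : sz a < sz l := by
  induction l with
  | nil => simp at h
  | cons b l ih =>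
    rcases List.mem_cons.1 h with rfl | h
    · simp
    · have := ih h; simp; omega

theorem sz_le_of_sublist {l l' : List α} (h : l.Sublist l') : sz l ≤ sz l' := by
  induction h with
  | slnil => rfl
  | cons a _ ih => simp; omega
  | cons_cons a _ ih => simp; omega

/-- A loop whose state consists of the parameters, the rest of the list and the accumulator.
Polynomially bounded accumulators are what keeps every round polynomial. -/
theorem PolyTime.foldl_of_bounded {l : γ → List α} {i : γ → β} {g : γ → β → α → β}
    (hl : PolyTime l) (hi : PolyTime i) (hg : PolyTime fun q : γ × β × α => g q.1 q.2.1 q.2.2)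
    (h : γ → ℕ) (hh : PolyBounded h)
    (hb : ∀ x l', l' <+: l x → sz (l'.foldl (g x) (i x)) ≤ h x) :
    PolyTime fun x => (l x).foldl (g x) (i x) := by
  let s : γ × List α × β → γ × List α × β := fun q =>
    _root_.listCases q.2.1 q fun a t => (q.1, t, g q.1 q.2.2 a)
  have hs : PolyTime s := by
    refine PolyTime.listCases (by fun_prop) (by fun_prop) (.prodMk (by fun_prop) (.prodMk
      (by fun_prop) ?_))
    exact hg.comp (f := fun q : (γ × List α × β) × α × List α => (q.1.1, q.1.2.2, q.2.1))
      (by fun_prop)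
  have ht : PolyTime fun q : γ × List α × β => _root_.listCases q.2.1 false fun _ _ => true :=
    PolyTime.listCases (by fun_prop) (by fun_prop) (by fun_prop)
  have key : ∀ x (j : ℕ), j ≤ (l x).length →
      s^[j] (x, l x, i x) = (x, (l x).drop j, ((l x).take j).foldl (g x) (i x)) := by
    intro x j
    induction j with
    | zero => simp
    | succ j ih =>
      intro hj
      have hd := List.drop_eq_getElem_cons (l := l x) (i := j) (by omega)
      have ht : (l x).take (j + 1) = (l x).take j ++ [(l x)[j]] := by
        rw [List.take_add_one, List.getElem?_eq_getElem (by omega)]; rfl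
      rw [Function.iterate_succ_apply', ih (by omega), ht, List.foldl_append]
      simp only [s]
      rw [hd]
      rfl
  have := PolyTime.while ht hs (f := fun x : γ => (x, l x, i x)) (by fun_prop)
    (fun x => (l x).length) (fun x => sz x + (sz (l x) + h x + 1) + 1)
    (hl.size.mono fun x => length_le_sz _)
    (.add (.add .sz (.add (.add hl.size hh) (.const 1))) (.const 1))
    (fun x j hj => by
      rw [key x j hj.le, List.drop_eq_getElem_cons (by omega)]; rfl)
    (fun x => by rw [key x _ le_rfl, List.drop_length]; rfl)
    (fun x j hj => by
      rw [key x j hj]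
      have h1 := hb x _ (List.take_prefix j (l x))
      have h2 := sz_le_of_suffix (List.drop_suffix j (l x))
      simp
      omega)
  have e : ∀ x, (s^[(l x).length] (x, l x, i x)).2.2 = (l x).foldl (g x) (i x) := fun x => by
    rw [key x _ le_rfl, List.take_length]
  simpa only [e] using PolyTime.comp PolyTime.snd' (PolyTime.comp PolyTime.snd' this)

/-- Growth by an amount independent of the accumulator adds up to a polynomial over the whole list;
growth by a factor would not. -/
theorem PolyTime.foldl {l : γ → List α} {i : γ → β} {g : γ → β → α → β}
    (hl : PolyTime l) (hi : PolyTime i) (hg : PolyTime fun q : γ × β × α => g q.1 q.2.1 q.2.2)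
    (h : γ → ℕ) (hh : PolyBounded h)
    (hb : ∀ x b, ∀ a ∈ l x, sz (g x b a) ≤ sz b + h x) :
    PolyTime fun x => (l x).foldl (g x) (i x) := by
  refine .foldl_of_bounded hl hi hg (fun x => sz (i x) + sz (l x) * h x)
    (.add hi.size (.mul hl.size hh)) fun x l' hl' => ?_
  have key : ∀ (l' : List α) (b : β), (∀ a ∈ l', a ∈ l x) →
      sz (l'.foldl (g x) b) ≤ sz b + l'.length * h x := by
    intro l'
    induction l' with
    | nil => simp
    | cons a t ih =>
      intro b H
      have h1 := ih (g x b a) fun a' ha' => H a' (List.mem_cons_of_mem _ ha')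
      have h2 := hb x b a (H a List.mem_cons_self)
      rw [List.foldl_cons, List.length_cons, Nat.succ_mul]
      omega
  refine (key l' (i x) fun a ha => hl'.subset ha).trans ?_
  have := (hl'.length_le).trans (length_le_sz (l x))
  gcongr

end

/-! ### Arithmetic, tests and list functions in polynomial time. -/

section
variable {α β γ δ : Type} [Enc α] [Enc β] [Enc γ] [Enc δ]

@[fun_prop]
theorem PolyTime.decide_le {f g : γ → ℕ} (hf : PolyTime f) (hg : PolyTime g) :
    PolyTime fun x => decide (f x ≤ g x) := by
  -- Truncated subtraction turns the comparison into the number 0 or 1, which encodes the truth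
  -- value.
  refine PolyTime.congr_enc (f := fun x => 1 - (f x - g x)) (by fun_prop) fun x => ?_
  by_cases h : f x ≤ g x
  · simp [enc, h]
  · simp only [enc, h, decide_false, Bool.toNat_false, Data.nat.injEq]; omega

@[fun_prop]
theorem PolyTime.decide_not {p : γ → Prop} [DecidablePred p]
    (hp : PolyTime fun x => decide (p x)) : PolyTime fun x => decide (¬ p x) := by
  have : PolyTime fun x => if p x then false else true := by fun_prop
  convert this using 2 with x
  by_cases h : p x <;> simp [h]

@[fun_prop]
theorem PolyTime.decide_and {p q : γ → Prop} [DecidablePred p] [DecidablePred q]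
    (hp : PolyTime fun x => decide (p x)) (hq : PolyTime fun x => decide (q x)) :
    PolyTime fun x => decide (p x ∧ q x) := by
  have : PolyTime fun x => if p x then decide (q x) else false := by fun_prop
  convert this using 2 with x
  by_cases h : p x <;> simp [h]

@[fun_prop]
theorem PolyTime.decide_lt {f g : γ → ℕ} (hf : PolyTime f) (hg : PolyTime g) :
    PolyTime fun x => decide (f x < g x) :=
  PolyTime.decide_le (f := fun x => f x + 1) (by fun_prop) hg

@[fun_prop]
theorem PolyTime.decide_eq {f g : γ → ℕ} (hf : PolyTime f) (hg : PolyTime g) :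
    PolyTime fun x => decide (f x = g x) := by
  have : PolyTime fun x => decide (f x ≤ g x ∧ g x ≤ f x) := by fun_prop
  convert this using 3 with x
  exact le_antisymm_iff

@[fun_prop]
theorem PolyTime.decide_eq_prod {f g : γ → ℕ × ℕ} (hf : PolyTime f) (hg : PolyTime g) :
    PolyTime fun x => decide (f x = g x) := by
  have : PolyTime fun x => decide ((f x).1 = (g x).1 ∧ (f x).2 = (g x).2) := by fun_prop
  convert this using 3 with x
  exact Prod.ext_iff

@[fun_prop]
theorem PolyTime.decide_bool {f : γ → Bool} (hf : PolyTime f) :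
    PolyTime fun x => decide (f x = true) := by
  simpa using hf

@[fun_prop]
theorem PolyTime.and {f g : γ → Bool} (hf : PolyTime f) (hg : PolyTime g) :
    PolyTime fun x => f x && g x := by
  have : PolyTime fun x => decide (f x = true ∧ g x = true) := by fun_prop
  convert this using 2 with x
  simp

@[fun_prop]
theorem PolyTime.min {f g : γ → ℕ} (hf : PolyTime f) (hg : PolyTime g) :
    PolyTime fun x => min (f x) (g x) := by
  have : PolyTime fun x => if f x ≤ g x then f x else g x := by fun_prop
  simpa only [min_def] using this

@[fun_prop]
theorem PolyTime.reverse {l : γ → List α} (hl : PolyTime l) : PolyTime fun x => (l x).reverse := by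
  have : PolyTime fun x => (l x).foldl (fun b a => a :: b) [] :=
    PolyTime.foldl hl (.const []) (by fun_prop) (fun x => sz (l x) + 1)
      (.add hl.size (.const 1)) fun x b a ha => by
        have := sz_le_of_mem ha
        simp; omega
  simpa using this

@[fun_prop]
theorem PolyTime.append {l l' : γ → List α} (hl : PolyTime l) (hl' : PolyTime l') :
    PolyTime fun x => l x ++ l' x := by
  have : PolyTime fun x => (l x).reverse.foldl (fun b a => a :: b) (l' x) :=
    PolyTime.foldl hl.reverse hl' (by fun_prop) (fun x => sz (l x) + 1)
      (.add hl.size (.const 1)) fun x b a ha => by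
        have := sz_le_of_mem (List.mem_reverse.1 ha)
        simp; omega
  simpa using this

/-- A member of a list is smaller than the list, so a polynomial bound in the parameters and a
member becomes one in the parameters alone. -/
theorem PolyBounded.of_mem {l : γ → List α} {h : γ × α → ℕ} (hl : PolyTime l)
    (hh : PolyBounded h) : ∃ h' : γ → ℕ, PolyBounded h' ∧ ∀ x, ∀ a ∈ l x, h (x, a) ≤ h' x := by
  obtain ⟨k, hk⟩ := hh
  refine ⟨fun x => (_root_.sz x + _root_.sz (l x) + 3) ^ k,
    .pow k (.add (.add .sz hl.size) (.const 3)), fun x a ha => (hk _).trans ?_⟩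
  have := sz_le_of_mem ha
  refine Nat.pow_le_pow_left ?_ k
  simp; omega

@[fun_prop]
theorem PolyTime.flatMap {l : γ → List α} {f : γ → α → List β} (hl : PolyTime l)
    (hf : PolyTime fun q : γ × α => f q.1 q.2) : PolyTime fun x => (l x).flatMap (f x) := by
  obtain ⟨h, hh, hb⟩ := PolyBounded.of_mem hl hf.size
  have : PolyTime fun x => (l x).foldl (fun b a => b ++ f x a) [] := by
    refine PolyTime.foldl hl (.const []) ?_ h hh fun x b a ha => ?_
    · have := hf.comp (f := fun q : γ × List β × α => (q.1, q.2.2)) (by fun_prop)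
      fun_prop
    · have := sz_append b (f x a)
      have := hb x a ha
      dsimp only at this
      omega
  have e : ∀ x, (l x).foldl (fun b a => b ++ f x a) [] = (l x).flatMap (f x) := fun x => by
    have : ∀ (l : List α) (b : List β), l.foldl (fun b a => b ++ f x a) b = b ++ l.flatMap (f x) := by
      intro l
      induction l with
      | nil => simp
      | cons a l ih => intro b; simp [ih]
    simpa using this (l x) []
  simpa only [e] using this

@[fun_prop]
theorem PolyTime.map {l : γ → List α} {f : γ → α → β} (hl : PolyTime l)
    (hf : PolyTime fun q : γ × α => f q.1 q.2) : PolyTime fun x => (l x).map (f x) := by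
  have : PolyTime fun x => (l x).flatMap fun a => [f x a] := by fun_prop
  convert this using 2 with x
  exact List.map_eq_flatMap

@[fun_prop]
theorem PolyTime.filter {l : γ → List α} {p : γ → α → Bool} (hl : PolyTime l)
    (hp : PolyTime fun q : γ × α => p q.1 q.2) : PolyTime fun x => (l x).filter (p x) := by
  have : PolyTime fun x => (l x).flatMap fun a => if p x a = true then [a] else [] := by fun_prop
  convert this using 2 with x
  induction l x with
  | nil => rfl
  | cons a l ih => by_cases h : p x a = true <;> simp [h, ih]

@[fun_prop]
theorem PolyTime.length {l : γ → List α} (hl : PolyTime l) : PolyTime fun x => (l x).length := by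
  have : PolyTime fun x => (l x).foldl (fun b _ => b + 1) 0 :=
    PolyTime.foldl hl (.const 0) (by fun_prop) (fun x => 1) (.const 1) fun x b a _ => by simp
  convert this using 2 with x
  simp

@[fun_prop]
theorem PolyTime.decide_exists_mem {l : γ → List α} {p : γ → α → Prop} [∀ x, DecidablePred (p x)]
    [DecidablePred fun x => ∃ a ∈ l x, p x a] (hl : PolyTime l)
    (hp : PolyTime fun q : γ × α => decide (p q.1 q.2)) :
    PolyTime fun x => decide (∃ a ∈ l x, p x a) := by
  have : PolyTime fun x => decide (1 ≤ ((l x).filter fun a => decide (p x a)).length) := by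
    fun_prop
  convert this using 3 with x
  rw [Nat.one_le_iff_ne_zero, Ne, List.length_eq_zero_iff, List.filter_eq_nil_iff]
  simp

@[fun_prop]
theorem PolyTime.decide_forall_mem {l : γ → List α} {p : γ → α → Prop}
    [∀ x, DecidablePred (p x)] [DecidablePred fun x => ∀ a ∈ l x, p x a] (hl : PolyTime l)
    (hp : PolyTime fun q : γ × α => decide (p q.1 q.2)) :
    PolyTime fun x => decide (∀ a ∈ l x, p x a) := by
  have : PolyTime fun x => decide (((l x).filter fun a => decide (¬ p x a)).length ≤ 0) := by
    fun_prop
  convert this using 3 with x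
  rw [Nat.le_zero, List.length_eq_zero_iff, List.filter_eq_nil_iff]
  simp

@[fun_prop]
theorem PolyTime.decide_mem {l : γ → List ℕ} {f : γ → ℕ} (hl : PolyTime l) (hf : PolyTime f) :
    PolyTime fun x => decide (f x ∈ l x) := by
  have : PolyTime fun x => decide (∃ a ∈ l x, a = f x) := by fun_prop
  convert this using 3 with x
  simp

@[fun_prop]
theorem PolyTime.decide_mem_prod {l : γ → List (ℕ × ℕ)} {f : γ → ℕ × ℕ} (hl : PolyTime l)
    (hf : PolyTime f) : PolyTime fun x => decide (f x ∈ l x) := by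
  have : PolyTime fun x => decide (∃ a ∈ l x, a = f x) := by fun_prop
  convert this using 3 with x
  simp

@[fun_prop]
theorem PolyTime.take {l : γ → List α} {n : γ → ℕ} (hn : PolyTime n) (hl : PolyTime l) :
    PolyTime fun x => (l x).take (n x) := by
  have : PolyTime fun x => ((l x).foldl (fun (b : ℕ × List α) a =>
      (b.1 + 1, if b.1 < n x then a :: b.2 else b.2)) (0, [])).2.reverse := by
    have hn' := hn.comp (f := fun q : γ × (ℕ × List α) × α => q.1) (by fun_prop)
    refine PolyTime.reverse (PolyTime.comp PolyTime.snd' (PolyTime.foldl hl (.const _) ?_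
      (fun x => sz (l x) + 2) (.add hl.size (.const 2)) fun x b a ha => ?_))
    · fun_prop
    · have := sz_le_of_mem ha
      split_ifs <;> simp <;> omega
  convert this using 2 with x
  have key : ∀ (l : List α) (k : ℕ) (t : List α), (l.foldl (fun (b : ℕ × List α) a =>
      (b.1 + 1, if b.1 < n x then a :: b.2 else b.2)) (k, t)).2.reverse =
      t.reverse ++ l.take (n x - k) := by
    intro l
    induction l with
    | nil => simp
    | cons a l ih =>
      intro k t
      rw [List.foldl_cons, ih]
      by_cases h : k < n x
      · obtain ⟨m, hm⟩ : ∃ m, n x - k = m + 1 := ⟨n x - k - 1, by omega⟩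
        have : n x - (k + 1) = m := by omega
        simp [h, hm, this]
      · have h1 : n x - (k + 1) = 0 := by omega
        have h2 : n x - k = 0 := by omega
        simp [h, h1, h2]
  simpa using (key (l x) 0 []).symm

@[fun_prop]
theorem PolyTime.getD {l : γ → List α} {n : γ → ℕ} {d : γ → α} (hl : PolyTime l) (hn : PolyTime n)
    (hd : PolyTime d) : PolyTime fun x => (l x).getD (n x) (d x) := by
  have : PolyTime fun x => ((l x).foldl (fun (b : ℕ × α) a =>
      (b.1 + 1, if b.1 = n x then a else b.2)) (0, d x)).2 := by
    have hn' := hn.comp (f := fun q : γ × (ℕ × α) × α => q.1) (by fun_prop)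
    refine PolyTime.comp PolyTime.snd' (PolyTime.foldl hl (by fun_prop) ?_
      (fun x => sz (l x) + 2) (.add hl.size (.const 2)) fun x b a ha => ?_)
    · fun_prop
    · have := sz_le_of_mem ha
      split_ifs <;> simp <;> omega
  convert this using 2 with x
  have key : ∀ (l : List α) (k : ℕ) (t : α), (l.foldl (fun (b : ℕ × α) a =>
      (b.1 + 1, if b.1 = n x then a else b.2)) (k, t)).2 =
      if n x < k then t else l.getD (n x - k) t := by
    intro l
    induction l with
    | nil => simp
    | cons a l ih =>
      intro k t
      rw [List.foldl_cons, ih]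
      rcases lt_trichotomy (n x) k with h | h | h
      · simp [h, h.ne', show n x < k + 1 by omega]
      · simp [h]
      · obtain ⟨m, hm⟩ : ∃ m, n x - k = m + 1 := ⟨n x - k - 1, by omega⟩
        have : n x - (k + 1) = m := by omega
        simp [show ¬ n x < k by omega, show ¬ n x < k + 1 by omega, hm, this, h.ne]
  simpa using (key (l x) 0 (d x)).symm

@[fun_prop]
theorem PolyTime.range {n : γ → ℕ} (hn : PolyTime n) : PolyTime fun x => List.range (n x) := by
  -- Counting down puts the numbers in front of each other in increasing order.
  let s : ℕ × List ℕ → ℕ × List ℕ := fun q => (q.1 - 1, (q.1 - 1) :: q.2)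
  have key : ∀ m j : ℕ, j ≤ m → s^[j] (m, []) = (m - j, (List.range' (m - j) j)) := by
    intro m j
    induction j with
    | zero => simp
    | succ j ih =>
      intro hj
      rw [Function.iterate_succ_apply', ih (by omega)]
      simp only [s, List.range'_succ]
      rw [show m - (j + 1) + 1 = m - j by omega, show m - j - 1 = m - (j + 1) by omega]
  have bound : ∀ a j : ℕ, sz (List.range' a j) ≤ j * (a + j + 1) + 1 := by
    intro a j
    induction j generalizing a with
    | zero => simp
    | succ j ih =>
      have := ih (a + 1)
      rw [List.range'_succ]
      simp only [sz_cons, sz_nat]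
      nlinarith
  have := PolyTime.while (t := fun q : ℕ × List ℕ => decide (1 ≤ q.1)) (s := s) (by fun_prop)
    (by fun_prop) (f := fun x => (n x, [])) (by fun_prop) n
    (fun x => n x + 1 + (n x * (n x + 1) + 1) + 1) hn.val
    (.add (.add (.add hn.val (.const 1)) (.add (.mul hn.val (.add hn.val (.const 1))) (.const 1)))
      (.const 1))
    (fun x j hj => by rw [key _ _ hj.le]; simp; omega)
    (fun x => by rw [key _ _ le_rfl]; simp)
    (fun x j hj => by
      rw [key _ _ hj]
      have := bound (n x - j) j
      rw [show n x - j + j = n x by omega] at this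
      have h2 : j * (n x + 1) ≤ n x * (n x + 1) := Nat.mul_le_mul_right _ hj
      simp only [sz_pair, sz_nat]
      omega)
  have h2 := PolyTime.comp PolyTime.snd' this
  convert h2 using 2 with x
  rw [key _ _ le_rfl]
  simp [List.range_eq_range']

-- The machine has no multiplication, but counting the members of a rectangle is polynomial because
-- a number counts with its value.
@[fun_prop]
theorem PolyTime.mul {f g : γ → ℕ} (hf : PolyTime f) (hg : PolyTime g) :
    PolyTime fun x => f x * g x := by
  have : PolyTime fun x => ((List.range (f x)).flatMap fun _ => List.range (g x)).length := by
    fun_prop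
  convert this using 2 with x
  simp

@[fun_prop]
theorem PolyTime.headD {l : γ → List α} {d : γ → α} (hl : PolyTime l) (hd : PolyTime d) :
    PolyTime fun x => (l x).headD (d x) := by
  have : PolyTime fun x => (l x).getD 0 (d x) := by fun_prop
  convert this using 2 with x
  cases l x <;> simp

end

/-! ### Exact vector sums by variable elimination -/

/-- The vector of length `m` with the entries `f i`. -/
def mkVec (m : ℕ) (f : ℕ → ℕ) : List ℕ := (List.range m).map f

/-- Equality of the first `m` entries. -/
def VecEq (m : ℕ) (x y : List ℕ) : Prop := ∀ i ∈ List.range m, x.getD i 0 = y.getD i 0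

/-- Comparison of the first `m` entries. -/
def VecLe (m : ℕ) (x y : List ℕ) : Prop := ∀ i ∈ List.range m, x.getD i 0 ≤ y.getD i 0

instance (m : ℕ) (x y : List ℕ) : Decidable (VecEq m x y) := by unfold VecEq; infer_instance

instance (m : ℕ) (x y : List ℕ) : Decidable (VecLe m x y) := by unfold VecLe; infer_instance

/-- Remove duplicates. -/
def dedupVec (m : ℕ) (t : List (List ℕ)) : List (List ℕ) :=
  t.foldl (fun b x => if ∃ y ∈ b, VecEq m y x then b else x :: b) []

/-- All sums of a vector of `t` and a vector of `u` that are at most `τ`. -/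
def joinTable (τ : List ℕ) (t u : List (List ℕ)) : List (List ℕ) :=
  dedupVec τ.length ((t.flatMap fun x => u.map fun y =>
    mkVec τ.length fun i => x.getD i 0 + y.getD i 0).filter fun z => decide (VecLe τ.length z τ))

/-- Keep at most `K` entries, and record whether this was no restriction. -/
def capTable (K : ℕ) (b : Bool) (t : List (List ℕ)) : Bool × List (List ℕ) :=
  (b && decide (t.length ≤ K), t.take K)

/-- Join all tables, keeping at most `K` vectors each time. -/
def joinAll (K : ℕ) (τ : List ℕ) (b : Bool) (ts : List (List (List ℕ))) :
    Bool × List (List ℕ) :=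
  ts.foldl (fun s t => capTable K s.1 (joinTable τ s.2 t)) (b, [[]])

/-- The coordinate `v` does not vanish on the table `t`. -/
def Touches (v : ℕ) (t : List (List ℕ)) : Prop := ∃ x ∈ t, x.getD v 0 ≠ 0

instance (v : ℕ) (t : List (List ℕ)) : Decidable (Touches v t) := by
  unfold Touches; infer_instance

/-- Replace the joined table by its vectors that agree with `τ` at `v`. -/
def pushTable (τ : List ℕ) (v : ℕ) (s : Bool × List (List ℕ)) (ts : List (List (List ℕ))) :
    Bool × List (List (List ℕ)) :=
  (s.1, (s.2.filter fun x => decide (x.getD v 0 = τ.getD v 0)) :: ts)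

/-- Eliminate the coordinate `v`. -/
def elimCoord (K : ℕ) (τ : List ℕ) (s : Bool × List (List (List ℕ))) (v : ℕ) :
    Bool × List (List (List ℕ)) :=
  pushTable τ v (joinAll K τ s.1 (s.2.filter fun t => decide (Touches v t)))
    (s.2.filter fun t => decide (¬ Touches v t))

/-- The answer: `2` for yes, `1` for no, `0` for a failure. -/
def answer (τ : List ℕ) (s : Bool × List (List ℕ)) : ℕ :=
  if s.1 = true then if ∃ x ∈ s.2, VecEq τ.length x τ then 2 else 1 else 0

/-- Decide whether one can choose one vector from each table such that the sum is `τ`, by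
eliminating coordinates in the order `l`. -/
def vecSum (K : ℕ) (τ : List ℕ) (ts : List (List (List ℕ))) (l : List ℕ) : ℕ :=
  (fun s => answer τ (joinAll K τ s.1 s.2)) (l.foldl (elimCoord K τ) (true, ts))

/-! ### The elimination runs in polynomial time. -/

section
variable {γ : Type} [Enc γ]

@[fun_prop]
theorem PolyTime.mkVec {m : γ → ℕ} {f : γ → ℕ → ℕ} (hm : PolyTime m)
    (hf : PolyTime fun q : γ × ℕ => f q.1 q.2) : PolyTime fun x => mkVec (m x) (f x) := by
  unfold _root_.mkVec; fun_prop

@[fun_prop]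
theorem PolyTime.vecLe {m : γ → ℕ} {f g : γ → List ℕ} (hm : PolyTime m) (hf : PolyTime f)
    (hg : PolyTime g) : PolyTime fun x => decide (VecLe (m x) (f x) (g x)) := by
  unfold VecLe; fun_prop

@[fun_prop]
theorem PolyTime.dedupVec {m : γ → ℕ} {t : γ → List (List ℕ)} (hm : PolyTime m)
    (ht : PolyTime t) : PolyTime fun x => dedupVec (m x) (t x) := by
  refine PolyTime.foldl ht (.const []) ?_ (fun x => sz (t x) + 1) (.add ht.size (.const 1))
    fun x b a ha => ?_
  · fun_prop
  · have := sz_le_of_mem ha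
    split_ifs
    · omega
    · simp; omega

@[fun_prop]
theorem PolyTime.joinTable {τ : γ → List ℕ} {t u : γ → List (List ℕ)} (hτ : PolyTime τ)
    (ht : PolyTime t) (hu : PolyTime u) : PolyTime fun x => joinTable (τ x) (t x) (u x) := by
  unfold _root_.joinTable; fun_prop

@[fun_prop]
theorem PolyTime.capTable {K : γ → ℕ} {b : γ → Bool} {t : γ → List (List ℕ)} (hK : PolyTime K)
    (hb : PolyTime b) (ht : PolyTime t) : PolyTime fun x => capTable (K x) (b x) (t x) := by
  unfold _root_.capTable; fun_prop

theorem mem_dedupVec_subset {m : ℕ} {t : List (List ℕ)} : dedupVec m t ⊆ t := by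
  have : ∀ (t b : List (List ℕ)),
      t.foldl (fun b x => if ∃ y ∈ b, VecEq m y x then b else x :: b) b ⊆ t ++ b := by
    intro t
    induction t with
    | nil => simp
    | cons a t ih =>
      intro b x hx
      have := ih _ hx
      dsimp only at this
      split_ifs at this <;> simp at this ⊢ <;> tauto
  simpa [dedupVec] using this t []

theorem sz_le_of_entries {x τ : List ℕ} (hl : x.length = τ.length)
    (h : ∀ i < τ.length, x.getD i 0 ≤ τ.getD i 0) : sz x ≤ sz τ := by
  induction x generalizing τ with
  | nil => simp [List.length_eq_zero_iff.1 hl.symm]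
  | cons a x ih =>
    cases τ with
    | nil => simp at hl
    | cons b τ =>
      have h0 := h 0 (by simp)
      have := ih (τ := τ) (by simpa using hl) fun i hi => by
        simpa using h (i + 1) (by simpa using hi)
      simp at h0 ⊢
      omega

theorem sz_list_le {α : Type} [Enc α] {l : List α} {B : ℕ} (h : ∀ x ∈ l, sz x ≤ B) :
    sz l ≤ l.length * (B + 1) + 1 := by
  induction l with
  | nil => simp
  | cons a l ih =>
    have := ih fun x hx => h x (List.mem_cons_of_mem _ hx)
    have := h a List.mem_cons_self
    simp only [sz_cons, List.length_cons, Nat.succ_mul]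
    omega

theorem mem_joinTable_bound {τ : List ℕ} {t u : List (List ℕ)} {z : List ℕ}
    (hz : z ∈ joinTable τ t u) : z.length = τ.length ∧ VecLe τ.length z τ ∧
      ∃ x ∈ t, ∃ y ∈ u, z = mkVec τ.length fun i => x.getD i 0 + y.getD i 0 := by
  have := mem_dedupVec_subset hz
  simp only [List.mem_filter, List.mem_flatMap, List.mem_map, decide_eq_true_eq] at this
  obtain ⟨⟨x, hx, y, hy, rfl⟩, h⟩ := this
  exact ⟨by simp [mkVec], h, x, hx, y, hy, rfl⟩

/-- The sizes of `t` and `u` do not enter: at most `K` vectors are kept and each is bounded by `τ`.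
Without this, repeated joins could grow exponentially. -/
theorem sz_capTable_joinTable (K : ℕ) (b : Bool) (τ : List ℕ) (t u : List (List ℕ)) :
    sz (capTable K b (joinTable τ t u)) ≤ K * (sz τ + 1) + 4 := by
  have h1 := sz_bool_le (b && decide ((joinTable τ t u).length ≤ K))
  have h2 : sz ((joinTable τ t u).take K) ≤ K * (sz τ + 1) + 1 := by
    refine (sz_list_le (B := sz τ) fun z hz => ?_).trans ?_
    · obtain ⟨h, h', -⟩ := mem_joinTable_bound (List.mem_of_mem_take hz)
      exact sz_le_of_entries h fun i hi => h' i (List.mem_range.2 hi)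
    · have := List.length_take_le K (joinTable τ t u)
      gcongr
  simp only [capTable, sz_pair]
  omega

@[fun_prop]
theorem PolyTime.joinAll {K : γ → ℕ} {τ : γ → List ℕ} {b : γ → Bool}
    {ts : γ → List (List (List ℕ))} (hK : PolyTime K) (hτ : PolyTime τ) (hb : PolyTime b)
    (ht : PolyTime ts) : PolyTime fun x => joinAll (K x) (τ x) (b x) (ts x) := by
  refine PolyTime.foldl ht (by fun_prop) ?_ (fun x => K x * (sz (τ x) + 1) + 4)
    (.add (.mul hK.val (.add hτ.size (.const 1))) (.const 4)) fun x b a ha => ?_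
  · fun_prop
  · exact (sz_capTable_joinTable _ _ _ _ _).trans (Nat.le_add_left _ _)

theorem sz_joinAll (K : ℕ) (τ : List ℕ) (b : Bool) (ts : List (List (List ℕ))) :
    sz (joinAll K τ b ts) ≤ K * (sz τ + 1) + 6 := by
  induction ts using List.reverseRecOn with
  | nil =>
    have := sz_bool_le b
    simp only [joinAll, List.foldl_nil, sz_pair, sz_cons, sz_nil]
    omega
  | append_singleton ts t _ =>
    simp only [joinAll, List.foldl_append, List.foldl_cons, List.foldl_nil]
    exact (sz_capTable_joinTable _ _ _ _ _).trans (by omega)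

@[fun_prop]
theorem PolyTime.touches {v : γ → ℕ} {t : γ → List (List ℕ)} (hv : PolyTime v) (ht : PolyTime t) :
    PolyTime fun x => decide (Touches (v x) (t x)) := by
  unfold Touches; fun_prop

@[fun_prop]
theorem PolyTime.pushTable {τ : γ → List ℕ} {v : γ → ℕ} {s : γ → Bool × List (List ℕ)}
    {ts : γ → List (List (List ℕ))} (hτ : PolyTime τ) (hv : PolyTime v) (hs : PolyTime s)
    (ht : PolyTime ts) : PolyTime fun x => pushTable (τ x) (v x) (s x) (ts x) := by
  unfold _root_.pushTable; fun_prop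

@[fun_prop]
theorem PolyTime.elimCoord {K : γ → ℕ} {τ : γ → List ℕ} {s : γ → Bool × List (List (List ℕ))}
    {v : γ → ℕ} (hK : PolyTime K) (hτ : PolyTime τ) (hs : PolyTime s) (hv : PolyTime v) :
    PolyTime fun x => elimCoord (K x) (τ x) (s x) (v x) := by
  unfold _root_.elimCoord; fun_prop

@[fun_prop]
theorem PolyTime.answer {τ : γ → List ℕ} {s : γ → Bool × List (List ℕ)} (hτ : PolyTime τ)
    (hs : PolyTime s) : PolyTime fun x => answer (τ x) (s x) := by
  unfold _root_.answer; fun_prop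

@[fun_prop]
theorem PolyTime.vecSum {K : γ → ℕ} {τ : γ → List ℕ} {ts : γ → List (List (List ℕ))}
    {l : γ → List ℕ} (hK : PolyTime K) (hτ : PolyTime τ) (ht : PolyTime ts) (hl : PolyTime l) :
    PolyTime fun x => vecSum (K x) (τ x) (ts x) (l x) := by
  have : PolyTime fun x => (l x).foldl (_root_.elimCoord (K x) (τ x)) (true, ts x) := by
    -- Old tables are only discarded, and one capped table is added per coordinate.
    refine PolyTime.foldl hl (by fun_prop) ?_ (fun x => K x * (sz (τ x) + 1) + 7)
      (.add (.mul hK.val (.add hτ.size (.const 1))) (.const 7)) fun x b a ha => ?_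
    · fun_prop
    · have h1 := sz_joinAll (K x) (τ x) b.1 (b.2.filter fun t => decide (Touches a t))
      have h2 := sz_le_of_sublist (List.filter_sublist (l := b.2)
        (p := fun t => decide (¬ Touches a t)))
      have h3 := sz_le_of_sublist (List.filter_sublist
        (l := (_root_.joinAll (K x) (τ x) b.1 (b.2.filter fun t => decide (Touches a t))).2)
        (p := fun y => decide (y.getD a 0 = (τ x).getD a 0)))
      simp only [_root_.elimCoord, _root_.pushTable, sz_pair, sz_cons] at *
      omega
  unfold _root_.vecSum
  fun_prop

end

/-! ### Graph search and flows -/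

/-- The nodes that were found by a search. -/
def keys (ps : List (ℕ × ℕ)) : List ℕ := ps.map Prod.fst

/-- Follow the arc `e`; a new node is recorded together with its predecessor. -/
def relaxArc (ps : List (ℕ × ℕ)) (e : ℕ × ℕ) : List (ℕ × ℕ) :=
  if e.1 ∈ keys ps ∧ e.2 ∉ keys ps then (e.2, e.1) :: ps else ps

/-- The search from `s` along `arcs`, in `r` rounds. -/
def searchFrom (r : ℕ) (arcs : List (ℕ × ℕ)) (s : ℕ) : List (ℕ × ℕ) :=
  (List.range r).foldl (fun ps _ => arcs.foldl relaxArc ps) [(s, s)]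

/-- The component of `v` after the removal of `P`. -/
def compOf (n : ℕ) (E : List (ℕ × ℕ)) (P : List ℕ) (v : ℕ) : List ℕ :=
  keys (searchFrom n (E.filter fun e => decide (e.2 ∉ P)) v)

/-- The members of `P` with a neighbour in `C`. -/
def nbrsIn (E : List (ℕ × ℕ)) (P C : List ℕ) : List ℕ :=
  P.filter fun u => decide (∃ e ∈ E, e.1 ∈ C ∧ e.2 = u)

/-- The network for vertex cuts between `A` and `B`: the vertex `v` is split into `v` and `n + v`,
the source is `n + n` and the sink is `n + n + 1`. -/
def netArcs (n : ℕ) (E : List (ℕ × ℕ)) (A B : List ℕ) : List (ℕ × ℕ) :=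
  ((List.range n).map fun v => (v, n + v)) ++ ((E.map fun e => (n + e.1, e.2)) ++
    ((A.map fun a => (n + n, a)) ++ B.map fun b => (n + b, n + n + 1)))

/-- The residual arcs of the flow `F`. -/
def residualArcs (arcs F : List (ℕ × ℕ)) : List (ℕ × ℕ) :=
  (arcs.filter fun e => decide (e ∉ F)) ++ F.map fun e => (e.2, e.1)

/-- Push one unit of flow along `e`. -/
def flipArc (F : List (ℕ × ℕ)) (e : ℕ × ℕ) : List (ℕ × ℕ) :=
  if (e.2, e.1) ∈ F then F.filter fun e' => decide (¬ e' = (e.2, e.1)) else e :: F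

/-- One step of the way back along the predecessors. -/
def walkBack (q : ℕ × List (ℕ × ℕ)) (e : ℕ × ℕ) : ℕ × List (ℕ × ℕ) :=
  if e.1 = q.1 ∧ ¬ e.2 = e.1 then (e.2, flipArc q.2 (e.2, e.1)) else q

/-- The arcs that belong to `F`. -/
def keepArcs (arcs F : List (ℕ × ℕ)) : List (ℕ × ℕ) := arcs.filter fun e => decide (e ∈ F)

/-- Augment the flow `F` along the path to `t` that is stored in `ps`. -/
def augmentAlong (arcs : List (ℕ × ℕ)) (t : ℕ) (F ps : List (ℕ × ℕ)) : List (ℕ × ℕ) :=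
  if t ∈ keys ps then keepArcs arcs (ps.foldl walkBack (t, F)).2 else F

/-- A flow from `s` to `t` after at most `j` augmentations. -/
def maxFlow (j r : ℕ) (arcs : List (ℕ × ℕ)) (s t : ℕ) : List (ℕ × ℕ) :=
  (List.range j).foldl
    (fun F _ => augmentAlong arcs t F (searchFrom r (residualArcs arcs F) s)) []

/-- The arcs that leave `R`. -/
def cutArcs (R : List ℕ) (arcs : List (ℕ × ℕ)) : List (ℕ × ℕ) :=
  arcs.filter fun e => decide (e.1 ∈ R ∧ e.2 ∉ R)

/-- The vertex that is removed instead of the arc `e`. -/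
def arcVertex (n : ℕ) (e : ℕ × ℕ) : ℕ :=
  if e.2 = n + n + 1 then e.1 - n else if e.2 < n then e.2 else e.2 - n

/-- The vertex cut that belongs to the set `R` of nodes, if it is one and has at most `k + 1`
elements. -/
def cutOf (k n : ℕ) (arcs : List (ℕ × ℕ)) (R : List ℕ) : List (List ℕ) :=
  if n + n + 1 ∉ R ∧ (cutArcs R arcs).length ≤ k + 1 then
    [(cutArcs R arcs).map (arcVertex n)] else []

/-- The vertex cut in a network. -/
def netCut (k n : ℕ) (arcs : List (ℕ × ℕ)) : List (List ℕ) :=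
  cutOf k n arcs (keys (searchFrom (n + n + 2)
    (residualArcs arcs (maxFlow (k + 2) (n + n + 2) arcs (n + n) (n + n + 1))) (n + n)))

/-- All subsets of `W`, but not more than `K`. -/
def subsetsUpTo (K : ℕ) (W : List ℕ) : List (List ℕ) :=
  W.foldl (fun b a => (b ++ b.map fun s => a :: s).take K) [[]]

/-- The members of `W` outside `A`. -/
def listDiff (W A : List ℕ) : List ℕ := W.filter fun u => decide (u ∉ A)

/-- A vertex cut between `A` and the rest of `W`, provided that both have `k + 2` elements. -/
def sepFor (k n : ℕ) (E : List (ℕ × ℕ)) (W A : List ℕ) : List (List ℕ) :=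
  if k + 2 ≤ A.length ∧ k + 2 ≤ (listDiff W A).length then
    netCut k n (netArcs n E A (listDiff W A)) else []

/-- A vertex cut that splits `W` well. -/
def findSep (K k n : ℕ) (E : List (ℕ × ℕ)) (W : List ℕ) : List ℕ :=
  ((subsetsUpTo K W).flatMap fun A => sepFor k n E W A).headD []

/-- Place some vertices of the component `C` of `v`, which has the neighbours `W`. -/
def placeIn (K k n : ℕ) (E : List (ℕ × ℕ)) (P : List ℕ) (v : ℕ) (C W : List ℕ) : List ℕ :=
  if W.length ≤ 4 * k + 4 then v :: P else
    ((List.range n).filter fun u => decide (u ∈ C ∧ u ∈ findSep K k n E W)) ++ P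

/-- Place some vertices of the component `C` of `v`. -/
def placeComp (K k n : ℕ) (E : List (ℕ × ℕ)) (P : List ℕ) (v : ℕ) (C : List ℕ) : List ℕ :=
  placeIn K k n E P v C (nbrsIn E P C)

/-- Place some vertices. -/
def placeStep (K k n : ℕ) (E : List (ℕ × ℕ)) (P : List ℕ) : List ℕ :=
  listCases ((List.range n).filter fun u => decide (u ∉ P)) P fun v _ =>
    placeComp K k n E P v (compOf n E P v)

/-- An elimination order of the vertices. -/
def elimOrder (K k n : ℕ) (E : List (ℕ × ℕ)) : List ℕ :=
  (List.range n).foldl (fun P _ => placeStep K k n E P) []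

/-! ### The decision procedure -/

/-- The possible sizes of subtrees of parts. -/
def flowVals (n p : ℕ) : List ℕ :=
  (List.range (n + 1)).filter fun z => decide (p * z < n + p)

/-- The possible sizes of parts. -/
def rootVals (n p : ℕ) : List ℕ :=
  (flowVals n p).filter fun z => decide (n < p * z + p)

/-- The choices for an arc: no flow or a flow from `zs`. -/
def arcTable (n : ℕ) (zs : List ℕ) (e : ℕ × ℕ) : List (List ℕ) :=
  [] :: zs.map fun a => mkVec (n + 1) fun u =>
    if u = e.1 then 2 * (2 * zs.length - a) + 1 else if u = e.2 then 2 * a else 0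

/-- The choices for a vertex: not a root or the root of a part with size from `rs`. -/
def vertTable (n : ℕ) (zs rs : List ℕ) (v : ℕ) : List (List ℕ) :=
  [] :: rs.map fun z => mkVec (n + 1) fun u =>
    if u = v then 2 * (2 * zs.length - z) + 1 else if u = n then 1 else 0

/-- The required sum. -/
def target (n p : ℕ) (zs : List ℕ) : List ℕ :=
  mkVec (n + 1) fun u => if u = n then p else 4 * zs.length - 1

/-- All choices. -/
def allTables (n p : ℕ) (E : List (ℕ × ℕ)) : List (List (List ℕ)) :=
  (E.map fun e => arcTable n (flowVals n p) e) ++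
    (List.range n).map fun v => vertTable n (flowVals n p) (rootVals n p) v

/-- The attempt with tree-width `k` and the resource bound `K`. -/
def attemptWith (K n p : ℕ) (E : List (ℕ × ℕ)) (k : ℕ) : ℕ :=
  vecSum K (target n p (flowVals n p)) (allTables n p E) (elimOrder K k n E)

/-- The first successful attempt. -/
def attemptAll (K n p : ℕ) (E : List (ℕ × ℕ)) : ℕ :=
  (List.range (n + 1)).foldl (fun r k => if r = 0 then attemptWith K n p E k else r) 0

/-- The first `i` bits are ones. -/
def AllOnes (w : List Bool) (i : ℕ) : Prop := ∀ j ∈ List.range i, w.getD j false = true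

instance (w : List Bool) (i : ℕ) : Decidable (AllOnes w i) := by unfold AllOnes; infer_instance

/-- The number of vertices. -/
def readOrder (w : List Bool) : ℕ :=
  ((List.range w.length).filter fun i => decide (AllOnes w (i + 1))).length

/-- The list of arcs. -/
def readArcs (w : List Bool) (n : ℕ) : List (ℕ × ℕ) :=
  (List.range n).flatMap fun i => ((List.range n).filter fun j =>
    w.getD (n + 1 + i * n + j) false).map fun j => (i, j)

/-- The number of parts, but at most `n + 1`. -/
def readParts (w : List Bool) (n : ℕ) : ℕ :=
  (List.range w.length).reverse.foldl (fun r i => if n + 1 + n * n ≤ i then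
    min (r + r + if w.getD i false = true then 1 else 0) (n + 1) else r) 0

/-- The attempts for a given number of vertices. -/
def solveOrder (K : ℕ) (w : List Bool) (n : ℕ) : ℕ :=
  attemptAll K n (readParts w n) (readArcs w n)

/-- The attempts on the input `w` with the resource bound `K`. -/
def solveWith (K : ℕ) (w : List Bool) : ℕ := solveOrder K w (readOrder w)

/-! ### The decision procedure runs in polynomial time. -/

section
variable {γ : Type} [Enc γ]

@[fun_prop]
theorem PolyTime.keys {ps : γ → List (ℕ × ℕ)} (h : PolyTime ps) :
    PolyTime fun x => keys (ps x) := by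
  unfold _root_.keys; fun_prop

theorem sz_relaxArc (ps : List (ℕ × ℕ)) (e : ℕ × ℕ) : sz (relaxArc ps e) ≤ sz ps + (sz e + 1) := by
  unfold relaxArc
  split_ifs
  · simp; omega
  · omega

@[fun_prop]
theorem PolyTime.relaxArc {ps : γ → List (ℕ × ℕ)} {e : γ → ℕ × ℕ} (h : PolyTime ps)
    (he : PolyTime e) : PolyTime fun x => relaxArc (ps x) (e x) := by
  unfold _root_.relaxArc; fun_prop

theorem sz_foldl_relaxArc (arcs ps : List (ℕ × ℕ)) :
    sz (arcs.foldl relaxArc ps) ≤ sz ps + sz arcs := by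
  induction arcs generalizing ps with
  | nil => simp
  | cons e arcs ih =>
    have h1 := ih (relaxArc ps e)
    have h2 := sz_relaxArc ps e
    rw [List.foldl_cons, sz_cons]
    omega

@[fun_prop]
theorem PolyTime.searchFrom {r : γ → ℕ} {arcs : γ → List (ℕ × ℕ)} {s : γ → ℕ} (hr : PolyTime r)
    (ha : PolyTime arcs) (hs : PolyTime s) :
    PolyTime fun x => searchFrom (r x) (arcs x) (s x) := by
  refine PolyTime.foldl (by fun_prop) (by fun_prop) ?_ (fun x => sz (arcs x)) ha.size
    fun x b a _ => sz_foldl_relaxArc _ _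
  refine PolyTime.foldl (l := fun q : γ × List (ℕ × ℕ) × ℕ => arcs q.1)
    (g := fun q => _root_.relaxArc) (by fun_prop) (by fun_prop) (by fun_prop)
    (fun x => sz (arcs x.1)) (ha.size.comp (by fun_prop)) fun x b a h => ?_
  have := sz_relaxArc b a
  have := sz_le_of_mem h
  omega

@[fun_prop]
theorem PolyTime.compOf {n : γ → ℕ} {E : γ → List (ℕ × ℕ)} {P : γ → List ℕ} {v : γ → ℕ}
    (hn : PolyTime n) (hE : PolyTime E) (hP : PolyTime P) (hv : PolyTime v) :
    PolyTime fun x => compOf (n x) (E x) (P x) (v x) := by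
  unfold _root_.compOf; fun_prop

@[fun_prop]
theorem PolyTime.nbrsIn {E : γ → List (ℕ × ℕ)} {P C : γ → List ℕ} (hE : PolyTime E)
    (hP : PolyTime P) (hC : PolyTime C) : PolyTime fun x => nbrsIn (E x) (P x) (C x) := by
  unfold _root_.nbrsIn; fun_prop

@[fun_prop]
theorem PolyTime.netArcs {n : γ → ℕ} {E : γ → List (ℕ × ℕ)} {A B : γ → List ℕ} (hn : PolyTime n)
    (hE : PolyTime E) (hA : PolyTime A) (hB : PolyTime B) :
    PolyTime fun x => netArcs (n x) (E x) (A x) (B x) := by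
  unfold _root_.netArcs; fun_prop

@[fun_prop]
theorem PolyTime.residualArcs {arcs F : γ → List (ℕ × ℕ)} (ha : PolyTime arcs) (hF : PolyTime F) :
    PolyTime fun x => residualArcs (arcs x) (F x) := by
  unfold _root_.residualArcs; fun_prop

@[fun_prop]
theorem PolyTime.flipArc {F : γ → List (ℕ × ℕ)} {e : γ → ℕ × ℕ} (hF : PolyTime F)
    (he : PolyTime e) : PolyTime fun x => flipArc (F x) (e x) := by
  unfold _root_.flipArc; fun_prop

@[fun_prop]
theorem PolyTime.walkBack {q : γ → ℕ × List (ℕ × ℕ)} {e : γ → ℕ × ℕ} (hq : PolyTime q)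
    (he : PolyTime e) : PolyTime fun x => walkBack (q x) (e x) := by
  unfold _root_.walkBack; fun_prop

theorem sz_walkBack (q : ℕ × List (ℕ × ℕ)) (e : ℕ × ℕ) :
    sz (walkBack q e) ≤ sz q + (2 * sz e + 1) := by
  unfold walkBack flipArc
  have := sz_le_of_sublist (List.filter_sublist (l := q.2)
    (p := fun e' => decide (¬ e' = (e.1, e.2))))
  split_ifs <;> simp at * <;> omega

theorem PolyTime.keepArcs {arcs F : γ → List (ℕ × ℕ)} (ha : PolyTime arcs) (hF : PolyTime F) :
    PolyTime fun x => keepArcs (arcs x) (F x) := by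
  unfold _root_.keepArcs; fun_prop

@[fun_prop]
theorem PolyTime.augmentAlong {arcs F ps : γ → List (ℕ × ℕ)} {t : γ → ℕ} (ha : PolyTime arcs)
    (ht : PolyTime t) (hF : PolyTime F) (hp : PolyTime ps) :
    PolyTime fun x => augmentAlong (arcs x) (t x) (F x) (ps x) := by
  have : PolyTime fun x => (ps x).foldl _root_.walkBack (t x, F x) := by
    refine PolyTime.foldl (g := fun _ => _root_.walkBack) hp (by fun_prop) (by fun_prop)
      (fun x => 2 * sz (ps x) + 1) (.add (.mul (.const 2) hp.size) (.const 1)) fun x b a h => ?_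
    have := sz_walkBack b a
    have := sz_le_of_mem h
    omega
  exact PolyTime.ite (by fun_prop) (.keepArcs ha (.comp .snd' this)) hF

@[fun_prop]
theorem PolyTime.maxFlow {j r s t : γ → ℕ} {arcs : γ → List (ℕ × ℕ)} (hj : PolyTime j)
    (hr : PolyTime r) (ha : PolyTime arcs) (hs : PolyTime s) (ht : PolyTime t) :
    PolyTime fun x => maxFlow (j x) (r x) (arcs x) (s x) (t x) := by
  refine PolyTime.foldl (by fun_prop) (by fun_prop) (by fun_prop) (fun x => sz (arcs x)) ha.size
    fun x b a _ => ?_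
  -- After an augmentation `keepArcs` yields a sublist of the arcs, so flows do not grow from round
  -- to round.
  unfold _root_.augmentAlong
  split_ifs
  · exact (sz_le_of_sublist List.filter_sublist).trans (Nat.le_add_left _ _)
  · exact Nat.le_add_right _ _

@[fun_prop]
theorem PolyTime.cutArcs {R : γ → List ℕ} {arcs : γ → List (ℕ × ℕ)} (hR : PolyTime R)
    (ha : PolyTime arcs) : PolyTime fun x => cutArcs (R x) (arcs x) := by
  unfold _root_.cutArcs; fun_prop

@[fun_prop]
theorem PolyTime.arcVertex {n : γ → ℕ} {e : γ → ℕ × ℕ} (hn : PolyTime n) (he : PolyTime e) :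
    PolyTime fun x => arcVertex (n x) (e x) := by
  unfold _root_.arcVertex; fun_prop

@[fun_prop]
theorem PolyTime.cutOf {k n : γ → ℕ} {arcs : γ → List (ℕ × ℕ)} {R : γ → List ℕ} (hk : PolyTime k)
    (hn : PolyTime n) (ha : PolyTime arcs) (hR : PolyTime R) :
    PolyTime fun x => cutOf (k x) (n x) (arcs x) (R x) := by
  unfold _root_.cutOf; fun_prop

@[fun_prop]
theorem PolyTime.netCut {k n : γ → ℕ} {arcs : γ → List (ℕ × ℕ)} (hk : PolyTime k)
    (hn : PolyTime n) (ha : PolyTime arcs) :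
    PolyTime fun x => netCut (k x) (n x) (arcs x) := by
  unfold _root_.netCut; fun_prop

-- Each step may double the list, so additive growth is not available. The cap bounds the number of
-- subsets, and each subset is no larger than the prefix read so far.
@[fun_prop]
theorem PolyTime.subsetsUpTo {K : γ → ℕ} {W : γ → List ℕ} (hK : PolyTime K) (hW : PolyTime W) :
    PolyTime fun x => subsetsUpTo (K x) (W x) := by
  refine PolyTime.foldl_of_bounded hW (by fun_prop) (by fun_prop)
    (fun x => (K x + 1) * (sz (W x) + 1) + 1) (.add (.mul (.add hK.val (.const 1))
      (.add hW.size (.const 1))) (.const 1)) fun x l hl => ?_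
  have key : (l.foldl (fun b a => (b ++ b.map fun s => a :: s).take (K x)) [[]]).length ≤ K x + 1 ∧
      ∀ s ∈ l.foldl (fun b a => (b ++ b.map fun s => a :: s).take (K x)) [[]], sz s ≤ sz l := by
    clear hl
    induction l using List.reverseRecOn with
    | nil => simp
    | append_singleton l a ih =>
      rw [List.foldl_append, List.foldl_cons, List.foldl_nil]
      refine ⟨(List.length_take_le _ _).trans (Nat.le_succ _), fun s hs => ?_⟩
      have h2 := sz_append l [a]
      simp only [sz_cons, sz_nil, sz_nat] at h2
      rcases List.mem_append.1 (List.mem_of_mem_take hs) with h | h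
      · have := ih.2 s h; omega
      · obtain ⟨s', hs', rfl⟩ := List.mem_map.1 h
        have := ih.2 s' hs'
        simp only [sz_cons, sz_nat]; omega
  have h1 := sz_le_of_prefix hl
  refine (sz_list_le (B := sz (W x)) fun s hs => (key.2 s hs).trans h1).trans ?_
  gcongr
  exact key.1

@[fun_prop]
theorem PolyTime.listDiff {W A : γ → List ℕ} (hW : PolyTime W) (hA : PolyTime A) :
    PolyTime fun x => listDiff (W x) (A x) := by
  unfold _root_.listDiff; fun_prop

@[fun_prop]
theorem PolyTime.sepFor {k n : γ → ℕ} {E : γ → List (ℕ × ℕ)} {W A : γ → List ℕ} (hk : PolyTime k)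
    (hn : PolyTime n) (hE : PolyTime E) (hW : PolyTime W) (hA : PolyTime A) :
    PolyTime fun x => sepFor (k x) (n x) (E x) (W x) (A x) := by
  unfold _root_.sepFor; fun_prop

@[fun_prop]
theorem PolyTime.findSep {K k n : γ → ℕ} {E : γ → List (ℕ × ℕ)} {W : γ → List ℕ}
    (hK : PolyTime K) (hk : PolyTime k) (hn : PolyTime n) (hE : PolyTime E) (hW : PolyTime W) :
    PolyTime fun x => findSep (K x) (k x) (n x) (E x) (W x) := by
  unfold _root_.findSep; fun_prop

@[fun_prop]
theorem PolyTime.placeIn {K k n v : γ → ℕ} {E : γ → List (ℕ × ℕ)} {P C W : γ → List ℕ}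
    (hK : PolyTime K) (hk : PolyTime k) (hn : PolyTime n) (hE : PolyTime E) (hP : PolyTime P)
    (hv : PolyTime v) (hC : PolyTime C) (hW : PolyTime W) :
    PolyTime fun x => placeIn (K x) (k x) (n x) (E x) (P x) (v x) (C x) (W x) := by
  unfold _root_.placeIn; fun_prop

@[fun_prop]
theorem PolyTime.placeComp {K k n v : γ → ℕ} {E : γ → List (ℕ × ℕ)} {P C : γ → List ℕ}
    (hK : PolyTime K) (hk : PolyTime k) (hn : PolyTime n) (hE : PolyTime E) (hP : PolyTime P)
    (hv : PolyTime v) (hC : PolyTime C) :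
    PolyTime fun x => placeComp (K x) (k x) (n x) (E x) (P x) (v x) (C x) := by
  unfold _root_.placeComp; fun_prop

@[fun_prop]
theorem PolyTime.placeStep {K k n : γ → ℕ} {E : γ → List (ℕ × ℕ)} {P : γ → List ℕ}
    (hK : PolyTime K) (hk : PolyTime k) (hn : PolyTime n) (hE : PolyTime E) (hP : PolyTime P) :
    PolyTime fun x => placeStep (K x) (k x) (n x) (E x) (P x) :=
  PolyTime.listCases (by fun_prop) hP (by fun_prop)

theorem sz_placeStep (K k n : ℕ) (E : List (ℕ × ℕ)) (P : List ℕ) :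
    sz (placeStep K k n E P) ≤ sz P + sz (List.range n) := by
  unfold placeStep
  cases h : (List.range n).filter fun u => decide (u ∉ P) with
  | nil => exact Nat.le_add_right _ _
  | cons v l =>
    simp only [listCases, placeComp, placeIn]
    split_ifs
    · have : v ∈ (List.range n).filter fun u => decide (u ∉ P) := by
        rw [h]; exact List.mem_cons_self
      have : v ∈ List.range n := List.mem_of_mem_filter this
      have := sz_le_of_mem this
      simp only [sz_cons]; omega
    · have h1 := sz_append ((List.range n).filter fun u => decide (u ∈ compOf n E P v ∧
        u ∈ findSep K k n E (nbrsIn E P (compOf n E P v)))) P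
      have h2 := sz_le_of_sublist (List.filter_sublist (l := List.range n)
        (p := fun u => decide (u ∈ compOf n E P v ∧
          u ∈ findSep K k n E (nbrsIn E P (compOf n E P v)))))
      omega

@[fun_prop]
theorem PolyTime.elimOrder {K k n : γ → ℕ} {E : γ → List (ℕ × ℕ)}
    (hK : PolyTime K) (hk : PolyTime k) (hn : PolyTime n) (hE : PolyTime E) :
    PolyTime fun x => elimOrder (K x) (k x) (n x) (E x) :=
  PolyTime.foldl (by fun_prop) (by fun_prop) (by fun_prop) (fun x => sz (List.range (n x)))
    (PolyTime.size (by fun_prop)) fun x b a _ => sz_placeStep _ _ _ _ _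

@[fun_prop]
theorem PolyTime.flowVals {n p : γ → ℕ} (hn : PolyTime n) (hp : PolyTime p) :
    PolyTime fun x => flowVals (n x) (p x) := by
  unfold _root_.flowVals; fun_prop

@[fun_prop]
theorem PolyTime.rootVals {n p : γ → ℕ} (hn : PolyTime n) (hp : PolyTime p) :
    PolyTime fun x => rootVals (n x) (p x) := by
  unfold _root_.rootVals; fun_prop

@[fun_prop]
theorem PolyTime.arcTable {n : γ → ℕ} {zs : γ → List ℕ} {e : γ → ℕ × ℕ} (hn : PolyTime n)
    (hz : PolyTime zs) (he : PolyTime e) : PolyTime fun x => arcTable (n x) (zs x) (e x) := by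
  unfold _root_.arcTable; fun_prop

@[fun_prop]
theorem PolyTime.vertTable {n v : γ → ℕ} {zs rs : γ → List ℕ} (hn : PolyTime n)
    (hz : PolyTime zs) (hr : PolyTime rs) (hv : PolyTime v) :
    PolyTime fun x => vertTable (n x) (zs x) (rs x) (v x) := by
  unfold _root_.vertTable; fun_prop

@[fun_prop]
theorem PolyTime.target {n p : γ → ℕ} {zs : γ → List ℕ} (hn : PolyTime n)
    (hp : PolyTime p) (hz : PolyTime zs) : PolyTime fun x => target (n x) (p x) (zs x) := by
  unfold _root_.target; fun_prop

@[fun_prop]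
theorem PolyTime.allTables {n p : γ → ℕ} {E : γ → List (ℕ × ℕ)} (hn : PolyTime n)
    (hp : PolyTime p) (hE : PolyTime E) : PolyTime fun x => allTables (n x) (p x) (E x) := by
  unfold _root_.allTables; fun_prop

@[fun_prop]
theorem PolyTime.attemptWith {K n p k : γ → ℕ} {E : γ → List (ℕ × ℕ)} (hK : PolyTime K)
    (hn : PolyTime n) (hp : PolyTime p) (hE : PolyTime E) (hk : PolyTime k) :
    PolyTime fun x => attemptWith (K x) (n x) (p x) (E x) (k x) := by
  unfold _root_.attemptWith; fun_prop

theorem answer_le (τ : List ℕ) (s : Bool × List (List ℕ)) : answer τ s ≤ 2 := by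
  unfold answer; split_ifs <;> simp

@[fun_prop]
theorem PolyTime.attemptAll {K n p : γ → ℕ} {E : γ → List (ℕ × ℕ)} (hK : PolyTime K)
    (hn : PolyTime n) (hp : PolyTime p) (hE : PolyTime E) :
    PolyTime fun x => attemptAll (K x) (n x) (p x) (E x) :=
  PolyTime.foldl (by fun_prop) (by fun_prop) (by fun_prop) (fun x => 3) (.const 3)
    fun x b a _ => by
      split_ifs
      · have : _root_.attemptWith (K x) (n x) (p x) (E x) a ≤ 2 := answer_le _ _
        simp only [sz_nat]; omega
      · omega

@[fun_prop]
theorem PolyTime.allOnes {w : γ → List Bool} {i : γ → ℕ} (hw : PolyTime w) (hi : PolyTime i) :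
    PolyTime fun x => decide (AllOnes (w x) (i x)) := by
  unfold AllOnes; fun_prop

@[fun_prop]
theorem PolyTime.readOrder {w : γ → List Bool} (hw : PolyTime w) :
    PolyTime fun x => readOrder (w x) := by
  unfold _root_.readOrder; fun_prop

@[fun_prop]
theorem PolyTime.readArcs {w : γ → List Bool} {n : γ → ℕ} (hw : PolyTime w) (hn : PolyTime n) :
    PolyTime fun x => readArcs (w x) (n x) := by
  unfold _root_.readArcs; fun_prop

@[fun_prop]
theorem PolyTime.readParts {w : γ → List Bool} {n : γ → ℕ} (hw : PolyTime w) (hn : PolyTime n) :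
    PolyTime fun x => readParts (w x) (n x) :=
  PolyTime.foldl (by fun_prop) (by fun_prop) (by fun_prop) (fun x => n x + 2)
    (.add hn.val (.const 2)) fun x b a _ => by
      split_ifs <;> simp only [sz_nat] <;> omega

@[fun_prop]
theorem PolyTime.solveWith {K : γ → ℕ} {w : γ → List Bool} (hK : PolyTime K) (hw : PolyTime w) :
    PolyTime fun x => solveWith (K x) (w x) := by
  unfold _root_.solveWith solveOrder; fun_prop

end

/-! ### The main program -/

namespace RAM

/-- Turn the input into a list in register `0`. -/
def readCmd : Cmd :=
  .seq (.seq (.const 6 1) (.seq (.add 2 0 6) (.seq (.add 5 0 4) (.const 0 0))))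
    (.loop 5 (.seq (.sub 5 5 6) (.seq (.load 3 5) consCmd)))

theorem exec_readCmd (w : List Bool) : ∃ t τ, Exec readCmd (start w) t τ ∧
    t ≤ 9 * w.length + 5 ∧ 0 < τ.reg 2 ∧ Holds τ 0 (enc w) := by
  -- The bits are consed from the last to the first, so with `j` bits left the register holds the
  -- list without its first `j` members.
  have loop : ∀ j, j ≤ w.length → ∀ σ : State, σ.reg 5 = j → σ.reg 6 = 1 → w.length < σ.reg 2 →
      (∀ i < w.length, σ.mem i = (w.getD i false).toNat) → Holds σ 0 (encList (w.drop j)) →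
      ∃ t τ, Exec (.loop 5 (.seq (.sub 5 5 6) (.seq (.load 3 5) consCmd))) σ t τ ∧
        t ≤ 9 * j + 1 ∧ 0 < τ.reg 2 ∧ Holds τ 0 (encList w) := by
    intro j
    induction j with
    | zero =>
      intro _ σ h5 _ h2 _ h
      exact ⟨1, σ, .loop_halt h5, le_rfl, by omega, by simpa using h⟩
    | succ j ih =>
      intro hj σ h5 h6 h2 hm h
      obtain ⟨τ', τ, hτ', hτ, hτm, hτ0, hτ2, hτ3, hτ5, hτ6⟩ : ∃ τ' τ,
          Exec (.sub 5 5 6) σ 1 τ' ∧ Exec (.load 3 5) τ' 1 τ ∧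
          τ.mem = σ.mem ∧ τ.reg 0 = σ.reg 0 ∧ τ.reg 2 = σ.reg 2 ∧ τ.reg 3 = σ.mem j ∧
          τ.reg 5 = j ∧ τ.reg 6 = 1 := by
        refine ⟨_, _, Exec.sub σ 5 5 6, Exec.load _ 3 5, ?_⟩
        simp [State.setReg, h5, h6]
      have e : w.drop j = w.getD j false :: w.drop (j + 1) := by
        rw [List.drop_eq_getElem_cons (by omega), List.getD_eq_getElem _ _ (by omega)]
      obtain ⟨υ, x, y, z, hr⟩ := holds_cons (σ := τ) (d := enc (w.getD j false))
        (e := encList (w.drop (j + 1))) (by omega)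
        (by simp only [Holds, enc, Data.Stored]; rw [hτ3, hm j (by omega)])
        (by unfold Holds; rw [hτm, hτ0, hτ2]; exact h)
      obtain ⟨t, ρ, p, q, r, s⟩ := ih (by omega) υ (by rw [hr 5 (by simp) (by simp) (by simp), hτ5])
        (by rw [hr 6 (by simp) (by simp) (by simp), hτ6]) (by have := z.heap; omega)
        (fun i hi => by rw [z.mem i (by omega), hτm, hm i hi])
        (by rw [e]; exact y)
      exact ⟨_, ρ, .loop_step (by omega) (hτ'.seq (hτ.seq x)) p, by omega, r, s⟩
  -- Register 4 is still 0, so adding it copies. The heap starts behind the input and never at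
  -- address 0, which is reserved for the empty list.
  obtain ⟨τ, h, h0, h2, h5, h6, hm⟩ : ∃ τ, Exec (.seq (.const 6 1) (.seq (.add 2 0 6)
      (.seq (.add 5 0 4) (.const 0 0)))) (start w) 4 τ ∧ τ.reg 0 = 0 ∧
      τ.reg 2 = w.length + 1 ∧ τ.reg 5 = w.length ∧ τ.reg 6 = 1 ∧ τ.mem = (start w).mem := by
    refine ⟨_, (Exec.const _ 6 1).seq ((Exec.add _ 2 0 6).seq ((Exec.add _ 5 0 4).seq
      (Exec.const _ 0 0))), ?_⟩
    simp [State.setReg, start]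
  obtain ⟨t, ρ, p, q, r, s⟩ := loop w.length le_rfl τ h5 h6 (by omega)
    (fun i _ => by rw [hm]; rfl) (by
      rw [List.drop_length]; simpa [Holds, encList, Data.Stored] using h0)
  exact ⟨_, ρ, h.seq p, by omega, r, s⟩

theorem sz_bits_le (w : List Bool) : sz w ≤ 3 * w.length + 1 := by
  induction w with
  | nil => simp
  | cons b w ih =>
    have := sz_bool_le b
    simp only [sz_cons, List.length_cons]; omega

/-- If `f K w` is a polynomial-time function, then there is a program that finds the first `K`
with `f K w ≠ 0` and tests whether this value is `2`. -/
theorem exists_search_program {f : ℕ → List Bool → ℕ}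
    (hf : PolyTime fun q : ℕ × List Bool => f q.1 q.2) :
    ∃ (c : Cmd) (k : ℕ), ∀ (w : List Bool) (K₀ : ℕ), f K₀ w ≠ 0 → ∃ K ≤ K₀, f K w ≠ 0 ∧
      ∃ t τ, Exec c (start w) t τ ∧ t ≤ (K₀ + w.length + 2) ^ k ∧
        τ.reg 0 = if f K w = 2 then 1 else 0 := by
  have h1 : PolyTime fun w : List Bool => (0, w) := by fun_prop
  have h2 : PolyTime fun q : ℕ × List Bool => decide (f q.1 q.2 = 0) := by fun_prop
  have h3 : PolyTime fun q : ℕ × List Bool => (q.1 + 1, q.2) := by fun_prop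
  have h4 : PolyTime fun q : ℕ × List Bool => if f q.1 q.2 = 2 then 1 else 0 := by fun_prop
  obtain ⟨c₁, k₁, hc₁⟩ := h1
  obtain ⟨c₂, k₂, hc₂⟩ := PolyTime.exists_while h2 h3
  obtain ⟨c₄, k₄, hc₄⟩ := h4
  have step : ∀ (w : List Bool) (j : ℕ),
      (fun q : ℕ × List Bool => (q.1 + 1, q.2))^[j] (0, w) = (j, w) := by
    intro w j
    induction j with
    | zero => rfl
    | succ j ih => rw [Function.iterate_succ_apply', ih]
  have hb : PolyBounded fun n : ℕ => 9 * n + 5 + ((3 * n + 3) ^ k₁ +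
      ((n + 1) * (4 * n + 7) ^ k₂ + (4 * n + 7) ^ k₄)) := by
    have hn : PolyBounded fun n : ℕ => n := PolyTime.id'.val
    refine .add (.add (.mul (.const 9) hn) (.const 5)) (.add (.pow _ (.add (.mul (.const 3) hn)
      (.const 3))) (.add (.mul (.add hn (.const 1)) (.pow _ (.add (.mul (.const 4) hn)
      (.const 7)))) (.pow _ (.add (.mul (.const 4) hn) (.const 7)))))
  obtain ⟨k, hk⟩ := hb
  -- The factor 2 turns the base `n + 3`, with `n = K₀ + w.length`, into `n + 2`, as `n + 3 ≤ (n +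
  -- 2) ^ 2`.
  refine ⟨.seq readCmd (.seq c₁ (.seq c₂ c₄)), k * 2, fun w K₀ hK₀ => ?_⟩
  have hex : ∃ K, f K w ≠ 0 := ⟨K₀, hK₀⟩
  classical
  let m := Nat.find hex
  have hm : m ≤ K₀ := Nat.find_min' hex hK₀
  refine ⟨m, hm, Nat.find_spec hex, ?_⟩
  have hsz := sz_bits_le w
  have r1 := (hc₁ w).1
  have r2 := hc₂ (0, w) m (K₀ + 3 * w.length + 3)
    (fun j hj => by rw [step]; simpa using Nat.find_min hex hj)
    (by rw [step]; simpa using Nat.find_spec hex)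
    (fun j hj => by rw [step]; simp; omega)
  rw [step] at r2
  have r4 := (hc₄ (m, w)).1
  obtain ⟨t, τ, x, ht, h0, h⟩ := exec_readCmd w
  obtain ⟨t', υ, x', ht', h', -⟩ := (r1.seq (r2.seq r4)) τ h0 h
  refine ⟨_, υ, x.seq x', ?_, h'⟩
  have b1 : (sz w + 2) ^ k₁ ≤ (3 * (K₀ + w.length) + 3) ^ k₁ := Nat.pow_le_pow_left (by omega) _
  have b2 : (m + 1) * (K₀ + 3 * w.length + 3 + 2) ^ k₂ ≤
      (K₀ + w.length + 1) * (4 * (K₀ + w.length) + 7) ^ k₂ :=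
    Nat.mul_le_mul (by omega) (Nat.pow_le_pow_left (by omega) _)
  have b3 : (sz (m, w) + 2) ^ k₄ ≤ (4 * (K₀ + w.length) + 7) ^ k₄ :=
    Nat.pow_le_pow_left (by simp; omega) _
  have b4 := hk (K₀ + w.length)
  have b5 : (sz (K₀ + w.length) + 2) ^ k ≤ (K₀ + w.length + 2) ^ (k * 2) := by
    rw [mul_comm, pow_mul]
    refine Nat.pow_le_pow_left ?_ k
    rw [sz_nat]; nlinarith
  refine le_trans ?_ (b4.trans b5)
  dsimp only
  omega

end RAM

open scoped Pointwise

/-! ### Correctness of the elimination -/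

/-- The entries of a vector, continued by zeros. -/
def entries (x : List ℕ) : ℕ → ℕ := fun i => x.getD i 0

/-- The vectors of a table. -/
def tableSet (t : List (List ℕ)) : Set (ℕ → ℕ) := {f | ∃ x ∈ t, entries x = f}

/-- All vectors of the table `t` have length at most `m`. -/
def LengthLe (m : ℕ) (t : List (List ℕ)) : Prop := ∀ x ∈ t, x.length ≤ m

theorem entries_eq_zero {x : List ℕ} {m i : ℕ} (h : x.length ≤ m) (hi : m ≤ i) :
    entries x i = 0 := by
  simp [entries, List.getElem?_eq_none (h.trans hi)]

theorem entries_mkVec (m : ℕ) (f : ℕ → ℕ) (i : ℕ) :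
    entries (mkVec m f) i = if i < m then f i else 0 := by
  by_cases h : i < m <;> simp [entries, mkVec, h]

theorem vecEq_iff {m : ℕ} {x y : List ℕ} (hx : x.length ≤ m) (hy : y.length ≤ m) :
    VecEq m x y ↔ entries x = entries y := by
  refine ⟨fun h => ?_, fun h i _ => congrFun h i⟩
  funext i
  by_cases hi : i < m
  · exact h i (List.mem_range.2 hi)
  · rw [entries_eq_zero hx (by omega), entries_eq_zero hy (by omega)]

theorem vecLe_iff {m : ℕ} {x y : List ℕ} (hx : x.length ≤ m) :
    VecLe m x y ↔ entries x ≤ entries y := by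
  refine ⟨fun h i => ?_, fun h i _ => h i⟩
  by_cases hi : i < m
  · exact h i (List.mem_range.2 hi)
  · rw [entries_eq_zero hx (by omega)]; exact Nat.zero_le _

theorem dedupVec_spec (m : ℕ) (t : List (List ℕ)) :
    (∀ x ∈ t, ∃ y ∈ dedupVec m t, VecEq m y x) ∧
      (dedupVec m t).Pairwise fun x y => ¬ VecEq m x y := by
  unfold dedupVec
  induction t using List.reverseRecOn with
  | nil => simp
  | append_singleton t a ih =>
    rw [List.foldl_append, List.foldl_cons, List.foldl_nil]
    split_ifs with h
    · refine ⟨fun x hx => ?_, ih.2⟩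
      rcases List.mem_append.1 hx with hx | hx
      · exact ih.1 x hx
      · rw [List.mem_singleton.1 hx]; exact h
    · refine ⟨fun x hx => ?_, List.pairwise_cons.2 ⟨fun y hy hay => h ⟨y, hy, fun i hi =>
        (hay i hi).symm⟩, ih.2⟩⟩
      rcases List.mem_append.1 hx with hx | hx
      · obtain ⟨y, hy, hyx⟩ := ih.1 x hx
        exact ⟨y, List.mem_cons_of_mem _ hy, hyx⟩
      · rw [List.mem_singleton.1 hx]
        exact ⟨a, List.mem_cons_self, fun i _ => rfl⟩

/-- Vectors are read as functions padded by zeros, so that joining becomes a Minkowski sum cut off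
at the target and the rest of the correctness proof is algebra of sets. -/
theorem tableSet_joinTable {τ : List ℕ} {t u : List (List ℕ)} (ht : LengthLe τ.length t)
    (hu : LengthLe τ.length u) :
    tableSet (joinTable τ t u) = (tableSet t + tableSet u) ∩ Set.Iic (entries τ) := by
  have hadd : ∀ x ∈ t, ∀ y ∈ u, entries (mkVec τ.length fun i => x.getD i 0 + y.getD i 0) =
      entries x + entries y := by
    intro x hx y hy
    funext i
    rw [entries_mkVec]
    split_ifs with hi
    · rfl
    · simp [entries_eq_zero (ht x hx) (not_lt.1 hi), entries_eq_zero (hu y hy) (not_lt.1 hi)]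
  ext f
  constructor
  · rintro ⟨z, hz, rfl⟩
    obtain ⟨hl, hle, x, hx, y, hy, rfl⟩ := mem_joinTable_bound hz
    exact ⟨⟨_, ⟨x, hx, rfl⟩, _, ⟨y, hy, rfl⟩, (hadd x hx y hy).symm⟩, (vecLe_iff hl.le).1 hle⟩
  · rintro ⟨⟨_, ⟨x, hx, rfl⟩, _, ⟨y, hy, rfl⟩, rfl⟩, hle⟩
    dsimp only at hle ⊢
    rw [← hadd x hx y hy] at hle ⊢
    obtain ⟨z, hz, hze⟩ := (dedupVec_spec τ.length ((t.flatMap fun x => u.map fun y =>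
      mkVec τ.length fun i => x.getD i 0 + y.getD i 0).filter fun z =>
        decide (VecLe τ.length z τ))).1 (mkVec τ.length fun i => x.getD i 0 + y.getD i 0) (by
          simp only [List.mem_filter, List.mem_flatMap, List.mem_map, decide_eq_true_eq]
          exact ⟨⟨x, hx, y, hy, rfl⟩, (vecLe_iff (by simp [mkVec])).2 hle⟩)
    exact ⟨z, hz, (vecEq_iff (mem_joinTable_bound hz).1.le (by simp [mkVec])).1 hze⟩

theorem capTable_eq {K : ℕ} {b : Bool} {t : List (List ℕ)} (h : (capTable K b t).1 = true) :
    b = true ∧ (capTable K b t).2 = t := by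
  simp only [capTable, Bool.and_eq_true, decide_eq_true_eq] at h ⊢
  exact ⟨h.1, List.take_of_length_le h.2⟩

theorem lengthLe_joinTable (τ : List ℕ) (t u : List (List ℕ)) :
    LengthLe τ.length (joinTable τ t u) := fun _ hz => (mem_joinTable_bound hz).1.le

theorem joinAll_append (K : ℕ) (τ : List ℕ) (b : Bool) (ts : List (List (List ℕ)))
    (t : List (List ℕ)) : joinAll K τ b (ts ++ [t]) =
      capTable K (joinAll K τ b ts).1 (joinTable τ (joinAll K τ b ts).2 t) := by
  simp [joinAll]

theorem joinAll_spec {K : ℕ} {τ : List ℕ} {b : Bool} {ts : List (List (List ℕ))}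
    (hl : ∀ t ∈ ts, LengthLe τ.length t) (h : (joinAll K τ b ts).1 = true) :
    b = true ∧ LengthLe τ.length (joinAll K τ b ts).2 ∧
      tableSet (joinAll K τ b ts).2 = (ts.map tableSet).sum ∩ Set.Iic (entries τ) := by
  induction ts using List.reverseRecOn with
  | nil =>
    refine ⟨h, by simp [joinAll, LengthLe], ?_⟩
    ext f
    simp only [joinAll, List.foldl_nil, tableSet, List.mem_singleton, exists_eq_left, List.map_nil,
      List.sum_nil, Set.mem_ofPred_eq, Set.mem_inter_iff, Set.mem_zero, Set.mem_Iic]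
    have : entries [] = 0 := by funext i; simp [entries]
    rw [this]
    constructor
    · rintro rfl; exact ⟨rfl, fun i => Nat.zero_le _⟩
    · rintro ⟨rfl, -⟩; rfl
  | append_singleton ts t ih =>
    rw [joinAll_append] at h ⊢
    obtain ⟨h1, h2⟩ := capTable_eq h
    obtain ⟨hb, hl', hs⟩ := ih (fun t ht => hl t (List.mem_append_left _ ht)) h1
    rw [h2]
    refine ⟨hb, lengthLe_joinTable _ _ _, ?_⟩
    rw [tableSet_joinTable hl' (hl t (by simp)), hs, List.map_append, List.sum_append]
    simp only [List.map_cons, List.map_nil, List.sum_cons, List.sum_nil, add_zero]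
    ext f
    constructor
    · rintro ⟨⟨a, ha, c, hc, rfl⟩, hle⟩
      exact ⟨⟨a, ha.1, c, hc, rfl⟩, hle⟩
    -- Cutting off early loses nothing: entries are natural numbers, so a partial sum of a vector
    -- below the target is itself below it.
    · rintro ⟨⟨a, ha, c, hc, rfl⟩, hle⟩
      exact ⟨⟨a, ⟨ha, fun i => (Nat.le_add_right _ _).trans (hle i)⟩, c, hc, rfl⟩, hle⟩

theorem sum_filter_tableSet (ts : List (List (List ℕ))) (v : ℕ) :
    (ts.map tableSet).sum = ((ts.filter fun t => decide (Touches v t)).map tableSet).sum +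
      ((ts.filter fun t => decide (¬ Touches v t)).map tableSet).sum := by
  induction ts with
  | nil => simp
  | cons t ts ih =>
    by_cases h : Touches v t
    · simp only [h, List.map_cons, List.sum_cons, List.filter_cons, decide_true, if_true,
        not_true, decide_false, Bool.false_eq_true, if_false, ih, add_assoc]
    · simp only [h, List.map_cons, List.sum_cons, List.filter_cons, decide_true, if_true,
        not_false_iff, decide_false, Bool.false_eq_true, if_false, ih]
      rw [add_left_comm]

theorem eq_zero_of_mem_sum {ts : List (List (List ℕ))} {v : ℕ} (h : ∀ t ∈ ts, ¬ Touches v t)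
    {f : ℕ → ℕ} (hf : f ∈ (ts.map tableSet).sum) : f v = 0 := by
  induction ts generalizing f with
  | nil =>
    simp only [List.map_nil, List.sum_nil, Set.mem_zero] at hf
    rw [hf]; rfl
  | cons t ts ih =>
    obtain ⟨_, ⟨x, hx, rfl⟩, c, hc, rfl⟩ := hf
    have h1 : entries x v = 0 := by
      by_contra h0
      exact h t List.mem_cons_self ⟨x, hx, h0⟩
    have h2 := ih (fun t ht => h t (List.mem_cons_of_mem _ ht)) hc
    simp [h1, h2]

/-- The tables left aside vanish at `v`. Hence in any sum equal to the target the joined summand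
alone already has the right entry at `v`, and it stays below the target because the other summands
are nonnegative. -/
theorem elimCoord_spec {K : ℕ} {τ : List ℕ} {s : Bool × List (List (List ℕ))} {v : ℕ}
    (hl : ∀ t ∈ s.2, LengthLe τ.length t) (h : (elimCoord K τ s v).1 = true) :
    s.1 = true ∧ (∀ t ∈ (elimCoord K τ s v).2, LengthLe τ.length t) ∧
      (entries τ ∈ ((elimCoord K τ s v).2.map tableSet).sum ↔
        entries τ ∈ (s.2.map tableSet).sum) := by
  obtain ⟨h1, h2, h3⟩ := joinAll_spec
    (fun t ht => hl t (List.mem_of_mem_filter ht)) h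
  refine ⟨h1, fun t ht => ?_, ?_⟩
  · rcases List.mem_cons.1 ht with rfl | ht
    · exact fun x hx => h2 x (List.mem_of_mem_filter hx)
    · exact hl t (List.mem_of_mem_filter ht)
  · rw [sum_filter_tableSet s.2 v]
    simp only [elimCoord, pushTable, List.map_cons, List.sum_cons]
    have key : ∀ f, f ∈ tableSet ((joinAll K τ s.1 (s.2.filter fun t => decide (Touches v t))).2.filter
        fun x => decide (x.getD v 0 = τ.getD v 0)) ↔ f ∈ ((s.2.filter fun t =>
          decide (Touches v t)).map tableSet).sum ∧ f ≤ entries τ ∧ f v = entries τ v := by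
      intro f
      rw [← Set.mem_Iic, ← and_assoc, ← Set.mem_inter_iff, ← h3]
      simp only [tableSet, List.mem_filter, decide_eq_true_eq, Set.mem_ofPred_eq]
      constructor
      · rintro ⟨x, ⟨hx, hv⟩, rfl⟩; exact ⟨⟨x, hx, rfl⟩, hv⟩
      · rintro ⟨⟨x, hx, rfl⟩, hv⟩; exact ⟨x, ⟨hx, hv⟩, rfl⟩
    constructor
    · rintro ⟨a, ha, c, hc, hac⟩
      exact ⟨a, ((key a).1 ha).1, c, hc, hac⟩
    · rintro ⟨a, ha, c, hc, hac⟩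
      refine ⟨a, (key a).2 ⟨ha, ?_, ?_⟩, c, hc, hac⟩
      · rw [← hac]; exact fun i => Nat.le_add_right _ _
      · have := eq_zero_of_mem_sum (v := v) (fun t ht => by
          simpa using (List.mem_filter.1 ht).2) hc
        rw [← hac]; simp [this]

theorem foldl_elimCoord_spec {K : ℕ} {τ : List ℕ} {s : Bool × List (List (List ℕ))} {l : List ℕ}
    (hl : ∀ t ∈ s.2, LengthLe τ.length t) (h : (l.foldl (elimCoord K τ) s).1 = true) :
    (∀ t ∈ (l.foldl (elimCoord K τ) s).2, LengthLe τ.length t) ∧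
      (entries τ ∈ ((l.foldl (elimCoord K τ) s).2.map tableSet).sum ↔
        entries τ ∈ (s.2.map tableSet).sum) := by
  induction l using List.reverseRecOn with
  | nil => exact ⟨hl, Iff.rfl⟩
  | append_singleton l v ih =>
    rw [List.foldl_append, List.foldl_cons, List.foldl_nil] at h ⊢
    have mono : (l.foldl (elimCoord K τ) s).1 = true ∨ (l.foldl (elimCoord K τ) s).1 = false := by
      cases (l.foldl (elimCoord K τ) s).1 <;> simp
    rcases mono with h' | h'
    · obtain ⟨h1, h2⟩ := ih h'
      obtain ⟨-, h3, h4⟩ := elimCoord_spec h1 h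
      exact ⟨h3, h4.trans h2⟩
    -- A cleared flag stays cleared, so a success at the end means that no table was ever truncated.
    · exfalso
      have : ∀ ts : List (List (List ℕ)), (joinAll K τ false ts).1 = false := by
        intro ts
        induction ts using List.reverseRecOn with
        | nil => rfl
        | append_singleton ts t ih => rw [joinAll_append, capTable, ih]; rfl
      simp [elimCoord, pushTable, h', this] at h

theorem joinAll_fst {K : ℕ} {τ : List ℕ} {b : Bool} {ts : List (List (List ℕ))}
    (h : (joinAll K τ b ts).1 = true) : b = true := by
  induction ts using List.reverseRecOn with
  | nil => exact h
  | append_singleton ts t ih =>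
    rw [joinAll_append] at h
    exact ih (capTable_eq h).1

/-- Whatever the order of elimination, the answer is correct if there is one. -/
theorem vecSum_spec {K : ℕ} {τ : List ℕ} {ts : List (List (List ℕ))} {l : List ℕ}
    (hl : ∀ t ∈ ts, LengthLe τ.length t) (h : vecSum K τ ts l ≠ 0) :
    vecSum K τ ts l = 2 ↔ entries τ ∈ (ts.map tableSet).sum := by
  unfold vecSum answer at h ⊢
  dsimp only at h ⊢
  by_cases h1 : (joinAll K τ (l.foldl (elimCoord K τ) (true, ts)).1
      (l.foldl (elimCoord K τ) (true, ts)).2).1 = true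
  · obtain ⟨h2, h3⟩ := foldl_elimCoord_spec (s := (true, ts)) hl (joinAll_fst h1)
    obtain ⟨-, h4, h5⟩ := joinAll_spec h2 h1
    rw [← h3, if_pos h1]
    have e : (∃ x ∈ (joinAll K τ (l.foldl (elimCoord K τ) (true, ts)).1
        (l.foldl (elimCoord K τ) (true, ts)).2).2, VecEq τ.length x τ) ↔
        entries τ ∈ ((l.foldl (elimCoord K τ) (true, ts)).2.map tableSet).sum := by
      have this := Set.ext_iff.1 h5 (entries τ)
      rw [Set.mem_inter_iff, and_iff_left (le_refl (entries τ) : _ ∈ Set.Iic _)] at this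
      rw [← this]
      exact exists_congr fun x => and_congr_right fun hx => vecEq_iff (h4 x hx) le_rfl
    split_ifs with h6 <;> simp [← e, h6]
  · rw [if_neg h1] at h
    exact absurd rfl h

/-! ### Equitable connected partitions as forests -/

section
variable {V : Type} [Fintype V] [DecidableEq V]

/-- The size of a tree of a forest, where `a` is the number of descendants. -/
theorem card_eq_of_descendants {par : V → Option V} {a : V → ℕ}
    (ha : ∀ v, a v = 1 + ∑ u, if par u = some v then a u else 0) {A : Finset V} {r : V}
    (hA : ∀ u v, par u = some v → (u ∈ A ↔ v ∈ A)) (hr : r ∈ A)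
    (hroot : ∀ v ∈ A, par v = none ↔ v = r) : a r = A.card := by
  have h1 : ∑ v ∈ A, a v = A.card + ∑ v ∈ A, ∑ u, if par u = some v then a u else 0 := by
    rw [Finset.card_eq_sum_ones, ← Finset.sum_add_distrib]
    exact Finset.sum_congr rfl fun v _ => ha v
  -- Every member of `A` other than the root is counted once, under its parent; subtracting leaves
  -- the value at the root.
  have h2 : ∑ v ∈ A, ∑ u, (if par u = some v then a u else 0) = ∑ u ∈ A.erase r, a u := by
    rw [Finset.sum_comm, ← Finset.sum_subset (Finset.subset_univ (A.erase r))]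
    · refine Finset.sum_congr rfl fun u hu => ?_
      obtain ⟨hur, huA⟩ := Finset.mem_erase.1 hu
      obtain ⟨v, hv⟩ : ∃ v, par u = some v :=
        Option.ne_none_iff_exists'.1 (mt (hroot u huA).1 hur)
      rw [Finset.sum_eq_single v]
      · simp [hv]
      · intro b _ hb; rw [hv, if_neg]; rintro ⟨⟩; exact hb rfl
      · intro h; exact absurd ((hA u v hv).1 huA) h
    · intro u _ hu
      refine Finset.sum_eq_zero fun v hv => if_neg fun h => hu (Finset.mem_erase.2 ⟨?_, ?_⟩)
      · rintro rfl
        rw [(hroot u hr).2 rfl] at h; cases h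
      · exact (hA u v h).2 hv
  have h3 := Finset.add_sum_erase A a hr
  omega

/-- The recursion runs from a vertex to its children. It is well-founded because depth increases in
this direction and is bounded on a finite set. -/
theorem exists_descendants {par : V → Option V} {d : V → ℕ}
    (hd : ∀ u v, par u = some v → d v < d u) :
    ∃ a : V → ℕ, ∀ v, a v = 1 + ∑ u, if par u = some v then a u else 0 := by
  obtain ⟨N, hN⟩ : ∃ N, ∀ v, d v ≤ N :=
    ⟨Finset.univ.sup d, fun v => Finset.le_sup (Finset.mem_univ v)⟩
  have wf : WellFounded fun u v : V => par u = some v :=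
    Subrelation.wf (r := InvImage (· < ·) fun v => N - d v)
      (fun {u v} h => by have := hd u v h; have := hN u; show N - d u < N - d v; omega)
      (InvImage.wf _ wellFounded_lt)
  refine ⟨wf.fix fun v f => 1 + ∑ u, if h : par u = some v then f u h else 0, fun v => ?_⟩
  rw [WellFounded.fix_eq]
  congr 1

/-- The parent is the second vertex of a shortest walk to `r`, and the depth is the distance from
`r`. -/
theorem exists_parents {W : Type} {H : SimpleGraph W} (hH : H.Connected) (r : W) :
    ∃ (par : W → Option W) (d : W → ℕ), par r = none ∧
      ∀ v, v ≠ r → ∃ u, par v = some u ∧ H.Adj v u ∧ d u < d v := by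
  classical
  have key : ∀ v, v ≠ r → ∃ u, H.Adj v u ∧ H.dist u r < H.dist v r := by
    intro v hv
    obtain ⟨w, hw⟩ := hH.exists_walk_length_eq_dist v r
    cases w with
    | nil => exact absurd rfl hv
    | cons h w =>
      rename_i u
      refine ⟨u, h, ?_⟩
      have := SimpleGraph.dist_le w
      simp at hw
      omega
  choose! f hf using key
  refine ⟨fun v => if v = r then none else some (f v), fun v => H.dist v r, by simp, fun v hv =>
    ⟨f v, by simp [hv], hf v hv⟩⟩

/-- A rooted forest in `G` with `p` trees of almost equal size; `a` is the number of
descendants. -/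
structure EquitableForest (G : SimpleGraph V) (p : ℕ) where
  par : V → Option V
  a : V → ℕ
  adj : ∀ u v, par u = some v → G.Adj u v
  sum : ∀ v, a v = 1 + ∑ u, if par u = some v then a u else 0
  le : ∀ v, p * a v < Fintype.card V + p
  ge : ∀ v, par v = none → Fintype.card V < p * a v + p
  card : (Finset.univ.filter fun v => par v = none).card = p

/-- The counting equation alone already excludes cycles of parents, which is why no acyclicity is
demanded of a forest. -/
theorem lt_of_parent {par : V → Option V} {a : V → ℕ}
    (ha : ∀ v, a v = 1 + ∑ u, if par u = some v then a u else 0) {u v : V} (h : par u = some v) :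
    a u < a v := by
  have := Finset.single_le_sum (f := fun u => if par u = some v then a u else 0)
    (fun _ _ => Nat.zero_le _) (Finset.mem_univ u)
  simp only [h, if_true] at this
  rw [ha v]
  omega

/-- Counts increase along parents and are bounded, so iterating the parent map often enough reaches
a root. The parts are the fibres of this map; a count at a root is the size of its fibre, and two
sizes differing by 2 would violate `le` and `ge`. -/
theorem EquitableForest.hasPartition {G : SimpleGraph V} {p : ℕ} (hp : 0 < p)
    (F : EquitableForest G p) : HasEquitableConnectedPartition G p := by
  classical
  obtain ⟨par, a, adj, sum, le, ge, card⟩ := F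
  have hlt : ∀ u v, par u = some v → a u < a v := fun u v h => lt_of_parent sum h
  let N := Fintype.card V + p
  have haN : ∀ v, a v < N := fun v => by
    have := le v
    have := Nat.le_mul_of_pos_left (a v) hp
    show a v < Fintype.card V + p
    omega
  -- Roots are fixed, so overshooting in the iteration does no harm.
  let step : V → V := fun v => (par v).getD v
  have step_none : ∀ v, par v = none → step v = v := fun v h => by simp [step, h]
  have step_some : ∀ v u, par v = some u → step v = u := fun v u h => by simp [step, h]
  have climb : ∀ v j, par (step^[j] v) = none ∨ j ≤ a (step^[j] v) := by
    intro v j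
    induction j with
    | zero => exact Or.inr (Nat.zero_le _)
    | succ j ih =>
      rw [Function.iterate_succ_apply']
      cases h : par (step^[j] v) with
      | none => rw [step_none _ h]; exact Or.inl h
      | some u =>
        rw [step_some _ _ h]
        rcases ih with ih | ih
        · rw [ih] at h; cases h
        · have := hlt _ _ h; right; omega
  let rt : V → V := fun v => step^[N] v
  have rt_none : ∀ v, par (rt v) = none := fun v =>
    (climb v N).resolve_right (by have := haN (step^[N] v); omega)
  have rt_step : ∀ v, rt (step v) = rt v := fun v => by
    show step^[N] (step v) = step^[N] v
    rw [← Function.iterate_succ_apply, Function.iterate_succ_apply']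
    exact step_none _ (rt_none v)
  have rt_par : ∀ u v, par u = some v → rt u = rt v := fun u v h => by
    rw [← rt_step u, step_some u v h]
  have rt_root : ∀ v, par v = none → rt v = v := fun v h =>
    Function.iterate_fixed (step_none v h) N
  let fib : V → Finset V := fun r => Finset.univ.filter fun v => rt v = r
  have mem_fib : ∀ r v, v ∈ fib r ↔ rt v = r := fun r v => by simp [fib]
  have card_fib : ∀ r, par r = none → a r = (fib r).card := fun r hr =>
    card_eq_of_descendants sum (fun u v h => by rw [mem_fib, mem_fib, rt_par u v h])
      ((mem_fib r r).2 (rt_root r hr)) fun v hv => by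
        rw [mem_fib] at hv
        exact ⟨fun h => by rw [← hv, rt_root v h], fun h => by rw [h]; exact hr⟩
  have conn : ∀ r, par r = none → (G.induce (fib r : Set V)).Connected := by
    intro r hr
    have hrr : r ∈ (fib r : Set V) := by simp [mem_fib, rt_root r hr]
    have reach : ∀ j v (hv : v ∈ (fib r : Set V)), step^[j] v = r →
        (G.induce (fib r : Set V)).Reachable ⟨v, hv⟩ ⟨r, hrr⟩ := by
      intro j
      induction j with
      | zero => rintro v hv rfl; exact .refl _
      | succ j ih =>
        intro v hv hj
        cases h : par v with
        | none =>
          have hvr : v = r := by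
            have := (mem_fib r v).1 (by simpa using hv)
            rw [← this, rt_root v h]
          subst hvr; exact .refl _
        | some u =>
          have hs := step_some v u h
          rw [Function.iterate_succ_apply, hs] at hj
          have hu : u ∈ (fib r : Set V) := by
            have := (mem_fib r v).1 (by simpa using hv)
            simp only [Finset.mem_coe, mem_fib]
            rw [← rt_par v u h, this]
          have hvu : (G.induce (fib r : Set V)).Adj ⟨v, hv⟩ ⟨u, hu⟩ := adj v u h
          exact hvu.reachable.trans (ih u hu hj)
    have : Nonempty (fib r : Set V) := ⟨⟨r, hrr⟩⟩
    refine ⟨fun x y => ?_⟩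
    have hx := reach N x.1 x.2 ((mem_fib r x.1).1 (by simp))
    have hy := reach N y.1 y.2 ((mem_fib r y.1).1 (by simp))
    exact hx.trans hy.symm
  let π : Finpartition (Finset.univ : Finset V) := Finpartition.ofSetoid (Setoid.ker rt)
  have parts : π.parts = (Finset.univ.filter fun v => par v = none).image fib := by
    ext A
    simp only [π, Finpartition.ofSetoid, Finpartition.ofSetSetoid, Finset.mem_image,
      Finset.mem_filter, Finset.mem_univ, true_and]
    constructor
    · rintro ⟨v, rfl⟩
      refine ⟨rt v, rt_none v, ?_⟩
      ext w
      simp [mem_fib, eq_comm]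
    · rintro ⟨r, hr, rfl⟩
      refine ⟨r, ?_⟩
      ext w
      simp [mem_fib, rt_root r hr, eq_comm]
  refine ⟨π, ?_, ?_, ?_⟩
  · rw [parts, Finset.card_image_of_injOn, card]
    intro r hr s hs h
    have hr' : par r = none := by simpa using hr
    have hs' : par s = none := by simpa using hs
    have : r ∈ fib s := by
      rw [← h, mem_fib, rt_root r hr']
    rw [mem_fib, rt_root r hr'] at this
    exact this
  · rw [parts]
    intro A hA
    obtain ⟨r, hr, rfl⟩ := Finset.mem_image.1 hA
    exact conn r (by simpa using hr)
  · rw [parts]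
    intro A hA B hB
    obtain ⟨r, hr, rfl⟩ := Finset.mem_image.1 hA
    obtain ⟨s, hs, rfl⟩ := Finset.mem_image.1 hB
    have h1 := le r
    have h2 := ge s (by simpa using hs)
    rw [card_fib r (by simpa using hr)] at h1
    rw [card_fib s (by simpa using hs)] at h2
    by_contra h3
    have : p * ((fib s).card + 2) ≤ p * (fib r).card := Nat.mul_le_mul_left p (by omega)
    rw [mul_add] at this
    omega

theorem HasEquitableConnectedPartition.exists_forest [Nonempty V] {G : SimpleGraph V} {p : ℕ}
    (h : HasEquitableConnectedPartition G p) : Nonempty (EquitableForest G p) := by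
  classical
  obtain ⟨π, hcard, hconn, hsize⟩ := h
  have tot : ∑ A ∈ π.parts, A.card = Fintype.card V := π.sum_card_parts
  -- Summing the comparison of `A` with all `p` parts gives the bound; it is strict because `A` is
  -- compared with itself once.
  have size1 : ∀ A ∈ π.parts, p * A.card < Fintype.card V + p := by
    intro A hA
    have h1 : ∑ B ∈ π.parts, A.card < ∑ B ∈ π.parts, (B.card + 1) :=
      Finset.sum_lt_sum (fun B hB => hsize A hA B hB) ⟨A, hA, Nat.lt_succ_self _⟩
    simp only [Finset.sum_const, smul_eq_mul, hcard, Finset.sum_add_distrib, tot, mul_one] at h1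
    exact h1
  have size2 : ∀ A ∈ π.parts, Fintype.card V < p * A.card + p := by
    intro A hA
    have h1 : ∑ B ∈ π.parts, B.card < ∑ B ∈ π.parts, (A.card + 1) :=
      Finset.sum_lt_sum (fun B hB => hsize B hB A hA) ⟨A, hA, Nat.lt_succ_self _⟩
    simp only [Finset.sum_const, smul_eq_mul, hcard, tot, mul_add, mul_one] at h1
    exact h1
  have key : ∀ A ∈ π.parts, ∃ r ∈ A, ∃ (par : V → Option V) (d : V → ℕ), par r = none ∧
      ∀ v ∈ A, v ≠ r → ∃ u ∈ A, par v = some u ∧ G.Adj v u ∧ d u < d v := by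
    intro A hA
    obtain ⟨⟨r, hr⟩⟩ := (hconn A hA).nonempty
    obtain ⟨par, d, h1, h2⟩ := exists_parents (hconn A hA) ⟨r, hr⟩
    -- The values outside `A` are never read: below, a vertex only uses the functions of its own
    -- part.
    refine ⟨r, by simpa using hr, fun v => if hv : v ∈ (A : Set V) then
      (par ⟨v, hv⟩).map Subtype.val else none, fun v => if hv : v ∈ (A : Set V) then
      d ⟨v, hv⟩ else 0, ?_, fun v hv hvr => ?_⟩
    · simp only [hr, dif_pos, h1, Option.map_none]
    · have hv' : v ∈ (A : Set V) := by simpa using hv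
      obtain ⟨⟨u, hu⟩, h3, h4, h5⟩ := h2 ⟨v, hv'⟩ (by simpa using hvr)
      exact ⟨u, by simpa using hu, by simp only [hv', dif_pos, h3, Option.map_some], h4,
        by simp only [hv', hu, dif_pos, h5]⟩
  choose! r hr par d h1 h2 using key
  let pt : V → Finset V := π.part
  have hpt : ∀ v, pt v ∈ π.parts := fun v => π.part_mem.2 (Finset.mem_univ v)
  have hmem : ∀ v, v ∈ pt v := fun v => π.mem_part (Finset.mem_univ v)
  have hpe : ∀ A ∈ π.parts, ∀ v ∈ A, pt v = A := fun A hA v hv => π.part_eq_of_mem hA hv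
  let P : V → Option V := fun v => par (pt v) v
  have hsome : ∀ u v, P u = some v → v ∈ pt u ∧ G.Adj u v ∧ d (pt u) v < d (pt u) u := by
    intro u v huv
    have hne : u ≠ r (pt u) := by
      intro h
      have := h1 (pt u) (hpt u)
      rw [← h] at this
      simp only [P, this] at huv
      cases huv
    obtain ⟨w, hw, h3, h4, h5⟩ := h2 (pt u) (hpt u) u (hmem u) hne
    simp only [P, h3, Option.some.injEq] at huv
    subst huv
    exact ⟨hw, h4, h5⟩
  have hsame : ∀ u v, P u = some v → pt v = pt u := fun u v h => hpe _ (hpt u) v (hsome u v h).1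
  have hnone : ∀ v, P v = none ↔ v = r (pt v) := by
    intro v
    constructor
    · intro h
      by_contra hne
      obtain ⟨w, hw, h3, h4, h5⟩ := h2 (pt v) (hpt v) v (hmem v) hne
      simp only [P, h3] at h
      cases h
    · intro h
      have := h1 (pt v) (hpt v)
      rw [← h] at this
      exact this
  have hd : ∀ u v, P u = some v → d (pt v) v < d (pt u) u := fun u v h => by
    rw [hsame u v h]; exact (hsome u v h).2.2
  obtain ⟨a, ha⟩ := exists_descendants (d := fun v => d (pt v) v) hd
  have hroot : ∀ A ∈ π.parts, a (r A) = A.card := fun A hA =>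
    card_eq_of_descendants ha (fun u v h => by
      constructor
      · intro hu; rw [← hpe A hA u hu, ← hsame u v h]; exact hmem v
      · intro hv; rw [← hpe A hA v hv, hsame u v h]; exact hmem u) (hr A hA)
      fun v hv => by rw [hnone, hpe A hA v hv]
  -- Counts grow towards the root, where the count is the size of the part.
  have hle : ∀ k v, d (pt v) v = k → a v ≤ (pt v).card := by
    intro k
    induction k using Nat.strong_induction_on with
    | _ k ih =>
      rintro v rfl
      cases h : P v with
      | none =>
        have := hroot (pt v) (hpt v)
        rw [← (hnone v).1 h] at this
        exact this.le
      | some u =>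
        have h3 := ih _ (hd v u h) u rfl
        rw [hsame v u h] at h3
        exact (lt_of_parent ha h).le.trans h3
  refine ⟨⟨P, a, fun u v h => (hsome u v h).2.1, ha, fun v => ?_, fun v hv => ?_, ?_⟩⟩
  · exact (Nat.mul_le_mul_left p (hle _ v rfl)).trans_lt (size1 _ (hpt v))
  · have h3 := hroot (pt v) (hpt v)
    rw [← (hnone v).1 hv] at h3
    rw [h3]
    exact size2 _ (hpt v)
  · rw [← hcard]
    refine Finset.card_bij (fun v _ => pt v) (fun v _ => hpt v) ?_ ?_
    · intro v hv w hw hvw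
      rw [(hnone v).1 (by simpa using hv), (hnone w).1 (by simpa using hw), hvw]
    · intro A hA
      have e := hpe A hA _ (hr A hA)
      exact ⟨r A, by simp [hnone, e], e⟩

theorem hasEquitableConnectedPartition_iff [Nonempty V] {G : SimpleGraph V} {p : ℕ} (hp : 0 < p) :
    HasEquitableConnectedPartition G p ↔ Nonempty (EquitableForest G p) :=
  ⟨fun h => h.exists_forest, fun ⟨F⟩ => F.hasPartition hp⟩

end

/-! ### Equitable connected partitions as vector sums -/

/-- The list `E` consists of the arcs of `G`. -/
structure IsArcList {n : ℕ} (G : SimpleGraph (Fin n)) (E : List (ℕ × ℕ)) : Prop where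
  nodup : E.Nodup
  mem : ∀ i j, (i, j) ∈ E ↔ ∃ (hi : i < n) (hj : j < n), G.Adj ⟨i, hi⟩ ⟨j, hj⟩

/-- A list without duplicates lets a selection of summands be written as one function of the index,
which turns membership in a Minkowski sum into a combinatorial choice. -/
theorem mem_sum_map_iff {α ι : Type} [DecidableEq α] {S : α → Set (ℕ → ℕ)} {O : α → Set ι}
    [Inhabited ι]
    {φ : α → ι → ℕ → ℕ} (hS : ∀ a f, f ∈ S a ↔ ∃ o ∈ O a, φ a o = f) {l : List α} (hl : l.Nodup)
    {f : ℕ → ℕ} : f ∈ (l.map S).sum ↔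
      ∃ c : α → ι, (∀ a ∈ l, c a ∈ O a) ∧ (l.map fun a => φ a (c a)).sum = f := by
  induction l generalizing f with
  | nil => simp [eq_comm]
  | cons a l ih =>
    obtain ⟨ha, hl⟩ := List.nodup_cons.1 hl
    rw [List.map_cons, List.sum_cons, Set.mem_add]
    constructor
    · rintro ⟨x, hx, y, hy, rfl⟩
      obtain ⟨o, ho, rfl⟩ := (hS a x).1 hx
      obtain ⟨c, hc, rfl⟩ := (ih hl).1 hy
      refine ⟨Function.update c a o, fun b hb => ?_, ?_⟩
      · rcases List.mem_cons.1 hb with rfl | hb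
        · simpa using ho
        · rw [Function.update_of_ne (ne_of_mem_of_not_mem hb ha)]; exact hc b hb
      · rw [List.map_cons, List.sum_cons, Function.update_self]
        congr 2
        refine List.map_congr_left fun b hb => ?_
        rw [Function.update_of_ne (ne_of_mem_of_not_mem hb ha)]
    · rintro ⟨c, hc, rfl⟩
      exact ⟨_, (hS a _).2 ⟨_, hc a List.mem_cons_self, rfl⟩, _,
        (ih hl).2 ⟨c, fun b hb => hc b (List.mem_cons_of_mem _ hb), rfl⟩, by simp⟩

/-- The contribution of an outgoing flow. -/
def outWeight (M : ℕ) : Option ℕ → ℕ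
  | none => 0
  | some a => 2 * (2 * M - a) + 1

/-- The contribution of an incoming flow. -/
def inWeight (o : Option ℕ) : ℕ := 2 * o.getD 0

/-- The vector for a choice at an arc. -/
def arcVec (n M : ℕ) (e : ℕ × ℕ) (o : Option ℕ) (u : ℕ) : ℕ :=
  if u < n + 1 then if u = e.1 then outWeight M o else if u = e.2 then inWeight o else 0 else 0

/-- The vector for a choice at a vertex. -/
def vertVec (n M v : ℕ) (o : Option ℕ) (u : ℕ) : ℕ :=
  if u < n + 1 then if u = v then outWeight M o else if u = n then (if o = none then 0 else 1)
    else 0 else 0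

theorem mem_arcTable (n : ℕ) (zs : List ℕ) (e : ℕ × ℕ) (f : ℕ → ℕ) :
    f ∈ tableSet (arcTable n zs e) ↔
      ∃ o ∈ {o : Option ℕ | ∀ a ∈ o, a ∈ zs}, arcVec n zs.length e o = f := by
  simp only [tableSet, arcTable, Set.mem_ofPred_eq, List.mem_cons, List.mem_map]
  constructor
  · rintro ⟨x, rfl | ⟨a, ha, rfl⟩, rfl⟩
    · exact ⟨none, by simp, by funext u; simp [arcVec, outWeight, inWeight, entries]⟩
    · refine ⟨some a, by simpa using ha, ?_⟩
      funext u
      simp [arcVec, outWeight, inWeight, entries_mkVec]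
  · rintro ⟨_ | a, ha, rfl⟩
    · exact ⟨[], Or.inl rfl, by funext u; simp [arcVec, outWeight, inWeight, entries]⟩
    · refine ⟨_, Or.inr ⟨a, ha a rfl, rfl⟩, ?_⟩
      funext u
      simp [arcVec, outWeight, inWeight, entries_mkVec]

theorem mem_vertTable (n : ℕ) (zs rs : List ℕ) (v : ℕ) (f : ℕ → ℕ) :
    f ∈ tableSet (vertTable n zs rs v) ↔
      ∃ o ∈ {o : Option ℕ | ∀ a ∈ o, a ∈ rs}, vertVec n zs.length v o = f := by
  simp only [tableSet, vertTable, Set.mem_ofPred_eq, List.mem_cons, List.mem_map]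
  constructor
  · rintro ⟨x, rfl | ⟨a, ha, rfl⟩, rfl⟩
    · exact ⟨none, by simp, by funext u; simp [vertVec, outWeight, entries]⟩
    · refine ⟨some a, by simpa using ha, ?_⟩
      funext u
      simp [vertVec, outWeight, entries_mkVec]
  · rintro ⟨_ | a, ha, rfl⟩
    · exact ⟨[], Or.inl rfl, by funext u; simp [vertVec, outWeight, entries]⟩
    · refine ⟨_, Or.inr ⟨a, ha a rfl, rfl⟩, ?_⟩
      funext u
      simp [vertVec, outWeight, entries_mkVec]

section
variable {n : ℕ} {G : SimpleGraph (Fin n)} {E : List (ℕ × ℕ)}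

open Classical in
theorem IsArcList.sum_map (hE : IsArcList G E) (F : ℕ × ℕ → ℕ) :
    (E.map F).sum = ∑ i : Fin n, ∑ j : Fin n, if G.Adj i j then F (i, j) else 0 := by
  have h := Finset.sum_product (Finset.univ : Finset (Fin n)) (Finset.univ : Finset (Fin n))
    fun q => if G.Adj q.1 q.2 then F (q.1, q.2) else 0
  rw [Finset.univ_product_univ, ← Finset.sum_filter] at h
  rw [← List.sum_toFinset F hE.nodup, ← h]
  refine (Finset.sum_bij (fun q _ => ((q.1 : ℕ), (q.2 : ℕ))) ?_ ?_ ?_ ?_).symm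
  · intro q hq
    rw [List.mem_toFinset, hE.mem]
    exact ⟨q.1.2, q.2.2, (Finset.mem_filter.1 hq).2⟩
  · intro q _ q' _ h
    simp only [Prod.mk.injEq] at h
    exact Prod.ext (Fin.ext h.1) (Fin.ext h.2)
  · rintro ⟨i, j⟩ h
    rw [List.mem_toFinset, hE.mem] at h
    obtain ⟨hi, hj, h⟩ := h
    exact ⟨(⟨i, hi⟩, ⟨j, hj⟩), by simpa using h, rfl⟩
  · intro q _; rfl

/-- A choice of outgoing flows: `c i (some j)` is the flow from `i` to `j` and `c i none` is the
flow from the root `i`. -/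
structure IsFlowChoice (G : SimpleGraph (Fin n)) (M p : ℕ) (zs rs : List ℕ)
    (c : Fin n → Option (Fin n) → Option ℕ) : Prop where
  adj : ∀ i j, c i (some j) ≠ none → G.Adj i j
  mem : ∀ i j, ∀ a ∈ c i (some j), a ∈ zs
  mem_root : ∀ i, ∀ a ∈ c i none, a ∈ rs
  balance : ∀ v, ∑ o, outWeight M (c v o) + ∑ i, inWeight (c i (some v)) = 4 * M - 1
  card : (Finset.univ.filter fun i => c i none ≠ none).card = p

theorem list_sum_apply {α : Type} (l : List α) (F : α → ℕ → ℕ) (u : ℕ) :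
    (l.map F).sum u = (l.map fun a => F a u).sum := by
  induction l with
  | nil => rfl
  | cons a l ih => simp [ih]

/-- A coordinate below `n` collects what its vertex sends and receives; coordinate `n` counts the
roots; nothing reaches any coordinate beyond. -/
theorem IsArcList.sum_apply (hE : IsArcList G E) (M : ℕ) (cE : ℕ × ℕ → Option ℕ)
    (cV : ℕ → Option ℕ) (c : Fin n → Option (Fin n) → Option ℕ) (h0 : ∀ i : Fin n, c i none = cV i)
    (h1 : ∀ i j, G.Adj i j → c i (some j) = cE (i, j))
    (h2 : ∀ i j, ¬ G.Adj i j → c i (some j) = none) (u : ℕ) :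
    (E.map fun e => arcVec n M e (cE e) u).sum +
      ((List.range n).map fun v => vertVec n M v (cV v) u).sum =
    if h : u < n then ∑ o, outWeight M (c ⟨u, h⟩ o) + ∑ i, inWeight (c i (some ⟨u, h⟩))
    else if u = n then (Finset.univ.filter fun i => c i none ≠ none).card else 0 := by
  classical
  rw [hE.sum_map, ← List.sum_toFinset _ List.nodup_range, List.toFinset_range,
    Finset.sum_range]
  have e1 : ∀ i j : Fin n, (if G.Adj i j then arcVec n M (i, j) (cE (i, j)) u else 0) =
      (if u = i then outWeight M (c i (some j)) else 0) +
        if u = j then inWeight (c i (some j)) else 0 := by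
    intro i j
    by_cases h : G.Adj i j
    · have hne : (i : ℕ) ≠ j := fun h' => h.ne (Fin.ext h')
      have := i.2
      have := j.2
      rw [if_pos h, ← h1 i j h]
      unfold arcVec
      dsimp only
      by_cases hi : u = i
      · simp [hi, hne]
      · by_cases hj : u = j
        · simp [hj, hne.symm]
        · simp [hi, hj]
    · rw [if_neg h, h2 i j h]
      simp [outWeight, inWeight]
  simp only [e1, Finset.sum_add_distrib]
  by_cases h : u < n
  · rw [dif_pos h, Fintype.sum_option]
    have a1 : ∀ i : Fin n, u = i ↔ (⟨u, h⟩ : Fin n) = i := fun i => by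
      rw [Fin.ext_iff]
    have a2 : ∀ i : Fin n, vertVec n M i (cV i) u =
        if (⟨u, h⟩ : Fin n) = i then outWeight M (c i none) else 0 := by
      intro i
      rw [h0 i, ← if_congr (a1 i) rfl rfl]
      unfold vertVec
      rw [if_pos (by omega)]
      simp [show u ≠ n by omega]
    simp only [a1, a2]
    rw [Finset.sum_comm]
    simp only [Finset.sum_ite_eq, Finset.mem_univ, if_true]
    omega
  · rw [dif_neg h]
    have a1 : ∀ i : Fin n, u ≠ i := fun i => by have := i.2; omega
    simp only [a1, if_false, Finset.sum_const_zero, zero_add]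
    split_ifs with hn
    · rw [Finset.card_filter]
      refine Finset.sum_congr rfl fun i _ => ?_
      rw [h0 i]
      unfold vertVec
      simp [hn, i.2.ne']
    · refine Finset.sum_eq_zero fun i _ => if_neg (by omega)

theorem mem_allTables_iff (hE : IsArcList G E) {p : ℕ} :
    entries (target n p (flowVals n p)) ∈ ((allTables n p E).map tableSet).sum ↔
      ∃ c, IsFlowChoice G (flowVals n p).length p (flowVals n p) (rootVals n p) c := by
  classical
  set zs := flowVals n p
  set rs := rootVals n p
  set M := zs.length
  have ht : ∀ u, entries (target n p zs) u =
      if u < n then 4 * M - 1 else if u = n then p else 0 := by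
    intro u
    unfold target
    rw [entries_mkVec]
    split_ifs <;> first | rfl | omega
  have step : entries (target n p zs) ∈ ((allTables n p E).map tableSet).sum ↔
      ∃ (cE : ℕ × ℕ → Option ℕ) (cV : ℕ → Option ℕ), (∀ e ∈ E, ∀ a ∈ cE e, a ∈ zs) ∧
        (∀ v < n, ∀ a ∈ cV v, a ∈ rs) ∧ ∀ u, (E.map fun e => arcVec n M e (cE e) u).sum +
      ((List.range n).map fun v => vertVec n M v (cV v) u).sum = entries (target n p zs) u := by
    rw [allTables, List.map_append, List.sum_append, List.map_map, List.map_map, Set.mem_add]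
    constructor
    · rintro ⟨x, hx, y, hy, hxy⟩
      obtain ⟨cE, h1, rfl⟩ := (mem_sum_map_iff (mem_arcTable n zs) hE.nodup).1 hx
      obtain ⟨cV, h2, rfl⟩ := (mem_sum_map_iff (mem_vertTable n zs rs) List.nodup_range).1 hy
      refine ⟨cE, cV, h1, fun v hv => h2 v (List.mem_range.2 hv), fun u => ?_⟩
      rw [← hxy, Pi.add_apply, list_sum_apply, list_sum_apply]
    · rintro ⟨cE, cV, h1, h2, h3⟩
      refine ⟨_, (mem_sum_map_iff (mem_arcTable n zs) hE.nodup).2 ⟨cE, h1, rfl⟩, _,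
        (mem_sum_map_iff (mem_vertTable n zs rs) List.nodup_range).2
          ⟨cV, fun v hv => h2 v (List.mem_range.1 hv), rfl⟩, ?_⟩
      funext u
      rw [← h3, Pi.add_apply, list_sum_apply, list_sum_apply]
  rw [step]
  constructor
  · rintro ⟨cE, cV, h1, h2, h3⟩
    let c : Fin n → Option (Fin n) → Option ℕ := fun i o =>
      o.elim (cV i) fun j => if G.Adj i j then cE (i, j) else none
    have key := hE.sum_apply M cE cV c (fun i => rfl) (fun i j h => if_pos h)
      (fun i j h => if_neg h)
    refine ⟨c, fun i j h => ?_, fun i j a ha => ?_, fun i a ha => h2 i i.2 a ha, fun v => ?_, ?_⟩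
    · by_contra h'; exact h (if_neg h')
    · by_cases h : G.Adj i j
      · rw [show c i (some j) = cE (i, j) from if_pos h] at ha
        exact h1 (i, j) ((hE.mem _ _).2 ⟨i.2, j.2, h⟩) a ha
      · rw [show c i (some j) = none from if_neg h] at ha; cases ha
    · have := key v
      rw [h3, ht, if_pos v.2, dif_pos v.2] at this
      exact this.symm
    · have := key n
      rw [h3, ht] at this
      simpa using this.symm
  · rintro ⟨c, hc⟩
    let cE : ℕ × ℕ → Option ℕ := fun e =>
      if h : e.1 < n ∧ e.2 < n then c ⟨e.1, h.1⟩ (some ⟨e.2, h.2⟩) else none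
    let cV : ℕ → Option ℕ := fun v => if h : v < n then c ⟨v, h⟩ none else none
    have key := hE.sum_apply M cE cV c (fun i => by simp [cV]) (fun i j h => by simp [cE])
      (fun i j h => by by_contra h'; exact h (hc.adj i j h'))
    refine ⟨cE, cV, fun e _ a ha => ?_, fun v hv a ha => ?_, fun u => ?_⟩
    · by_cases h : e.1 < n ∧ e.2 < n
      · simp only [cE, dif_pos h] at ha; exact hc.mem _ _ a ha
      · simp only [cE, dif_neg h] at ha; cases ha
    · simp only [cV, dif_pos hv] at ha; exact hc.mem_root _ a ha
    · rw [key u, ht]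
      split_ifs with h1 h2
      · exact hc.balance _
      · exact hc.card
      · rfl

theorem mem_flowVals {n p z : ℕ} (hp : 0 < p) : z ∈ flowVals n p ↔ p * z < n + p := by
  simp only [flowVals, List.mem_filter, List.mem_range, decide_eq_true_eq, and_iff_right_iff_imp]
  intro h
  by_contra h'
  have : p * (n + 1) ≤ p * z := Nat.mul_le_mul_left p (by omega)
  nlinarith

theorem mem_rootVals {n p z : ℕ} (hp : 0 < p) :
    z ∈ rootVals n p ↔ p * z < n + p ∧ n < p * z + p := by
  simp [rootVals, mem_flowVals hp]

/-- The admissible values form an initial segment, so their number serves as a strict upper bound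
for each of them. -/
theorem lt_length_flowVals {n p z : ℕ} (hp : 0 < p) (hz : p * z < n + p) :
    z < (flowVals n p).length := by
  have : (List.range (z + 1)).Subperm (flowVals n p) :=
    List.nodup_range.subperm fun y hy => (mem_flowVals hp).2 <|
      (Nat.mul_le_mul_left p (Nat.lt_succ_iff.1 (List.mem_range.1 hy))).trans_lt hz
  simpa using this.length_le

/-- Incoming contributions are even, outgoing ones are odd and at least `2 * M + 3`, and the target
`4 * M - 1` is odd. So something leaves, and two outgoing flows would exceed the target. For a
single outgoing value `a` the equation reads `2 * (2 * M - a) + 1 + 2 * I = 4 * M - 1`, that is `a =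
I + 1`. -/
theorem exists_unique_out {ι : Type} [Fintype ι] [DecidableEq ι] {M I : ℕ} {w : ι → Option ℕ}
    (hM : 0 < M) (hw : ∀ o, ∀ a ∈ w o, a < M)
    (h : ∑ o, outWeight M (w o) + 2 * I = 4 * M - 1) :
    ∃ o, w o = some (I + 1) ∧ ∀ o', w o' ≠ none → o' = o := by
  have big : ∀ o, w o ≠ none → 2 * M + 3 ≤ outWeight M (w o) := by
    intro o ho
    obtain ⟨a, ha⟩ := Option.ne_none_iff_exists'.1 ho
    have := hw o a ha
    rw [ha]
    simp only [outWeight]; omega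
  have hne : ∃ o, w o ≠ none := by
    by_contra hno
    push Not at hno
    simp only [hno, outWeight, Finset.sum_const_zero] at h
    omega
  obtain ⟨o, ho⟩ := hne
  have huniq : ∀ o', w o' ≠ none → o' = o := by
    intro o' ho'
    by_contra hoo
    have h1 := Finset.sum_le_sum_of_subset (f := fun o => outWeight M (w o))
      (Finset.subset_univ {o', o})
    rw [Finset.sum_pair hoo] at h1
    have := big o ho
    have := big o' ho'
    omega
  refine ⟨o, ?_, huniq⟩
  rw [Finset.sum_eq_single o (fun b _ hb => by
    by_cases hb' : w b = none
    · rw [hb']; rfl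
    · exact absurd (huniq b hb') hb) (by simp)] at h
  obtain ⟨a, ha⟩ := Option.ne_none_iff_exists'.1 ho
  have := hw o a ha
  rw [ha] at h ⊢
  simp only [outWeight] at h
  congr 1
  omega

/-- The unique outgoing flow at a vertex names its parent, or makes it a root, and its value is the
number of descendants. The balance equation and the counting equation are then the same. -/
theorem exists_flowChoice_iff {p : ℕ} (hp : 0 < p) :
    (∃ c, IsFlowChoice G (flowVals n p).length p (flowVals n p) (rootVals n p) c) ↔
      Nonempty (EquitableForest G p) := by
  classical
  set M := (flowVals n p).length with hMdef
  have hM : 0 < M := lt_length_flowVals (z := 0) hp (by simp; omega)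
  constructor
  · rintro ⟨c, hc⟩
    have hlt : ∀ v o, ∀ a ∈ c v o, p * a < n + p := by
      intro v o a ha
      cases o with
      | none => exact ((mem_rootVals hp).1 (hc.mem_root v a ha)).1
      | some j => exact (mem_flowVals hp).1 (hc.mem v j a ha)
    have key : ∀ v, ∃ o, c v o = some (∑ i, (c i (some v)).getD 0 + 1) ∧
        ∀ o', c v o' ≠ none → o' = o := fun v =>
      exists_unique_out hM (fun o a ha => lt_length_flowVals hp (hlt v o a ha)) (by
        rw [← hc.balance v, Finset.mul_sum]; rfl)
    choose par h1 h2 using key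
    have hnone : ∀ v o, o ≠ par v → c v o = none := fun v o h => by
      by_contra h'; exact h (h2 v o h')
    refine ⟨⟨par, fun v => ∑ i, (c i (some v)).getD 0 + 1, fun u v h => ?_, fun v => ?_, fun v => ?_,
      fun v hv => ?_, ?_⟩⟩
    · exact hc.adj u v (by rw [← h, h1]; simp)
    · rw [add_comm]
      congr 1
      refine Finset.sum_congr rfl fun i _ => ?_
      split_ifs with h
      · rw [← h, h1]; rfl
      · rw [hnone i _ (Ne.symm h)]; rfl
    · simpa using hlt v _ _ (h1 v)
    · have := h1 v
      rw [hv] at this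
      simpa using ((mem_rootVals hp).1 (hc.mem_root v _ this)).2
    · rw [← hc.card]
      congr 1
      ext v
      simp only [Finset.mem_filter, Finset.mem_univ, true_and]
      constructor
      · intro h; rw [← h, h1]; simp
      · intro h; exact (h2 v _ h).symm
  · rintro ⟨F⟩
    refine ⟨fun v o => if o = F.par v then some (F.a v) else none, fun i j h => ?_,
      fun i j a ha => ?_, fun i a ha => ?_, fun v => ?_, ?_⟩
    · refine F.adj i j ?_
      by_contra h'; exact h (if_neg (Ne.symm h'))
    · have hle := F.le i
      rw [Fintype.card_fin] at hle
      split_ifs at ha with h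
      · simp only [Option.mem_def, Option.some.injEq] at ha
        subst ha
        exact (mem_flowVals hp).2 hle
      · cases ha
    · have hle := F.le i
      rw [Fintype.card_fin] at hle
      split_ifs at ha with h
      · simp only [Option.mem_def, Option.some.injEq] at ha
        subst ha
        have hge := F.ge i h.symm
        rw [Fintype.card_fin] at hge
        exact (mem_rootVals hp).2 ⟨hle, hge⟩
      · cases ha
    · have hle := F.le v
      rw [Fintype.card_fin] at hle
      have h1 := lt_length_flowVals hp hle
      have h2 : ∑ i, inWeight (if some v = F.par i then some (F.a i) else none) =
          2 * (F.a v - 1) := by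
        rw [F.sum v, Nat.add_sub_cancel_left, Finset.mul_sum]
        refine Finset.sum_congr rfl fun i _ => ?_
        by_cases h : some v = F.par i
        · simp [inWeight, ← h]
        · simp [inWeight, h, Ne.symm h]
      have h3 := F.sum v
      rw [h2, Finset.sum_eq_single (F.par v) (fun b _ hb => by simp [hb, outWeight]) (by simp)]
      simp only [if_true, outWeight]
      omega
    · refine Eq.trans ?_ F.card
      congr 1
      ext v
      simp [eq_comm]

theorem mem_allTables_iff_hasPartition (hE : IsArcList G E) (hn : 0 < n) {p : ℕ} (hp : 0 < p) :
    entries (target n p (flowVals n p)) ∈ ((allTables n p E).map tableSet).sum ↔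
      HasEquitableConnectedPartition G p := by
  have : Nonempty (Fin n) := ⟨⟨0, hn⟩⟩
  rw [mem_allTables_iff hE, exists_flowChoice_iff hp, hasEquitableConnectedPartition_iff hp]

end

/-! ### Connected sets and the width of an elimination order -/

/-- The set `K` is connected (or empty) with respect to the relation `r`. -/
def PreConn (r : ℕ → ℕ → Prop) (K : Set ℕ) : Prop :=
  ∀ X : Set ℕ, (∃ u ∈ K, u ∈ X) → (∀ u ∈ K, u ∈ X → ∀ v ∈ K, r u v → v ∈ X) → K ⊆ X

/-- The neighbours of the set `K`. -/
def nbrSet (r : ℕ → ℕ → Prop) (K : Set ℕ) : Set ℕ := {u | ∃ v ∈ K, r v u}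

open Classical in
/-- Every connected set that avoids `P` has at most `b` neighbours in `P`. -/
def WidthLe (r : ℕ → ℕ → Prop) (P : Finset ℕ) (b : ℕ) : Prop :=
  ∀ K : Set ℕ, K.Nonempty → PreConn r K → (∀ u ∈ K, u ∉ P) →
    (P.filter fun u => u ∈ nbrSet r K).card ≤ b

/-! ### The size of the tables -/

/-- The vectors of `t` agree at all coordinates below `n` outside `Y`. -/
def ConstOff (n : ℕ) (Y : Finset ℕ) (t : List (List ℕ)) : Prop :=
  ∀ u < n, u ∉ Y → ∃ c, ∀ x ∈ t, entries x u = c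

/-- A vector is determined by its entries on `Y`, each at most `T`, and by its entry at `n`, at most
`p`: elsewhere below `n` the table is constant, and beyond `n` all entries vanish. -/
theorem length_le_of_constOff {n T p : ℕ} {Y : Finset ℕ} {t : List (List ℕ)} {τ : List ℕ}
    (hτ : τ.length = n + 1) (hT : ∀ u < n, entries τ u ≤ T) (hp : entries τ n = p)
    (hl : LengthLe (n + 1) t) (hle : ∀ x ∈ t, VecLe (n + 1) x τ)
    (hd : t.Pairwise fun x y => ¬ VecEq (n + 1) x y) (hY : ConstOff n Y t)
    (hYn : ∀ u ∈ Y, u < n) :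
    t.length ≤ (T + 1) ^ Y.card * (p + 1) := by
  classical
  have hnd : (t.map entries).Nodup := by
    refine List.pairwise_map.2 (hd.imp_of_mem fun {x y} hx hy hne hxy => hne ?_)
    exact (vecEq_iff (hl x hx) (hl y hy)).2 hxy
  have hle' : ∀ x ∈ t, entries x ≤ entries τ := fun x hx => (vecLe_iff (hl x hx)).1 (hle x hx)
  have h1 := Finset.card_le_card_of_injOn (s := (t.map entries).toFinset)
    (t := (Finset.univ : Finset ((Y → Fin (T + 1)) × Fin (p + 1))))
    (fun f => (fun u => Fin.ofNat (T + 1) (f u), Fin.ofNat (p + 1) (f n)))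
    (fun _ _ => Finset.mem_univ _) (by
      intro f hf g hg hfg
      simp only [List.coe_toFinset, List.mem_map, Set.mem_ofPred_eq] at hf hg
      obtain ⟨x, hx, rfl⟩ := hf
      obtain ⟨y, hy, rfl⟩ := hg
      simp only [Prod.mk.injEq] at hfg
      obtain ⟨h1, h2⟩ := hfg
      funext u
      rcases lt_trichotomy u n with hu | rfl | hu
      · by_cases hu' : u ∈ Y
        · have h3 := congrArg Fin.val (congrFun h1 ⟨u, hu'⟩)
          simp only [Fin.val_ofNat] at h3
          rwa [Nat.mod_eq_of_lt, Nat.mod_eq_of_lt] at h3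
          · exact Nat.lt_succ_of_le ((hle' y hy u).trans (hT u hu))
          · exact Nat.lt_succ_of_le ((hle' x hx u).trans (hT u hu))
        · obtain ⟨c, hc⟩ := hY u hu hu'
          rw [hc x hx, hc y hy]
      · have h3 := congrArg Fin.val h2
        simp only [Fin.val_ofNat] at h3
        rwa [Nat.mod_eq_of_lt, Nat.mod_eq_of_lt] at h3
        · exact Nat.lt_succ_of_le (hp ▸ hle' y hy _)
        · exact Nat.lt_succ_of_le (hp ▸ hle' x hx _)
      · rw [entries_eq_zero (hl x hx) hu, entries_eq_zero (hl y hy) hu])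
  rw [List.toFinset_card_of_nodup hnd, List.length_map] at h1
  simpa using h1

/-- The assumptions on the required sum that bound the size of the tables. -/
structure TableBound (n T p K b : ℕ) (τ : List ℕ) : Prop where
  length : τ.length = n + 1
  le : ∀ u < n, entries τ u ≤ T
  eq : entries τ n = p
  bound : (T + 1) ^ b * (p + 1) ≤ K

/-- Sums of tables constant off `Y` are constant off `Y`, so every intermediate table obeys the size
bound and the cap never takes effect. -/
theorem TableBound.joinAll {n T p K b : ℕ} {τ : List ℕ} (H : TableBound n T p K b τ)
    {Y : Finset ℕ} (hY : ∀ u ∈ Y, u < n) (hYb : Y.card ≤ b) {ts : List (List (List ℕ))}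
    (h : ∀ t ∈ ts, LengthLe (n + 1) t ∧ ConstOff n Y t) :
    (joinAll K τ true ts).1 = true ∧ ConstOff n Y (joinAll K τ true ts).2 := by
  induction ts using List.reverseRecOn with
  | nil =>
    refine ⟨rfl, fun u _ _ => ⟨entries [] u, fun x hx => ?_⟩⟩
    rw [List.mem_singleton.1 hx]
  | append_singleton ts t ih =>
    obtain ⟨h1, h2⟩ := ih fun t ht => h t (List.mem_append_left _ ht)
    obtain ⟨h3, h4⟩ := h t (by simp)
    have hl := (joinAll_spec (fun t ht => by
      rw [H.length]; exact (h t (List.mem_append_left _ ht)).1) h1).2.1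
    set J := (_root_.joinAll K τ true ts).2
    have hc : ConstOff n Y (joinTable τ J t) := by
      intro u hu huY
      obtain ⟨c, hc⟩ := h2 u hu huY
      obtain ⟨d, hd⟩ := h4 u hu huY
      refine ⟨c + d, fun z hz => ?_⟩
      obtain ⟨-, -, x, hx, y, hy, rfl⟩ := mem_joinTable_bound hz
      rw [entries_mkVec, if_pos (by rw [H.length]; omega)]
      exact congrArg₂ (· + ·) (hc x hx) (hd y hy)
    have hlen : (joinTable τ J t).length ≤ K := by
      refine le_trans ?_ H.bound
      refine le_trans (length_le_of_constOff H.length H.le H.eq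
        (H.length ▸ lengthLe_joinTable τ J t) (fun z hz => ?_) ?_ hc hY) ?_
      · rw [← H.length]; exact (mem_joinTable_bound hz).2.1
      · rw [← H.length]; exact (dedupVec_spec _ _).2
      · exact Nat.mul_le_mul_right _ (Nat.pow_le_pow_right (by omega) hYb)
    rw [joinAll_append, h1]
    refine ⟨by simpa [capTable] using hlen, ?_⟩
    rw [(capTable_eq (by simpa [capTable] using hlen)).2]
    exact hc

/-- The live coordinates of the table `t` are neighbours of one connected set of eliminated
vertices, or they are the ends of an edge. -/
def SupportNear (r : ℕ → ℕ → Prop) (P : Finset ℕ) (t : List (List ℕ)) : Prop :=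
  (∃ K : Set ℕ, K.Nonempty ∧ PreConn r K ∧ (∀ u ∈ K, u ∉ P) ∧
    ∀ u ∈ P, Touches u t → u ∈ nbrSet r K) ∨
  ∃ i j, (r i j ∨ i = j) ∧ ∀ u ∈ P, Touches u t → u = i ∨ u = j

/-- The invariant of the elimination. -/
structure TablesNear (r : ℕ → ℕ → Prop) (n : ℕ) (P : Finset ℕ) (ts : List (List (List ℕ))) :
    Prop where
  length : ∀ t ∈ ts, LengthLe (n + 1) t
  const : ∀ t ∈ ts, ConstOff n P t
  near : ∀ t ∈ ts, SupportNear r P t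

/-- Connected sets adjacent to `v` become one connected set when `v` is added. Taking all such sets
that avoid `P`, instead of one per table, avoids a choice. -/
theorem exists_joined_set {r : ℕ → ℕ → Prop} (hr : ∀ {a b}, r a b → r b a) {v : ℕ} {P : Finset ℕ}
    (hv : v ∉ P) {ts : List (List (List ℕ))}
    (hts : ∀ t ∈ ts, SupportNear r (insert v P) t ∧ Touches v t) :
    ∃ K : Set ℕ, v ∈ K ∧ PreConn r K ∧ (∀ u ∈ K, u ∉ P) ∧
      ∀ t ∈ ts, ∀ u ∈ P, Touches u t → u ∈ nbrSet r K := by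
  let valid : Set ℕ → Prop := fun K => K.Nonempty ∧ PreConn r K ∧ (∀ u ∈ K, u ∉ P) ∧
    v ∈ nbrSet r K
  let K : Set ℕ := {w | w = v ∨ ∃ K', valid K' ∧ w ∈ K'}
  have hsub : ∀ K', valid K' → K' ⊆ K := fun K' h w hw => Or.inr ⟨K', h, hw⟩
  refine ⟨K, Or.inl rfl, ?_, ?_, ?_⟩
  · rintro X ⟨w, hw, hwX⟩ hX
    have hvX : v ∈ X := by
      rcases hw with rfl | ⟨K', hK', hw⟩
      · exact hwX
      · have : K' ⊆ X := hK'.2.1 X ⟨w, hw, hwX⟩ fun a ha haX b hb hab =>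
          hX a (hsub K' hK' ha) haX b (hsub K' hK' hb) hab
        obtain ⟨u, hu, huv⟩ := hK'.2.2.2
        exact hX u (hsub K' hK' hu) (this hu) v (Or.inl rfl) huv
    rintro w (rfl | ⟨K', hK', hw⟩)
    · exact hvX
    · obtain ⟨u, hu, huv⟩ := hK'.2.2.2
      have huX := hX v (Or.inl rfl) hvX u (hsub K' hK' hu) (hr huv)
      exact hK'.2.1 X ⟨u, hu, huX⟩ (fun a ha haX b hb hab =>
          hX a (hsub K' hK' ha) haX b (hsub K' hK' hb) hab) hw
  · rintro u (rfl | ⟨K', hK', hu⟩)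
    · exact hv
    · exact hK'.2.2.1 u hu
  · intro t ht u hu htu
    obtain ⟨⟨K', h1, h2, h3, h4⟩ | ⟨i, j, hij, h⟩, hvt⟩ := hts t ht
    · have hvalid : valid K' := ⟨h1, h2, fun u hu h => h3 u hu (Finset.mem_insert_of_mem h),
        h4 v (Finset.mem_insert_self v P) hvt⟩
      obtain ⟨w, hw, hwu⟩ := h4 u (Finset.mem_insert_of_mem hu) htu
      exact ⟨w, hsub K' hvalid hw, hwu⟩
    · have hne : u ≠ v := by rintro rfl; exact hv hu
      refine ⟨v, Or.inl rfl, ?_⟩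
      rcases h v (Finset.mem_insert_self v P) hvt with rfl | rfl <;>
      rcases h u (Finset.mem_insert_of_mem hu) htu with rfl | rfl
      · exact absurd rfl hne
      · exact hij.resolve_right hne.symm
      · exact hr (hij.resolve_right hne)
      · exact absurd rfl hne

theorem TableBound.elimCoord {n T p K b : ℕ} {τ : List ℕ} (H : TableBound n T p K (b + 1) τ)
    {r : ℕ → ℕ → Prop} (hr : ∀ {a b}, r a b → r b a) {v : ℕ} {P : Finset ℕ} (hv : v ∉ P)
    (hP : ∀ u ∈ insert v P, u < n) (hw : WidthLe r P b) {ts : List (List (List ℕ))}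
    (h : TablesNear r n (insert v P) ts) :
    (elimCoord K τ (true, ts) v).1 = true ∧ TablesNear r n P (elimCoord K τ (true, ts) v).2 := by
  classical
  set A := ts.filter fun t => decide (Touches v t) with hA
  have hAt : ∀ t ∈ A, t ∈ ts ∧ Touches v t := fun t ht => by simpa [hA] using ht
  obtain ⟨K', hvK, hconn, hdisj, hnear⟩ := exists_joined_set (fun h => hr h) hv (ts := A) fun t ht =>
    ⟨h.near t (hAt t ht).1, (hAt t ht).2⟩
  set Y := insert v (P.filter fun u => u ∈ nbrSet r K') with hYdef
  have hYP : ∀ u ∈ Y, u ∈ insert v P := fun u hu => by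
    rcases Finset.mem_insert.1 hu with rfl | hu
    · exact Finset.mem_insert_self _ _
    · exact Finset.mem_insert_of_mem (Finset.mem_filter.1 hu).1
  -- The width bounds the neighbours of the joined set; the extra 1 is the eliminated vertex `v`, at
  -- which the table still varies while it is being joined.
  have hYb : Y.card ≤ b + 1 :=
    (Finset.card_insert_le _ _).trans (Nat.succ_le_succ (hw K' ⟨v, hvK⟩ hconn hdisj))
  have hAY : ∀ t ∈ A, LengthLe (n + 1) t ∧ ConstOff n Y t := by
    intro t ht
    refine ⟨h.length t (hAt t ht).1, fun u hu huY => ?_⟩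
    by_cases huP : u ∈ insert v P
    · refine ⟨0, fun x hx => ?_⟩
      by_contra hne
      have htu : Touches u t := ⟨x, hx, hne⟩
      rcases Finset.mem_insert.1 huP with rfl | huP
      · exact huY (Finset.mem_insert_self _ _)
      · exact huY (Finset.mem_insert_of_mem (Finset.mem_filter.2 ⟨huP, hnear t ht u huP htu⟩))
    · exact h.const t (hAt t ht).1 u hu huP
  obtain ⟨h1, h2⟩ := H.joinAll (fun u hu => hP u (hYP u hu)) hYb hAY
  obtain ⟨-, hl, hs⟩ := joinAll_spec (fun t ht => by rw [H.length]; exact (hAY t ht).1) h1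
  rw [H.length] at hl
  refine ⟨h1, ?_, ?_, ?_⟩
  · intro t ht
    rcases List.mem_cons.1 ht with rfl | ht
    · exact fun x hx => hl x (List.mem_of_mem_filter hx)
    · exact h.length t (List.mem_of_mem_filter ht)
  · intro t ht u hu huP
    rcases List.mem_cons.1 ht with rfl | ht
    · by_cases huv : u = v
      · subst huv
        exact ⟨_, fun x hx => of_decide_eq_true (List.mem_filter.1 hx).2⟩
      · obtain ⟨c, hc⟩ := h2 u hu (by
          intro h'
          rcases Finset.mem_insert.1 (hYP u h') with h' | h'
          exacts [huv h', huP h'])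
        exact ⟨c, fun x hx => hc x (List.mem_of_mem_filter hx)⟩
    · obtain ⟨ht, hvt⟩ := List.mem_filter.1 ht
      by_cases huv : u = v
      · subst huv
        refine ⟨0, fun x hx => ?_⟩
        by_contra hne
        simp at hvt
        exact hvt ⟨x, hx, hne⟩
      · exact h.const t ht u hu (by simp [huv, huP])
  · intro t ht
    rcases List.mem_cons.1 ht with rfl | ht
    · refine Or.inl ⟨K', ⟨v, hvK⟩, hconn, hdisj, fun u hu ⟨x, hx, hne⟩ => ?_⟩
      by_contra hno
      have hx' : entries x ∈ tableSet (_root_.joinAll K τ true A).2 :=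
        ⟨x, List.mem_of_mem_filter hx, rfl⟩
      rw [hs] at hx'
      exact hne (eq_zero_of_mem_sum (v := u) (fun t ht htu => hno (hnear t ht u hu htu)) hx'.1)
    · obtain ⟨ht, hvt⟩ := List.mem_filter.1 ht
      rcases h.near t ht with ⟨K, k1, k2, k3, k4⟩ | ⟨i, j, hij, k⟩
      · exact Or.inl ⟨K, k1, k2, fun u hu hu' => k3 u hu (Finset.mem_insert_of_mem hu'),
          fun u hu => k4 u (Finset.mem_insert_of_mem hu)⟩
      · exact Or.inr ⟨i, j, hij, fun u hu => k u (Finset.mem_insert_of_mem hu)⟩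

/-- Coordinates are taken from the head of the list, so those still alive always form a suffix;
hence the width condition on suffixes. -/
theorem TableBound.foldl_elimCoord {n T p K b : ℕ} {τ : List ℕ}
    (H : TableBound n T p K (b + 1) τ) {r : ℕ → ℕ → Prop} (hr : ∀ {a b}, r a b → r b a) {l : List ℕ}
    (hl : l.Nodup) (hln : ∀ u ∈ l, u < n)
    (hw : ∀ l', l' <:+ l → WidthLe r l'.toFinset b) {ts : List (List (List ℕ))}
    (h : TablesNear r n l.toFinset ts) :
    (l.foldl (_root_.elimCoord K τ) (true, ts)).1 = true ∧
      TablesNear r n ∅ (l.foldl (_root_.elimCoord K τ) (true, ts)).2 := by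
  induction l generalizing ts with
  | nil => exact ⟨rfl, by simpa using h⟩
  | cons v l ih =>
    obtain ⟨hv, hl⟩ := List.nodup_cons.1 hl
    rw [List.toFinset_cons] at h
    obtain ⟨h1, h2⟩ := H.elimCoord (fun h => hr h) (by simpa using hv)
      (fun u hu => hln u (by simpa using hu)) (hw l (List.suffix_cons v l)) h
    rw [List.foldl_cons]
    have e : _root_.elimCoord K τ (true, ts) v = (true, (_root_.elimCoord K τ (true, ts) v).2) :=
      Prod.ext h1 rfl
    rw [e]
    exact ih hl (fun u hu => hln u (List.mem_cons_of_mem _ hu))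
      (fun l' hl' => hw l' (hl'.trans (List.suffix_cons v l))) h2

/-- With a good elimination order the resource bound is not exceeded. -/
theorem TableBound.vecSum_ne_zero {n T p K b : ℕ} {τ : List ℕ}
    (H : TableBound n T p K (b + 1) τ) {r : ℕ → ℕ → Prop} (hr : ∀ {a b}, r a b → r b a) {l : List ℕ}
    (hl : l.Nodup) (hln : ∀ u ∈ l, u < n)
    (hw : ∀ l', l' <:+ l → WidthLe r l'.toFinset b) {ts : List (List (List ℕ))}
    (h : TablesNear r n l.toFinset ts) : vecSum K τ ts l ≠ 0 := by
  obtain ⟨h1, h2⟩ := H.foldl_elimCoord (fun h => hr h) hl hln hw h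
  have h3 := (H.joinAll (Y := ∅) (by simp) (by simp)
    (fun t ht => ⟨h2.length t ht, h2.const t ht⟩)).1
  unfold vecSum answer
  dsimp only
  rw [h1, if_pos h3]
  split_ifs <;> simp

/-- At the start nothing is eliminated, and a table lives at the two ends of an arc or at one
vertex. The root counter is never eliminated and does not count. -/
theorem tablesNear_allTables {n p : ℕ} {E : List (ℕ × ℕ)} {l : List ℕ}
    (hl : ∀ u ∈ l, u < n) (hl' : ∀ u < n, u ∈ l) :
    TablesNear (fun i j => (i, j) ∈ E) n l.toFinset (allTables n p E) := by
  have hmk : ∀ f, (mkVec (n + 1) f).length ≤ n + 1 := fun f => by simp [mkVec]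
  have hent : ∀ f u, u < n → (mkVec (n + 1) f).getD u 0 = f u := fun f u hu => by
    have := entries_mkVec (n + 1) f u
    rw [if_pos (by omega)] at this
    exact this
  refine ⟨?_, fun t _ u hu hu' => absurd (hl' u hu) (by simpa using hu'), ?_⟩
  · intro t ht x hx
    rcases List.mem_append.1 ht with ht | ht <;> obtain ⟨e, he, rfl⟩ := List.mem_map.1 ht <;>
    rcases List.mem_cons.1 hx with rfl | hx
    · simp
    · obtain ⟨a, -, rfl⟩ := List.mem_map.1 hx; exact hmk _
    · simp
    · obtain ⟨a, -, rfl⟩ := List.mem_map.1 hx; exact hmk _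
  · intro t ht
    rcases List.mem_append.1 ht with ht | ht <;> obtain ⟨e, he, rfl⟩ := List.mem_map.1 ht
    · refine Or.inr ⟨e.1, e.2, Or.inl he, fun u hu ⟨x, hx, hxu⟩ => ?_⟩
      rcases List.mem_cons.1 hx with rfl | hx
      · simp at hxu
      · obtain ⟨a, -, rfl⟩ := List.mem_map.1 hx
        rw [hent _ _ (hl u (by simpa using hu))] at hxu
        by_contra hno
        push Not at hno
        simp [hno.1, hno.2] at hxu
    · refine Or.inr ⟨e, e, Or.inr rfl, fun u hu ⟨x, hx, hxu⟩ => ?_⟩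
      have hun := hl u (by simpa using hu)
      rcases List.mem_cons.1 hx with rfl | hx
      · simp at hxu
      · obtain ⟨a, -, rfl⟩ := List.mem_map.1 hx
        rw [hent _ _ hun] at hxu
        by_contra hno
        push Not at hno
        simp [hno.1, hun.ne] at hxu

/-! ### Correctness of the search -/

/-- The list of predecessors `ps` was obtained by a search from `s`. -/
inductive SearchTree (arcs : List (ℕ × ℕ)) (s : ℕ) : List (ℕ × ℕ) → Prop where
  | root : SearchTree arcs s [(s, s)]
  | step {x y : ℕ} {ps : List (ℕ × ℕ)} (h : SearchTree arcs s ps) (hx : x ∈ keys ps)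
      (hy : y ∉ keys ps) (he : (x, y) ∈ arcs) : SearchTree arcs s ((y, x) :: ps)

theorem SearchTree.relaxArc {arcs : List (ℕ × ℕ)} {s : ℕ} {ps : List (ℕ × ℕ)}
    (h : SearchTree arcs s ps) {e : ℕ × ℕ} (he : e ∈ arcs) :
    SearchTree arcs s (relaxArc ps e) := by
  unfold _root_.relaxArc
  split_ifs with h'
  · exact h.step h'.1 h'.2 he
  · exact h

theorem SearchTree.foldl_relaxArc {arcs l : List (ℕ × ℕ)} {s : ℕ} {ps : List (ℕ × ℕ)}
    (h : SearchTree arcs s ps) (hl : l ⊆ arcs) :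
    SearchTree arcs s (l.foldl _root_.relaxArc ps) := by
  induction l generalizing ps with
  | nil => exact h
  | cons e l ih =>
    exact ih (h.relaxArc (hl List.mem_cons_self)) fun x hx => hl (List.mem_cons_of_mem _ hx)

theorem searchTree_searchFrom (r : ℕ) (arcs : List (ℕ × ℕ)) (s : ℕ) :
    SearchTree arcs s (searchFrom r arcs s) := by
  unfold searchFrom
  induction r with
  | zero => exact .root
  | succ r ih =>
    rw [List.range_succ, List.foldl_append]
    exact ih.foldl_relaxArc fun _ h => h

theorem SearchTree.start_mem {arcs : List (ℕ × ℕ)} {s : ℕ} {ps : List (ℕ × ℕ)}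
    (h : SearchTree arcs s ps) : s ∈ keys ps := by
  induction h with
  | root => simp [keys]
  | step _ _ _ _ ih => exact List.mem_cons_of_mem _ ih

theorem SearchTree.nodup {arcs : List (ℕ × ℕ)} {s : ℕ} {ps : List (ℕ × ℕ)}
    (h : SearchTree arcs s ps) : (keys ps).Nodup := by
  induction h with
  | root => simp [keys]
  | step _ _ hy _ ih => exact List.nodup_cons.2 ⟨hy, ih⟩

/-- An induction principle for search: closure is needed only along arcs that start at nodes found.
-/
theorem SearchTree.mem_of_closed {arcs : List (ℕ × ℕ)} {s : ℕ} {ps : List (ℕ × ℕ)}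
    (h : SearchTree arcs s ps) {X : Set ℕ} (hs : s ∈ X)
    (hX : ∀ e ∈ arcs, e.1 ∈ keys ps → e.1 ∈ X → e.2 ∈ X) {u : ℕ} (hu : u ∈ keys ps) : u ∈ X := by
  induction h generalizing u with
  | root => simp [keys] at hu; rwa [hu]
  | step h hx hy he ih =>
    have ih' := fun {u} => ih (u := u) fun e he h' => hX e he (List.mem_cons_of_mem _ h')
    rcases List.mem_cons.1 hu with rfl | hu
    · exact hX _ he (List.mem_cons_of_mem _ hx) (ih' hx)
    · exact ih' hu

theorem keys_subset_relaxArc (ps : List (ℕ × ℕ)) (e : ℕ × ℕ) : keys ps ⊆ keys (relaxArc ps e) := by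
  unfold relaxArc
  split_ifs
  · exact fun u hu => List.mem_cons_of_mem _ hu
  · exact fun u hu => hu

theorem keys_subset_foldl (l ps : List (ℕ × ℕ)) : keys ps ⊆ keys (l.foldl relaxArc ps) := by
  induction l generalizing ps with
  | nil => exact fun u hu => hu
  | cons e l ih => exact fun u hu => ih _ (keys_subset_relaxArc ps e hu)

theorem mem_keys_foldl {l ps : List (ℕ × ℕ)} {e : ℕ × ℕ} (he : e ∈ l) (h : e.1 ∈ keys ps) :
    e.2 ∈ keys (l.foldl relaxArc ps) := by
  induction l generalizing ps with
  | nil => simp at he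
  | cons e' l ih =>
    rcases List.mem_cons.1 he with rfl | he
    · refine keys_subset_foldl l _ ?_
      unfold relaxArc
      split_ifs with h'
      · exact List.mem_cons_self
      · by_contra h''; exact h' ⟨h, h''⟩
    · exact ih he (keys_subset_relaxArc _ _ h)

/-- A round that adds nothing shows closure, and every other round adds a node. With the start node
found beforehand, `r` productive rounds would find more than `r` nodes below `r`. -/
theorem searchFrom_closed {r : ℕ} {arcs : List (ℕ × ℕ)} {s : ℕ} (hs : s < r)
    (hr : ∀ e ∈ arcs, e.2 < r) :
    ∀ e ∈ arcs, e.1 ∈ keys (searchFrom r arcs s) → e.2 ∈ keys (searchFrom r arcs s) := by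
  have hlt : ∀ ps, SearchTree arcs s ps → (keys ps).length ≤ r := by
    intro ps h
    have : (keys ps).Subperm (List.range r) := h.nodup.subperm fun u hu =>
      List.mem_range.2 (h.mem_of_closed (X := {u | u < r}) hs (fun e he _ _ => hr e he) hu)
    simpa using this.length_le
  have key : ∀ j, (∀ e ∈ arcs, e.1 ∈ keys (searchFrom j arcs s) → e.2 ∈ keys (searchFrom j arcs s)) ∨
      j + 1 ≤ (keys (searchFrom j arcs s)).length := by
    intro j
    induction j with
    | zero => right; simp [searchFrom, keys]
    | succ j ih =>
      have e1 : searchFrom (j + 1) arcs s = arcs.foldl relaxArc (searchFrom j arcs s) := by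
        simp [searchFrom, List.range_succ]
      rcases ih with ih | ih
      · have : ∀ l ⊆ arcs, l.foldl relaxArc (searchFrom j arcs s) = searchFrom j arcs s := by
          intro l
          induction l with
          | nil => intro _; rfl
          | cons e l ih' =>
            intro hl
            have : relaxArc (searchFrom j arcs s) e = searchFrom j arcs s := if_neg fun h =>
              h.2 (ih e (hl List.mem_cons_self) h.1)
            rw [List.foldl_cons, this]
            exact ih' fun x hx => hl (List.mem_cons_of_mem _ hx)
        left
        rw [e1, this arcs fun _ h => h]
        exact ih
      · by_cases hc : ∀ e ∈ arcs, e.1 ∈ keys (searchFrom j arcs s) →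
          e.2 ∈ keys (searchFrom j arcs s)
        · left
          intro e he h
          rw [e1]
          refine mem_keys_foldl he ?_
          have hX := (searchTree_searchFrom (j + 1) arcs s).mem_of_closed
            (X := {u | u ∈ keys (searchFrom j arcs s)}) (searchTree_searchFrom j arcs s).start_mem
            (fun e he _ h => hc e he h) h
          exact hX
        · right
          push Not at hc
          obtain ⟨e, he, h1, h2⟩ := hc
          have h3 : (e.2 :: keys (searchFrom j arcs s)).Subperm
              (keys (searchFrom (j + 1) arcs s)) := by
            refine (List.nodup_cons.2 ⟨h2, (searchTree_searchFrom j arcs s).nodup⟩).subperm ?_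
            intro u hu
            rw [e1]
            rcases List.mem_cons.1 hu with rfl | hu
            · exact mem_keys_foldl he h1
            · exact keys_subset_foldl _ _ hu
          have := h3.length_le
          rw [List.length_cons] at this
          omega
  refine (key r).resolve_right fun h => ?_
  have := hlt _ (searchTree_searchFrom r arcs s)
  omega

/-! ### Flows -/

/-- The excess of the outgoing over the incoming arcs of `F` at `z`. -/
def netOut (F : Finset (ℕ × ℕ)) (z : ℕ) : ℤ :=
  ∑ e ∈ F, ((if z = e.1 then 1 else 0) - if z = e.2 then 1 else 0)

theorem netOut_insert {F : Finset (ℕ × ℕ)} {e : ℕ × ℕ} (he : e ∉ F) (z : ℕ) :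
    netOut (insert e F) z =
      netOut F z + (if z = e.1 then 1 else 0) - if z = e.2 then 1 else 0 := by
  unfold netOut
  rw [Finset.sum_insert he]; ring

theorem netOut_erase {F : Finset (ℕ × ℕ)} {e : ℕ × ℕ} (he : e ∈ F) (z : ℕ) :
    netOut (F.erase e) z =
      netOut F z + (if z = e.2 then 1 else 0) - if z = e.1 then 1 else 0 := by
  unfold netOut
  rw [← Finset.add_sum_erase F _ he]; ring

theorem mem_residualArcs {arcs F : List (ℕ × ℕ)} {x y : ℕ} :
    (x, y) ∈ residualArcs arcs F ↔ ((x, y) ∈ arcs ∧ (x, y) ∉ F) ∨ (y, x) ∈ F := by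
  simp [residualArcs]

/-- Newer nodes stand before their predecessors in `ps`, so a single pass meets the nodes of the
path from its end back to `s`. The arcs flipped so far all involve nodes already passed; this is
`hagree`, and it lets the remaining residual arcs still be judged by the original `F`. -/
theorem walkBack_spec {arcs F ps : List (ℕ × ℕ)} {s : ℕ}
    (h : SearchTree (residualArcs arcs F) s ps) {c : ℕ} {L : List (ℕ × ℕ)} (hc : c ∈ keys ps)
    (hL : L ⊆ arcs) (hagree : ∀ u ∈ keys ps, ∀ v ∈ keys ps, (u, v) ∈ L ↔ (u, v) ∈ F) :
    (ps.foldl walkBack (c, L)).2 ⊆ arcs ∧ ∀ z, netOut (ps.foldl walkBack (c, L)).2.toFinset z =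
      netOut L.toFinset z + (if z = s then 1 else 0) - if z = c then 1 else 0 := by
  induction h generalizing c L with
  | root =>
    have : c = s := by simpa [keys] using hc
    subst this
    simpa [walkBack] using hL
  | @step x y ps h hx hy he ih =>
    have hag' : ∀ u ∈ keys ps, ∀ v ∈ keys ps, (u, v) ∈ L ↔ (u, v) ∈ F := fun u hu v hv =>
      hagree u (List.mem_cons_of_mem _ hu) v (List.mem_cons_of_mem _ hv)
    rw [List.foldl_cons]
    by_cases hcy : c = y
    · subst hcy
      have hxc : x ≠ c := by rintro rfl; exact hy hx
      have hw : walkBack (c, L) (c, x) = (x, flipArc L (x, c)) := if_pos ⟨rfl, hxc⟩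
      rw [hw]
      have ag1 := hagree c List.mem_cons_self x (List.mem_cons_of_mem _ hx)
      have ag2 := hagree x (List.mem_cons_of_mem _ hx) c List.mem_cons_self
      by_cases hmem : (c, x) ∈ L
      · have hf : flipArc L (x, c) = L.filter fun e' => decide (¬ e' = (c, x)) := if_pos hmem
        obtain ⟨h1, h2⟩ := ih (c := x) (L := flipArc L (x, c)) hx
          (by rw [hf]; exact fun e he => hL (List.mem_of_mem_filter he)) (by
            intro u hu v hv
            rw [← hag' u hu v hv, hf, List.mem_filter, and_iff_left]
            have : u ≠ c := by rintro rfl; exact hy hu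
            simp [this])
        refine ⟨h1, fun z => ?_⟩
        have e1 : (flipArc L (x, c)).toFinset = L.toFinset.erase (c, x) := by
          ext e; simp [hf, and_comm]
        rw [h2, e1, netOut_erase (by simpa using hmem)]
        ring
      · have hf : flipArc L (x, c) = (x, c) :: L := if_neg hmem
        have hres : (x, c) ∈ arcs ∧ (x, c) ∉ F :=
          (mem_residualArcs.1 he).resolve_right fun h' => hmem (ag1.2 h')
        obtain ⟨h1, h2⟩ := ih (c := x) (L := flipArc L (x, c)) hx
          (by
            rw [hf]
            intro e he
            rcases List.mem_cons.1 he with rfl | he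
            exacts [hres.1, hL he]) (by
            intro u hu v hv
            rw [← hag' u hu v hv, hf, List.mem_cons, or_iff_right]
            rintro ⟨⟩
            exact hy hv)
        refine ⟨h1, fun z => ?_⟩
        rw [h2, hf, List.toFinset_cons, netOut_insert (by
          rw [List.mem_toFinset, ag2]; exact hres.2)]
        ring
    · have hw : walkBack (c, L) (y, x) = (c, L) := if_neg fun h' => hcy h'.1.symm
      rw [hw]
      exact ih ((List.mem_cons.1 hc).resolve_left hcy) hL hag'

/-- `F` is a flow of value `v` from `s` to `t`. -/
structure IsFlow (arcs : List (ℕ × ℕ)) (s t : ℕ) (v : ℕ) (F : List (ℕ × ℕ)) : Prop where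
  subset : F ⊆ arcs
  nodup : F.Nodup
  net : ∀ z, netOut F.toFinset z = v * ((if z = s then 1 else 0) - if z = t then 1 else 0)

/-- Either each of the `j` augmentations gained one unit, or the sink became unreachable, and then
the flow does not change any more. -/
theorem exists_isFlow_maxFlow {arcs : List (ℕ × ℕ)} (ha : arcs.Nodup) (j r s t : ℕ) :
    ∃ v, IsFlow arcs s t v (maxFlow j r arcs s t) ∧ (v = j ∨
      t ∉ keys (searchFrom r (residualArcs arcs (maxFlow j r arcs s t)) s)) := by
  induction j with
  | zero => exact ⟨0, ⟨by simp [maxFlow], by simp [maxFlow], by simp [maxFlow, netOut]⟩, Or.inl rfl⟩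
  | succ j ih =>
    have e : maxFlow (j + 1) r arcs s t = augmentAlong arcs t (maxFlow j r arcs s t)
        (searchFrom r (residualArcs arcs (maxFlow j r arcs s t)) s) := by
      simp [maxFlow, List.range_succ]
    obtain ⟨v, hv, hor⟩ := ih
    set F := maxFlow j r arcs s t
    by_cases ht : t ∈ keys (searchFrom r (residualArcs arcs F) s)
    · obtain rfl : v = j := hor.resolve_right (not_not.2 ht)
      have e' : maxFlow (v + 1) r arcs s t = keepArcs arcs
          ((searchFrom r (residualArcs arcs F) s).foldl walkBack (t, F)).2 := by
        rw [e]; exact if_pos ht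
      obtain ⟨h1, h2⟩ := walkBack_spec (searchTree_searchFrom r (residualArcs arcs F) s) ht
        hv.subset fun _ _ _ _ => Iff.rfl
      -- Intersecting with the arc list keeps the set and removes the repetitions that flipping
      -- might have caused.
      have hk : ∀ L : List (ℕ × ℕ), L ⊆ arcs → (keepArcs arcs L).toFinset = L.toFinset := by
        intro L hL
        ext e
        simp only [keepArcs, List.mem_toFinset, List.mem_filter, decide_eq_true_eq]
        exact ⟨fun h => h.2, fun h => ⟨hL h, h⟩⟩
      refine ⟨v + 1, ⟨?_, ?_, fun z => ?_⟩, Or.inl rfl⟩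
      · rw [e']; exact fun e he => List.mem_of_mem_filter he
      · rw [e']; exact ha.filter _
      · rw [e', hk _ h1, h2, hv.net]
        push_cast
        ring
    · have e' : maxFlow (j + 1) r arcs s t = F := by rw [e]; exact if_neg ht
      rw [e']
      exact ⟨v, hv, Or.inr ht⟩

/-- Summing the excess over `R` cancels every arc with both ends in `R`, and only crossing arcs
remain. -/
theorem IsFlow.value_eq {arcs F : List (ℕ × ℕ)} {s t v : ℕ} (h : IsFlow arcs s t v F)
    {R : Finset ℕ} (hs : s ∈ R) (ht : t ∉ R) :
    (v : ℤ) = (F.toFinset.filter fun e => e.1 ∈ R ∧ e.2 ∉ R).card -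
      (F.toFinset.filter fun e => e.1 ∉ R ∧ e.2 ∈ R).card := by
  have h1 : ∑ z ∈ R, netOut F.toFinset z = v := by
    simp only [h.net, ← Finset.mul_sum, Finset.sum_sub_distrib, Finset.sum_ite_eq', hs, ht,
      if_true, if_false]
    ring
  rw [← h1]
  unfold netOut
  rw [Finset.sum_comm, Finset.card_filter, Finset.card_filter]
  push_cast
  rw [← Finset.sum_sub_distrib]
  refine Finset.sum_congr rfl fun e _ => ?_
  rw [Finset.sum_sub_distrib, Finset.sum_ite_eq', Finset.sum_ite_eq']
  by_cases h1 : e.1 ∈ R <;> by_cases h2 : e.2 ∈ R <;> simp [h1, h2]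

theorem IsFlow.value_le {arcs F : List (ℕ × ℕ)} {s t v : ℕ} (h : IsFlow arcs s t v F)
    {R : Finset ℕ} (hs : s ∈ R) (ht : t ∉ R) :
    v ≤ (arcs.toFinset.filter fun e => e.1 ∈ R ∧ e.2 ∉ R).card := by
  have h1 := h.value_eq hs ht
  have h2 : (F.toFinset.filter fun e => e.1 ∈ R ∧ e.2 ∉ R).card ≤
      (arcs.toFinset.filter fun e => e.1 ∈ R ∧ e.2 ∉ R).card := by
    refine Finset.card_le_card (Finset.filter_subset_filter _ fun e he => ?_)
    rw [List.mem_toFinset] at *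
    exact h.subset he
  omega

/-- If no residual arc leaves `R`, then every arc leaving `R` carries flow and no flow returns, so
the value counts exactly the leaving arcs. -/
theorem IsFlow.length_cutArcs {arcs F : List (ℕ × ℕ)} (ha : arcs.Nodup) {s t v : ℕ}
    (h : IsFlow arcs s t v F) {R : List ℕ} (hs : s ∈ R) (ht : t ∉ R)
    (hR : ∀ e ∈ residualArcs arcs F, e.1 ∈ R → e.2 ∈ R) : (cutArcs R arcs).length = v := by
  have h1 := h.value_eq (R := R.toFinset) (by simpa using hs) (by simpa using ht)
  have h2 : (F.toFinset.filter fun e => e.1 ∉ R.toFinset ∧ e.2 ∈ R.toFinset) = ∅ := by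
    refine Finset.filter_eq_empty_iff.2 fun e he ⟨h3, h4⟩ => h3 ?_
    rw [List.mem_toFinset] at *
    exact hR (e.2, e.1) (mem_residualArcs.2 (Or.inr he)) h4
  have h3 : (F.toFinset.filter fun e => e.1 ∈ R.toFinset ∧ e.2 ∉ R.toFinset) =
      (cutArcs R arcs).toFinset := by
    ext e
    simp only [cutArcs, Finset.mem_filter, List.mem_toFinset, List.mem_filter, decide_eq_true_eq]
    refine ⟨fun h' => ⟨h.subset h'.1, h'.2⟩, fun h' => ⟨?_, h'.2⟩⟩
    by_contra hF
    exact h'.2.2 (hR e (mem_residualArcs.2 (Or.inl ⟨h'.1, hF⟩)) h'.2.1)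
  have h4 : (cutArcs R arcs).toFinset.card = (cutArcs R arcs).length :=
    List.toFinset_card_of_nodup (ha.filter _)
  rw [h2, h3, Finset.card_empty, h4] at h1
  omega

/-! ### Vertex cuts -/

/-- The set `S` separates `A` from `B`, and `X` is the side of `A`. -/
structure IsSeparation {V : Type} (r : V → V → Prop) (X S A B : Set V) : Prop where
  disjoint : ∀ u ∈ X, u ∉ S
  closed : ∀ u ∈ X, ∀ v, r u v → v ∉ S → v ∈ X
  left : ∀ u ∈ A, u ∉ S → u ∈ X
  right : ∀ u ∈ B, u ∉ X

theorem mem_netArcs {n : ℕ} {E : List (ℕ × ℕ)} {A B : List ℕ} {e : ℕ × ℕ} :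
    e ∈ netArcs n E A B ↔ (∃ v < n, e = (v, n + v)) ∨ (∃ e' ∈ E, e = (n + e'.1, e'.2)) ∨
      (∃ a ∈ A, e = (n + n, a)) ∨ ∃ b ∈ B, e = (n + b, n + n + 1) := by
  simp only [netArcs, List.mem_append, List.mem_map, List.mem_range, eq_comm]

theorem nodup_netArcs {n : ℕ} {E : List (ℕ × ℕ)} {A B : List ℕ} (hE : E.Nodup) (hA : A.Nodup)
    (hB : B.Nodup) (hEn : ∀ e ∈ E, e.1 < n ∧ e.2 < n) (hBn : ∀ b ∈ B, b < n) :
    (netArcs n E A B).Nodup := by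
  unfold netArcs
  refine List.Nodup.append (List.nodup_range.map fun a b h => by simpa using h)
    (List.Nodup.append (hE.map fun a b h => by
      simp only [Prod.mk.injEq] at h; exact Prod.ext (by omega) h.2)
      (List.Nodup.append (hA.map fun a b h => by simpa using h) (hB.map fun a b h => by
        simpa using h) ?_) ?_) ?_
  · intro e h1 h2
    obtain ⟨a, ha, rfl⟩ := List.mem_map.1 h1
    obtain ⟨b, hb, h⟩ := List.mem_map.1 h2
    have := hBn b hb
    simp only [Prod.mk.injEq] at h
    omega
  · intro e h1 h2
    obtain ⟨a, ha, rfl⟩ := List.mem_map.1 h1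
    have := hEn a ha
    rcases List.mem_append.1 h2 with h2 | h2 <;> obtain ⟨b, hb, h⟩ := List.mem_map.1 h2 <;>
    simp only [Prod.mk.injEq] at h <;> omega
  · intro e h1 h2
    obtain ⟨a, ha, rfl⟩ := List.mem_map.1 h1
    have ha := List.mem_range.1 ha
    rcases List.mem_append.1 h2 with h2 | h2
    · obtain ⟨b, hb, h⟩ := List.mem_map.1 h2
      simp only [Prod.mk.injEq] at h; omega
    · rcases List.mem_append.1 h2 with h2 | h2 <;> obtain ⟨b, hb, h⟩ := List.mem_map.1 h2 <;>
      simp only [Prod.mk.injEq] at h <;> omega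

/-- Each leaving arc is blocked by removing one vertex. The side of `A` consists of the vertices
whose outgoing copy lies in `R` and that are not removed. Maximality of a flow plays no role, so any
set of nodes containing the source will do. -/
theorem cutOf_sound {k n : ℕ} {E : List (ℕ × ℕ)} {A B R S : List ℕ}
    (hEn : ∀ e ∈ E, e.1 < n ∧ e.2 < n) (hAn : ∀ a ∈ A, a < n)
    (hs : n + n ∈ R) (h : S ∈ cutOf k n (netArcs n E A B) R) :
    S.length ≤ k + 1 ∧
      ∃ X, IsSeparation (fun i j => (i, j) ∈ E) X {u | u ∈ S} {u | u ∈ A} {u | u ∈ B} := by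
  unfold cutOf at h
  split_ifs at h with hc
  swap
  · simp at h
  rw [List.mem_singleton.1 h]
  refine ⟨by simpa using hc.2, {v | v < n ∧ n + v ∈ R ∧
    v ∉ (cutArcs R (netArcs n E A B)).map (arcVertex n)}, ?_⟩
  have cross : ∀ e ∈ netArcs n E A B, e.1 ∈ R →
      arcVertex n e ∉ (cutArcs R (netArcs n E A B)).map (arcVertex n) → e.2 ∈ R := by
    intro e he h1 h2
    by_contra h3
    exact h2 (List.mem_map.2 ⟨e, by simp [cutArcs, he, h1, h3], rfl⟩)
  have v1 : ∀ v < n, arcVertex n (v, n + v) = v := fun v hv => by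
    simp only [arcVertex]
    rw [if_neg (by omega), if_neg (by omega)]; omega
  have v2 : ∀ x, ∀ v < n, arcVertex n (x, v) = v := fun x v hv => by
    simp only [arcVertex]
    rw [if_neg (by omega), if_pos hv]
  have v3 : ∀ b, arcVertex n (n + b, n + n + 1) = b := fun b => by simp [arcVertex]
  refine ⟨fun u hu => hu.2.2, fun u hu v huv hv => ?_, fun a ha haS => ?_, fun b hb hbX => ?_⟩
  · have hvn := (hEn _ huv).2
    have h1 : v ∈ R := cross (n + u, v) (mem_netArcs.2 (Or.inr (Or.inl ⟨_, huv, rfl⟩))) hu.2.1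
      (by rw [v2 _ v hvn]; exact hv)
    exact ⟨hvn, cross (v, n + v) (mem_netArcs.2 (Or.inl ⟨v, hvn, rfl⟩)) h1
      (by rw [v1 v hvn]; exact hv), hv⟩
  · have han := hAn a ha
    have h1 : a ∈ R := cross (n + n, a) (mem_netArcs.2 (Or.inr (Or.inr (Or.inl ⟨a, ha, rfl⟩)))) hs
      (by rw [v2 _ a han]; exact haS)
    exact ⟨han, cross (a, n + a) (mem_netArcs.2 (Or.inl ⟨a, han, rfl⟩)) h1
      (by rw [v1 a han]; exact haS), haS⟩
  · exact hc.1 (cross (n + b, n + n + 1)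
      (mem_netArcs.2 (Or.inr (Or.inr (Or.inr ⟨b, hb, rfl⟩)))) hbX.2.1
      (by rw [v3]; exact hbX.2.2))

/-- The separation bounds every flow by `k + 1`, so the allowance of `k + 2` augmentations is not
used up. The nodes reachable in the residual network then give a cut with as many arcs as the value
of the flow. -/
theorem netCut_ne_nil {k n : ℕ} {E : List (ℕ × ℕ)} {A B : List ℕ} (hE : E.Nodup) (hA : A.Nodup)
    (hB : B.Nodup) (hEn : ∀ e ∈ E, e.1 < n ∧ e.2 < n) (hAn : ∀ a ∈ A, a < n)
    (hBn : ∀ b ∈ B, b < n) {X : Set ℕ} {S : Finset ℕ} (hS : S.card ≤ k + 1)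
    (h : IsSeparation (fun i j => (i, j) ∈ E) X S {u | u ∈ A} {u | u ∈ B}) :
    netCut k n (netArcs n E A B) ≠ [] := by
  classical
  set arcs := netArcs n E A B with harcs
  have ha : arcs.Nodup := nodup_netArcs hE hA hB hEn hBn
  obtain ⟨v, hv, hor⟩ := exists_isFlow_maxFlow ha (k + 2) (n + n + 2) (n + n) (n + n + 1)
  set F := maxFlow (k + 2) (n + n + 2) arcs (n + n) (n + n + 1)
  -- The source, the incoming copies of `X` and `S`, and the outgoing copies of `X`: only the arcs
  -- between the two copies of vertices in `S` leave this set.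
  let R' : Finset ℕ := (Finset.range (n + n + 1)).filter fun z => z = n + n ∨
    (z < n ∧ (z ∈ X ∨ z ∈ S)) ∨ ∃ u < n, u ∈ X ∧ z = n + u
  have hR' : ∀ z, z ∈ R' ↔ z = n + n ∨ (z < n ∧ (z ∈ X ∨ z ∈ S)) ∨
      ∃ u < n, u ∈ X ∧ z = n + u := by
    intro z
    simp only [R', Finset.mem_filter, Finset.mem_range, and_iff_right_iff_imp]
    rintro (h | h | ⟨u, h, -, h'⟩) <;> omega
  have hXS : ∀ u v, u ∈ X → (u, v) ∈ E → v ∈ X ∨ v ∈ S := fun u v hu huv => by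
    by_cases hvS : v ∈ S
    · exact Or.inr hvS
    · exact Or.inl (h.closed u hu v huv hvS)
  have hle : v ≤ k + 1 := by
    refine (hv.value_le (R := R') ((hR' _).2 (Or.inl rfl)) ?_).trans (le_trans ?_ hS)
    · rw [hR']
      rintro (h | h | ⟨u, h, -, h'⟩) <;> omega
    · refine (Finset.card_le_card (t := S.image fun v => (v, n + v)) fun e he => ?_).trans
        Finset.card_image_le
      rw [Finset.mem_filter, List.mem_toFinset, harcs, mem_netArcs, hR', hR'] at he
      obtain ⟨he, h1, h2⟩ := he
      rw [Finset.mem_image]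
      rcases he with ⟨w, hw, rfl⟩ | ⟨e', he', rfl⟩ | ⟨a, ha', rfl⟩ | ⟨b, hb, rfl⟩
      · refine ⟨w, ?_, rfl⟩
        rcases h1 with h1 | ⟨-, h1 | h1⟩ | ⟨u, hu, hu', h1⟩
        · dsimp only at h1; omega
        · exact absurd (Or.inr (Or.inr ⟨w, hw, h1, rfl⟩)) h2
        · exact h1
        · dsimp only at h1; omega
      · exfalso
        have hn' := hEn e' he'
        rcases h1 with h1 | ⟨h1, -⟩ | ⟨u, hu, hu', h1⟩
        · dsimp only at h1; omega
        · dsimp only at h1; omega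
        · have : u = e'.1 := by dsimp only at h1; omega
          subst this
          exact h2 (Or.inr (Or.inl ⟨hn'.2, hXS _ _ hu' he'⟩))
      · exfalso
        refine h2 (Or.inr (Or.inl ⟨hAn a ha', ?_⟩))
        by_cases haS : a ∈ S
        · exact Or.inr haS
        · exact Or.inl (h.left a ha' haS)
      · exfalso
        have := hBn b hb
        rcases h1 with h1 | ⟨h1, -⟩ | ⟨u, hu, hu', h1⟩
        · dsimp only at h1; omega
        · dsimp only at h1; omega
        · have : u = b := by dsimp only at h1; omega
          subst this
          exact h.right u hb hu'
  have ht := hor.resolve_left (by omega)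
  have hlt : ∀ e ∈ arcs, e.1 < n + n + 2 ∧ e.2 < n + n + 2 := by
    intro e he
    rw [harcs, mem_netArcs] at he
    rcases he with ⟨w, hw, rfl⟩ | ⟨e', he', rfl⟩ | ⟨a, ha', rfl⟩ | ⟨b, hb, rfl⟩
    · dsimp only; omega
    · have := hEn e' he'; dsimp only; omega
    · have := hAn a ha'; dsimp only; omega
    · have := hBn b hb; dsimp only; omega
  have hcl := searchFrom_closed (r := n + n + 2) (arcs := residualArcs arcs F) (s := n + n)
    (by omega) (by
      rintro ⟨x, y⟩ he
      rcases mem_residualArcs.1 he with he | he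
      · exact (hlt _ he.1).2
      · exact (hlt _ (hv.subset he)).1)
  have hlen := hv.length_cutArcs ha
    (searchTree_searchFrom (n + n + 2) (residualArcs arcs F) (n + n)).start_mem ht hcl
  unfold netCut cutOf
  rw [if_pos ⟨ht, by rw [hlen]; exact hle⟩]
  simp

/-! ### Balanced separations in graphs of small tree-width -/

namespace SimpleGraph

variable {N : Type} {T : SimpleGraph N}

/-- The nodes on the side of `y` after the removal of the edge between `x` and `y`. -/
def sideOf (T : SimpleGraph N) (x y : N) : Set N :=
  {u | (T.deleteEdges {s(x, y)}).Reachable y u}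

theorem self_mem_sideOf (x y : N) : y ∈ T.sideOf x y := Reachable.refl _

theorem IsAcyclic.disjoint_sideOf (hT : T.IsAcyclic) {x y u : N} (h : T.Adj x y)
    (hu : u ∈ T.sideOf x y) : u ∉ T.sideOf y x := by
  intro hu'
  have hb := isAcyclic_iff_forall_adj_isBridge.1 hT h
  rw [isBridge_iff] at hb
  unfold sideOf at hu hu'
  rw [Set.mem_ofPred_eq, Sym2.eq_swap] at hu'
  exact hb (hu'.trans hu.symm)

theorem IsAcyclic.notMem_sideOf (hT : T.IsAcyclic) {x y : N} (h : T.Adj x y) :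
    x ∉ T.sideOf x y :=
  fun h' => hT.disjoint_sideOf h h' (self_mem_sideOf y x)

theorem sideOf_subset {x y : N} {Y : Set N} (hy : y ∈ Y)
    (hY : ∀ u ∈ T.sideOf x y, u ∈ Y → ∀ v, T.Adj u v → v ∈ T.sideOf x y → v ∈ Y) :
    T.sideOf x y ⊆ Y := by
  rintro u ⟨w⟩
  suffices ∀ (a b : N) (w : (T.deleteEdges {s(x, y)}).Walk a b), a ∈ T.sideOf x y → a ∈ Y → b ∈ Y
    from this y u w (self_mem_sideOf x y) hy
  intro a b w
  induction w with
  | nil => exact fun _ h => h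
  | cons h p ih =>
    intro h1 h2
    have h3 := Reachable.trans h1 h.reachable
    exact ih h3 (hY _ h1 h2 _ ((deleteEdges_adj.1 h).1) h3)

/-- Any edge other than the deleted one keeps its ends on the same side. -/
theorem IsAcyclic.eq_of_leave_sideOf (hT : T.IsAcyclic) {x y u v : N} (h : T.Adj x y)
    (hu : u ∈ T.sideOf x y) (huv : T.Adj u v) (hv : v ∉ T.sideOf x y) : u = y ∧ v = x := by
  by_cases he : s(u, v) = s(x, y)
  · rcases Sym2.eq_iff.1 he with ⟨rfl, rfl⟩ | h'
    · exact absurd hu (hT.notMem_sideOf h)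
    · exact h'
  · exact absurd (Reachable.trans hu (Adj.reachable (deleteEdges_adj.2 ⟨huv, he⟩))) hv

theorem IsAcyclic.sideOf_ssubset (hT : T.IsAcyclic) {x y z : N} (h : T.Adj x y) (hz : T.Adj y z)
    (hzx : z ≠ x) : T.sideOf y z ⊂ T.sideOf x y := by
  refine ⟨sideOf_subset ?_ fun u hu huY v huv hv => ?_, fun h' =>
    hT.notMem_sideOf hz (h' (self_mem_sideOf x y))⟩
  · by_contra h'
    exact hzx (hT.eq_of_leave_sideOf h (self_mem_sideOf x y) hz h').2
  · by_contra h'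
    obtain ⟨rfl, -⟩ := hT.eq_of_leave_sideOf h huY huv h'
    exact hT.notMem_sideOf hz hu

/-- Along a walk from `y` one stays on one side until the walk returns to `y`, by
`IsAcyclic.eq_of_leave_sideOf`. -/
theorem IsTree.exists_mem_sideOf (hT : T.IsTree) {y u : N} (h : u ≠ y) :
    ∃ z, T.Adj y z ∧ u ∈ T.sideOf y z := by
  obtain ⟨w⟩ := hT.connected.preconnected y u
  suffices ∀ (a b : N) (w : T.Walk a b), (a = y ∨ ∃ z, T.Adj y z ∧ a ∈ T.sideOf y z) →
    b = y ∨ ∃ z, T.Adj y z ∧ b ∈ T.sideOf y z from (this y u w (Or.inl rfl)).resolve_left h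
  intro a b w
  induction w with
  | nil => exact id
  | @cons a b c hab p ih =>
    rintro (rfl | ⟨z, hz, ha⟩)
    · exact ih (Or.inr ⟨b, hab, self_mem_sideOf _ _⟩)
    · by_cases hb : b ∈ T.sideOf y z
      · exact ih (Or.inr ⟨z, hz, hb⟩)
      · exact ih (Or.inl (hT.isAcyclic.eq_of_leave_sideOf hz ha hab hb).2)

end SimpleGraph

/-- Add the sets one at a time and stop when `a` is first reached; the last set overshoots by less
than `b`. -/
theorem Finset.exists_subset_biUnion_card {ι α : Type} [DecidableEq α] [DecidableEq ι]
    (f : ι → Finset α) {a b : ℕ} (Z : Finset ι) (hf : ∀ z ∈ Z, (f z).card ≤ b) (ha : 0 < a)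
    (hZ : a ≤ (Z.biUnion f).card) :
    ∃ Z' ⊆ Z, a ≤ (Z'.biUnion f).card ∧ (Z'.biUnion f).card < a + b := by
  induction Z using Finset.induction_on with
  | empty => simp at hZ; omega
  | insert z Z hz ih =>
    by_cases h : a ≤ (Z.biUnion f).card
    · obtain ⟨Z', h1, h2⟩ := ih (fun z hz => hf z (Finset.mem_insert_of_mem hz)) h
      exact ⟨Z', h1.trans (Finset.subset_insert _ _), h2⟩
    · refine ⟨_, subset_rfl, hZ, ?_⟩
      rw [Finset.biUnion_insert]
      have := Finset.card_union_le (f z) (Z.biUnion f)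
      have := hf z (Finset.mem_insert_self _ _)
      omega

namespace TreeDecomposition

variable {V : Type} {G : SimpleGraph V}

/-- The vertices in the bags on the side of `y`, but not in the bag of `x`. -/
def beyond (D : TreeDecomposition G) (x y : Fin D.numNodes) : Set V :=
  {v | v ∉ D.bag x ∧ ∃ u ∈ D.tree.sideOf x y, v ∈ D.bag u}

/-- The nodes whose bags contain `v` are connected and do not include `x`, so they cannot cross the
edge between `x` and `y`. -/
theorem mem_sideOf_of_mem_beyond (D : TreeDecomposition G) {x y : Fin D.numNodes}
    (h : D.tree.Adj x y) {v : V} (hv : v ∈ D.beyond x y) {u : Fin D.numNodes}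
    (hu : v ∈ D.bag u) : u ∈ D.tree.sideOf x y := by
  obtain ⟨h1, u₀, h2, h3⟩ := hv
  obtain ⟨w⟩ := (D.connected_nodes v).preconnected ⟨u₀, h3⟩ ⟨u, hu⟩
  suffices ∀ (a b : {x | v ∈ D.bag x}) (w : (D.tree.induce {x | v ∈ D.bag x}).Walk a b),
    a.1 ∈ D.tree.sideOf x y → b.1 ∈ D.tree.sideOf x y from this _ _ w h2
  intro a b w
  induction w with
  | nil => exact id
  | @cons a b c hab p ih =>
    refine fun ha => ih ?_
    by_contra hb
    have := (D.isTree.isAcyclic.eq_of_leave_sideOf h ha hab hb).2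
    exact h1 (this ▸ b.2)

theorem beyond_closed (D : TreeDecomposition G) {x y : Fin D.numNodes} (h : D.tree.Adj x y)
    {u v : V} (hu : u ∈ D.beyond x y) (huv : G.Adj u v) (hv : v ∉ D.bag x) : v ∈ D.beyond x y := by
  obtain ⟨z, h1, h2⟩ := D.exists_edge_subset_bag u v huv
  exact ⟨hv, z, D.mem_sideOf_of_mem_beyond h hu h1, h2⟩

theorem exists_mem_beyond (D : TreeDecomposition G) {y : Fin D.numNodes} {v : V}
    (hv : v ∉ D.bag y) : ∃ z, D.tree.Adj y z ∧ v ∈ D.beyond y z := by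
  obtain ⟨u, hu⟩ := D.exists_mem_bag v
  have : u ≠ y := fun h => hv (h ▸ hu)
  obtain ⟨z, h1, h2⟩ := D.isTree.exists_mem_sideOf this
  exact ⟨z, h1, hv, u, h2, hu⟩

-- The separator is the bag of `y`, and `A` collects the branches at `y` one after another until it
-- is large enough; since no branch is too large, enough of `W` is left over.
open Classical in
theorem exists_isSeparation_of_node (D : TreeDecomposition G) {k : ℕ}
    (hk : ∀ x, (D.bag x).card ≤ k + 1) {W : Finset V} (hW : 4 * k + 5 ≤ W.card)
    (y : Fin D.numNodes) (Z : Finset (Fin D.numNodes)) (hZ : ∀ z ∈ Z, D.tree.Adj y z)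
    (h1 : ∀ z ∈ Z, (W.filter (· ∈ D.beyond y z)).card ≤ 2 * k + 2)
    (h2 : k + 2 ≤ (Z.biUnion fun z => W.filter (· ∈ D.beyond y z)).card) :
    ∃ A ⊆ W, k + 2 ≤ A.card ∧ k + 2 ≤ (W \ A).card ∧ ∃ X : Set V, ∃ S : Finset V,
      S.card ≤ k + 1 ∧ IsSeparation G.Adj X S A (W \ A : Finset V) := by
  obtain ⟨Z', hZ', h3, h4⟩ := Finset.exists_subset_biUnion_card _ Z h1 (by omega) h2
  have hsub : (Z'.biUnion fun z => W.filter (· ∈ D.beyond y z)) ⊆ W :=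
    Finset.biUnion_subset.2 fun z _ => Finset.filter_subset _ _
  refine ⟨_, hsub, h3, ?_, {v | ∃ z ∈ Z', v ∈ D.beyond y z}, D.bag y, hk y, ?_, ?_, ?_, ?_⟩
  -- `A` has fewer than `(k + 2) + (2 * k + 2)` elements, hence at most `3 * k + 3` of the at least
  -- `4 * k + 5`.
  · have := Finset.card_sdiff_add_card_eq_card hsub
    omega
  · rintro u ⟨z, -, hu⟩
    exact hu.1
  · rintro u ⟨z, hz, hu⟩ v huv hv
    exact ⟨z, hz, D.beyond_closed (hZ z (hZ' hz)) hu huv hv⟩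
  · intro u hu _
    obtain ⟨z, hz, hu⟩ := Finset.mem_biUnion.1 (Finset.mem_coe.1 hu)
    exact ⟨z, hz, (Finset.mem_filter.1 hu).2⟩
  · rintro u hu ⟨z, hz, hu'⟩
    have hu := Finset.mem_sdiff.1 (Finset.mem_coe.1 hu)
    exact hu.2 (Finset.mem_biUnion.2 ⟨z, hz, Finset.mem_filter.2 ⟨hu.1, hu'⟩⟩)

-- Call an oriented edge heavy if at least `2 * k + 3` elements of `W` lie beyond it. At the head of
-- a heavy edge with smallest side, the branches ahead are light and together hold enough of `W`,
-- since the bag takes only `k + 1`. Without heavy edges any node serves.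
open Classical in
theorem exists_isSeparation (D : TreeDecomposition G) {k : ℕ}
    (hk : ∀ x, (D.bag x).card ≤ k + 1) {W : Finset V} (hW : 4 * k + 5 ≤ W.card) :
    ∃ A ⊆ W, k + 2 ≤ A.card ∧ k + 2 ≤ (W \ A).card ∧ ∃ X : Set V, ∃ S : Finset V,
      S.card ≤ k + 1 ∧ IsSeparation G.Adj X S A (W \ A : Finset V) := by
  have hcover : ∀ (Y : Finset V) (y : Fin D.numNodes) (Z : Finset (Fin D.numNodes)),
      (∀ v ∈ Y, v ∉ D.bag y → ∃ z ∈ Z, v ∈ D.beyond y z) → Y ⊆ W → 2 * k + 3 ≤ Y.card →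
      k + 2 ≤ (Z.biUnion fun z => W.filter (· ∈ D.beyond y z)).card := by
    intro Y y Z h hY hc
    have h1 : Y \ D.bag y ⊆ Z.biUnion fun z => W.filter (· ∈ D.beyond y z) := by
      intro v hv
      have hv := Finset.mem_sdiff.1 hv
      obtain ⟨z, hz, hv'⟩ := h v hv.1 hv.2
      exact Finset.mem_biUnion.2 ⟨z, hz, Finset.mem_filter.2 ⟨hY hv.1, hv'⟩⟩
    have h2 := Finset.card_le_card h1
    have h3 := Finset.le_card_sdiff (D.bag y) Y
    have := hk y
    omega
  let Q := (Finset.univ : Finset (Fin D.numNodes × Fin D.numNodes)).filter fun q =>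
    D.tree.Adj q.1 q.2 ∧ 2 * k + 3 ≤ (W.filter (· ∈ D.beyond q.1 q.2)).card
  rcases Q.eq_empty_or_nonempty with hQ | hQ
  · have hQ' : ∀ y z, D.tree.Adj y z → (W.filter (· ∈ D.beyond y z)).card ≤ 2 * k + 2 := by
      intro y z h
      by_contra h'
      have : (y, z) ∈ Q := Finset.mem_filter.2 ⟨Finset.mem_univ _, h, by simp only; omega⟩
      simp [hQ] at this
    obtain ⟨y⟩ := D.isTree.connected.nonempty
    refine D.exists_isSeparation_of_node hk hW y
      (Finset.univ.filter (D.tree.Adj y))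
      (fun z hz => (Finset.mem_filter.1 hz).2) (fun z hz => hQ' y z (Finset.mem_filter.1 hz).2)
      (hcover W y _ (fun v _ hv => ?_) subset_rfl (by omega))
    obtain ⟨z, hz, h⟩ := D.exists_mem_beyond hv
    exact ⟨z, Finset.mem_filter.2 ⟨Finset.mem_univ _, hz⟩, h⟩
  · obtain ⟨⟨x, y⟩, hq, hmin⟩ := Q.exists_min_image
      (fun q => (D.tree.sideOf q.1 q.2).ncard) hQ
    obtain ⟨-, hxy, hc⟩ := Finset.mem_filter.1 hq
    simp only at hxy hc hmin
    refine D.exists_isSeparation_of_node hk hW y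
      (Finset.univ.filter fun z => D.tree.Adj y z ∧ z ≠ x)
      (fun z hz => (Finset.mem_filter.1 hz).2.1) (fun z hz => ?_)
      (hcover (W.filter (· ∈ D.beyond x y)) y _ (fun v hv hvy => ?_)
        (Finset.filter_subset _ _) hc)
    · obtain ⟨-, hyz, hzx⟩ := Finset.mem_filter.1 hz
      by_contra h
      have h1 := hmin (y, z) (Finset.mem_filter.2 ⟨Finset.mem_univ _, hyz, by simp only; omega⟩)
      have h2 := Set.ncard_lt_ncard (D.isTree.isAcyclic.sideOf_ssubset hxy hyz hzx)
        (Set.toFinite _)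
      simp only at h1
      omega
    · have hv := (Finset.mem_filter.1 hv).2
      obtain ⟨z, hz, h⟩ := D.exists_mem_beyond hvy
      refine ⟨z, Finset.mem_filter.2 ⟨Finset.mem_univ _, hz, ?_⟩, h⟩
      -- The branch back to `x` is not used: a vertex beyond the edge in both directions would have
      -- its bags on both sides.
      rintro rfl
      obtain ⟨u, hu, hvu⟩ := hv.2
      exact D.isTree.isAcyclic.disjoint_sideOf hxy hu (D.mem_sideOf_of_mem_beyond hz h hvu)

/-- The tree-decomposition with only one bag. -/
def single {V : Type} [Fintype V] (G : SimpleGraph V) : TreeDecomposition G where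
  numNodes := 1
  tree := ⊥
  isTree := ⟨{ preconnected := fun x y => by rw [Subsingleton.elim x y] }, by simp⟩
  bag := fun _ => Finset.univ
  exists_mem_bag := fun v => ⟨0, Finset.mem_univ v⟩
  exists_edge_subset_bag := fun u v _ => ⟨0, Finset.mem_univ u, Finset.mem_univ v⟩
  connected_nodes := fun v =>
    { preconnected := fun x y => by rw [Subsingleton.elim x y]
      nonempty := ⟨⟨0, Finset.mem_univ v⟩⟩ }

theorem card_bag_le (D : TreeDecomposition G) (x : Fin D.numNodes) :
    (D.bag x).card ≤ D.width + 1 := by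
  have : (D.bag x).card ≤ Finset.univ.sup fun x => (D.bag x).card :=
    Finset.le_sup (f := fun x => (D.bag x).card) (Finset.mem_univ x)
  unfold width
  omega

end TreeDecomposition

theorem exists_width_eq_treewidth {V : Type} [Fintype V] (G : SimpleGraph V) :
    ∃ D : TreeDecomposition G, D.width = treewidth G :=
  Nat.sInf_mem (s := {w | ∃ D : TreeDecomposition G, D.width = w})
    ⟨_, TreeDecomposition.single G, rfl⟩

theorem treewidth_le_card {V : Type} [Fintype V] (G : SimpleGraph V) :
    treewidth G ≤ Fintype.card V :=
  (Nat.sInf_le (s := {w | ∃ D : TreeDecomposition G, D.width = w})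
    ⟨TreeDecomposition.single G, rfl⟩).trans
    ((Nat.sub_le _ _).trans (Finset.sup_le fun _ _ => Finset.card_le_univ _))

/-! ### The width of the elimination order -/

theorem PreConn.subset_of_closed {r : ℕ → ℕ → Prop} {K X : Set ℕ} (hK : PreConn r K)
    (h : ∃ u ∈ K, u ∈ X) (hX : ∀ u ∈ K, u ∈ X → ∀ v ∈ K, r u v → v ∈ X) : K ⊆ X := hK X h hX

/-- The set `C` is a component after the removal of `P`. -/
structure IsComponent (r : ℕ → ℕ → Prop) (P : Finset ℕ) (C : Set ℕ) : Prop where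
  nonempty : C.Nonempty
  preConn : PreConn r C
  notMem : ∀ u ∈ C, u ∉ P
  closed : ∀ u ∈ C, ∀ v, r u v → v ∉ P → v ∈ C

-- A connected set avoiding `P ∪ Q` either lies in `C` or misses it. In the second case it has no
-- neighbour in `Q`, because a component is closed under adjacency outside `P`, and the old bound
-- applies.
open Classical in
theorem IsComponent.widthLe_union {r : ℕ → ℕ → Prop} (hr : ∀ {a b}, r a b → r b a) {P Q : Finset ℕ}
    {C : Set ℕ} (hC : IsComponent r P C) (hQ : ∀ u ∈ Q, u ∈ C) {b : ℕ} (hP : WidthLe r P b)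
    (h : ∀ K : Set ℕ, K.Nonempty → PreConn r K → K ⊆ C → (∀ u ∈ K, u ∉ Q) →
      ((P ∪ Q).filter fun u => u ∈ nbrSet r K).card ≤ b) : WidthLe r (P ∪ Q) b := by
  intro K hK hKc hKP
  have hKP' : ∀ u ∈ K, u ∉ P ∧ u ∉ Q := fun u hu => by simpa using hKP u hu
  by_cases hKC : ∃ u ∈ K, u ∈ C
  · exact h K hK hKc (hKc.subset_of_closed hKC fun u _ huC v hv huv =>
      hC.closed u huC v huv (hKP' v hv).1) fun u hu => (hKP' u hu).2
  · refine (Finset.card_le_card fun u hu => ?_).trans (hP K hK hKc fun u hu => (hKP' u hu).1)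
    obtain ⟨h1, v, hv, hvu⟩ := Finset.mem_filter.1 hu
    refine Finset.mem_filter.2 ⟨(Finset.mem_union.1 h1).resolve_right fun huQ => ?_, v, hv, hvu⟩
    exact hKC ⟨v, hv, hC.closed u (hQ u huQ) v (hr hvu) (hKP' v hv).1⟩

open Classical in
theorem filter_nbrSet_subset {r : ℕ → ℕ → Prop} {P Q : Finset ℕ} {C K : Set ℕ} (hK : K ⊆ C) :
    ((P ∪ Q).filter fun u => u ∈ nbrSet r K) ⊆ (P.filter fun u => u ∈ nbrSet r C) ∪ Q := by
  intro u hu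
  obtain ⟨h1, v, hv, hvu⟩ := Finset.mem_filter.1 hu
  rcases Finset.mem_union.1 h1 with h1 | h1
  · exact Finset.mem_union_left _ (Finset.mem_filter.2 ⟨h1, v, hK hv, hvu⟩)
  · exact Finset.mem_union_right _ h1

open Classical in
theorem IsComponent.widthLe_union_of_card {r : ℕ → ℕ → Prop} (hr : ∀ {a b}, r a b → r b a)
    {P Q : Finset ℕ} {C : Set ℕ} (hC : IsComponent r P C) (hQ : ∀ u ∈ Q, u ∈ C) {b : ℕ}
    (hP : WidthLe r P b) (h : (P.filter fun u => u ∈ nbrSet r C).card + Q.card ≤ b) :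
    WidthLe r (P ∪ Q) b :=
  hC.widthLe_union hr hQ hP fun _ _ _ hKC _ =>
    (Finset.card_le_card (filter_nbrSet_subset hKC)).trans ((Finset.card_union_le _ _).trans h)

-- A connected subset of the rest of `C` lies on one side of `S`, so it loses the neighbours in `B \
-- S`, where `B` is the part of `W` on the other side. It gains at most `Q`. As `B ∩ S` and `Q` are
-- disjoint subsets of `S` and `S` is smaller than `B`, the loss exceeds the gain.
open Classical in
theorem IsComponent.card_lt_of_isSeparation {r : ℕ → ℕ → Prop} (hr : ∀ {a b}, r a b → r b a)
    {P Q A S W : Finset ℕ} {C X K : Set ℕ} (hC : IsComponent r P C)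
    (hQ : ∀ u, u ∈ Q ↔ u ∈ C ∧ u ∈ S) (hW : W = P.filter fun u => u ∈ nbrSet r C)
    (hA : A ⊆ W) (hSA : S.card < A.card) (hSB : S.card < (W \ A).card)
    (hS : IsSeparation r X S A (W \ A : Finset ℕ)) (hK : PreConn r K) (hKC : K ⊆ C)
    (hKQ : ∀ u ∈ K, u ∉ Q) :
    ((P ∪ Q).filter fun u => u ∈ nbrSet r K).card < W.card := by
  have hKS : ∀ u ∈ K, u ∉ S := fun u hu h => hKQ u hu ((hQ u).2 ⟨hKC hu, h⟩)
  have key : ∀ B ⊆ W, S.card < B.card → (∀ u ∈ B, u ∉ S → u ∉ nbrSet r K) →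
      ((P ∪ Q).filter fun u => u ∈ nbrSet r K).card < W.card := by
    intro B hB hSB hBK
    have h1 : ((P ∪ Q).filter fun u => u ∈ nbrSet r K) ⊆ (W \ (B \ S)) ∪ Q := by
      intro u hu
      have h2 := filter_nbrSet_subset hKC hu
      rw [← hW] at h2
      refine (Finset.mem_union.1 h2).elim (fun h3 => Finset.mem_union_left _
        (Finset.mem_sdiff.2 ⟨h3, fun h4 => ?_⟩)) (Finset.mem_union_right _)
      have h4 := Finset.mem_sdiff.1 h4
      exact hBK u h4.1 h4.2 (Finset.mem_filter.1 hu).2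
    have h2 := Finset.card_le_card h1
    have h3 := Finset.card_union_le (W \ (B \ S)) Q
    have h4 := Finset.card_sdiff_add_card_eq_card (Finset.sdiff_subset.trans hB : B \ S ⊆ W)
    have h5 := Finset.card_sdiff_add_card_inter B S
    have h6 : Disjoint (B ∩ S) Q := by
      refine Finset.disjoint_left.2 fun u h1 h2 => ?_
      have h3 := hB (Finset.mem_inter.1 h1).1
      rw [hW] at h3
      exact hC.notMem u ((hQ u).1 h2).1 (Finset.mem_filter.1 h3).1
    have h7 : (B ∩ S) ∪ Q ⊆ S := Finset.union_subset Finset.inter_subset_right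
      fun u hu => ((hQ u).1 hu).2
    have h8 := Finset.card_le_card h7
    rw [Finset.card_union_of_disjoint h6] at h8
    omega
  by_cases hX : ∃ u ∈ K, u ∈ X
  · have hKX := hK.subset_of_closed hX fun u _ huX v hv huv => hS.closed u huX v huv (hKS v hv)
    refine key (W \ A) Finset.sdiff_subset hSB fun u hu huS ⟨v, hv, hvu⟩ => ?_
    exact hS.right u (Finset.mem_coe.2 hu) (hS.closed v (hKX hv) u hvu huS)
  · refine key A hA hSA fun u hu huS ⟨v, hv, hvu⟩ => hX ⟨v, hv, ?_⟩
    exact hS.closed u (hS.left u (Finset.mem_coe.2 hu) huS) v (hr hvu) (hKS v hv)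

theorem isComponent_compOf {n : ℕ} {E : List (ℕ × ℕ)} (hEn : ∀ e ∈ E, e.1 < n ∧ e.2 < n)
    (hr : ∀ {a b}, (a, b) ∈ E → (b, a) ∈ E) {P : List ℕ} {v : ℕ} (hv : v < n) (hvP : v ∉ P) :
    IsComponent (fun i j => (i, j) ∈ E) P.toFinset {u | u ∈ compOf n E P v} := by
  have h := searchTree_searchFrom n (E.filter fun e => decide (e.2 ∉ P)) v
  have hs := h.start_mem
  have hc := searchFrom_closed (r := n) (arcs := E.filter fun e => decide (e.2 ∉ P)) hv
    fun e he => (hEn e (List.mem_of_mem_filter he)).2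
  have hP : ∀ u ∈ compOf n E P v, u ∉ P := fun u hu =>
    h.mem_of_closed (X := {u | u ∉ P}) hvP (fun e he _ _ => by
      simpa using (List.mem_filter.1 he).2) hu
  have key : ∀ X : Set ℕ, v ∈ X →
      (∀ u ∈ compOf n E P v, u ∈ X → ∀ w ∈ compOf n E P v, (u, w) ∈ E → w ∈ X) →
      ∀ u ∈ compOf n E P v, u ∈ X := fun X hvX hX u hu =>
    h.mem_of_closed hvX (fun e he he1 heX =>
      hX e.1 he1 heX e.2 (hc e he he1) (List.mem_of_mem_filter he)) hu
  refine ⟨⟨v, hs⟩, ?_, ?_, ?_⟩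
  · rintro X ⟨u, hu, huX⟩ hX
    -- Search shows only that everything is reached from `v`. If `v` is not in `X`, the complement
    -- of `X` is closed by symmetry and swallows the component.
    by_cases hvX : v ∈ X
    · exact key X hvX hX
    · refine absurd huX (key Xᶜ hvX (fun a ha haX b hb hab hbX => haX ?_) u hu)
      exact hX b hb hbX a ha (hr hab)
  · intro u hu
    simpa using hP u hu
  · intro u hu w huw hw
    exact hc (u, w) (List.mem_filter.2 ⟨huw, by simpa using hw⟩) hu

theorem mem_nbrsIn {E : List (ℕ × ℕ)} {P C : List ℕ} {u : ℕ} :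
    u ∈ nbrsIn E P C ↔ u ∈ P ∧ u ∈ nbrSet (fun i j => (i, j) ∈ E) {u | u ∈ C} := by
  simp only [nbrsIn, List.mem_filter, decide_eq_true_eq, nbrSet]
  refine and_congr_right fun _ => ⟨?_, ?_⟩
  · rintro ⟨e, he, h1, rfl⟩
    exact ⟨e.1, h1, he⟩
  · rintro ⟨v, hv, h⟩
    exact ⟨_, h, hv, rfl⟩

/-! ### Finding separations -/

theorem subsetsUpTo_append (K : ℕ) (W : List ℕ) (a : ℕ) : subsetsUpTo K (W ++ [a]) =
    (subsetsUpTo K W ++ (subsetsUpTo K W).map fun s => a :: s).take K := by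
  simp [subsetsUpTo]

theorem subset_of_mem_subsetsUpTo {K : ℕ} {W A : List ℕ} (hW : W.Nodup)
    (hA : A ∈ subsetsUpTo K W) : A.Nodup ∧ A ⊆ W := by
  induction W using List.reverseRecOn generalizing A with
  | nil => simp [subsetsUpTo] at hA; simp [hA]
  | append_singleton W a ih =>
    have hW' := List.nodup_append.1 hW
    rw [subsetsUpTo_append] at hA
    rcases List.mem_append.1 (List.mem_of_mem_take hA) with h | h
    · exact ⟨(ih hW'.1 h).1, fun u hu => List.mem_append_left _ ((ih hW'.1 h).2 hu)⟩
    · obtain ⟨A, hA', rfl⟩ := List.mem_map.1 h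
      obtain ⟨h1, h2⟩ := ih hW'.1 hA'
      refine ⟨List.nodup_cons.2 ⟨fun ha => hW'.2.2 a (h2 ha) a (by simp) rfl, h1⟩, ?_⟩
      intro u hu
      rcases List.mem_cons.1 hu with rfl | hu
      · simp
      · exact List.mem_append_left _ (h2 hu)

/-- The length bound is carried along in the induction because it is what makes the cap harmless at
the next step. -/
theorem exists_mem_subsetsUpTo {K : ℕ} {W : List ℕ} (hK : 2 ^ W.length ≤ K) {A : Finset ℕ}
    (hA : A ⊆ W.toFinset) :
    (subsetsUpTo K W).length ≤ 2 ^ W.length ∧ ∃ A' ∈ subsetsUpTo K W, A'.toFinset = A := by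
  induction W using List.reverseRecOn generalizing A with
  | nil => simp at hA; simp [subsetsUpTo, hA]
  | append_singleton W a ih =>
    rw [List.length_append, List.length_singleton, pow_succ] at hK
    have ih := fun {A} => ih (by omega) (A := A)
    have hl := (ih (Finset.empty_subset _)).1
    have hl' : (subsetsUpTo K W ++ (subsetsUpTo K W).map fun s => a :: s).length ≤
        2 ^ (W.length + 1) := by
      rw [List.length_append, List.length_map, pow_succ]; omega
    rw [subsetsUpTo_append, List.take_of_length_le (hl'.trans (by rwa [pow_succ]))]
    rw [show (W ++ [a]).length = W.length + 1 by simp]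
    refine ⟨hl', ?_⟩
    have h0 : A.erase a ⊆ W.toFinset := by
      intro u hu
      have := hA (Finset.mem_of_mem_erase hu)
      simpa [Finset.ne_of_mem_erase hu] using this
    obtain ⟨-, A', h1, h2⟩ := ih h0
    by_cases ha : a ∈ A
    · refine ⟨a :: A', List.mem_append_right _ (List.mem_map.2 ⟨A', h1, rfl⟩), ?_⟩
      rw [List.toFinset_cons, h2, Finset.insert_erase ha]
    · exact ⟨A', List.mem_append_left _ h1, by rw [h2, Finset.erase_eq_of_notMem ha]⟩

/-- Every large set of vertices is split well by a set of `k + 1` vertices. -/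
def HasSplits (n k : ℕ) (E : List (ℕ × ℕ)) : Prop :=
  ∀ W : Finset ℕ, (∀ u ∈ W, u < n) → 4 * k + 5 ≤ W.card →
    ∃ A ⊆ W, k + 2 ≤ A.card ∧ k + 2 ≤ (W \ A).card ∧ ∃ X : Set ℕ, ∃ S : Finset ℕ,
      S.card ≤ k + 1 ∧ IsSeparation (fun i j => (i, j) ∈ E) X S A (W \ A : Finset ℕ)

theorem IsArcList.hasSplits {n : ℕ} {G : SimpleGraph (Fin n)} {E : List (ℕ × ℕ)}
    (hE : IsArcList G E) : HasSplits n (treewidth G) E := by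
  intro W hW hc
  obtain ⟨D, hD⟩ := exists_width_eq_treewidth G
  obtain ⟨W, rfl⟩ : ∃ W' : Finset (Fin n), W'.map Fin.valEmbedding = W :=
    ⟨W.attachFin hW, by ext; simp⟩
  rw [Finset.card_map] at hc
  obtain ⟨A, hA, h1, h2, X, S, hS, h⟩ := D.exists_isSeparation (k := treewidth G)
    (fun x => hD ▸ D.card_bag_le x) hc
  refine ⟨A.map Fin.valEmbedding, Finset.map_subset_map.2 hA, by rwa [Finset.card_map], ?_,
    Fin.val '' X, S.map Fin.valEmbedding, by rwa [Finset.card_map], ?_, ?_, ?_, ?_⟩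
  · rw [← Finset.map_sdiff, Finset.card_map]
    convert h2
  · rintro _ ⟨u, hu, rfl⟩ h'
    exact h.disjoint u hu (by simpa [Fin.val_inj] using h')
  · rintro _ ⟨u, hu, rfl⟩ v huv hv
    obtain ⟨_, hj, huv⟩ := (hE.mem _ _).1 huv
    refine ⟨⟨v, hj⟩, h.closed u hu _ huv fun h' => hv ?_, rfl⟩
    exact Finset.mem_coe.2 (Finset.mem_map.2 ⟨⟨v, hj⟩, h', rfl⟩)
  · intro u hu hv
    obtain ⟨u, hu', rfl⟩ := Finset.mem_map.1 (Finset.mem_coe.1 hu)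
    exact ⟨u, h.left u (Finset.mem_coe.2 hu') fun h' => hv (by simpa [Fin.val_inj] using h'), rfl⟩
  · rintro u hu ⟨u, hu', rfl⟩
    refine h.right u ?_ hu'
    simpa [Fin.val_inj] using hu

/-- The splitting of `W` given by `HasSplits` makes the search succeed for at least one subset; the
cut returned may belong to another subset, and its properties come from `cutOf_sound`. -/
theorem findSep_spec {K k n : ℕ} {E : List (ℕ × ℕ)} (hE : E.Nodup)
    (hEn : ∀ e ∈ E, e.1 < n ∧ e.2 < n) (hk : HasSplits n k E) {W : List ℕ} (hW : W.Nodup)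
    (hWn : ∀ u ∈ W, u < n) (hc : W.length = 4 * k + 5) (hK : 2 ^ (4 * k + 5) ≤ K) :
    (findSep K k n E W).length ≤ k + 1 ∧ ∃ A ⊆ W.toFinset, k + 2 ≤ A.card ∧
      k + 2 ≤ (W.toFinset \ A).card ∧ ∃ X, IsSeparation (fun i j => (i, j) ∈ E) X
        {u | u ∈ findSep K k n E W} A (W.toFinset \ A : Finset ℕ) := by
  have hcard : ∀ A ∈ subsetsUpTo K W, A.toFinset.card = A.length ∧
      (W.toFinset \ A.toFinset).card = (listDiff W A).length := by
    intro A hA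
    refine ⟨List.toFinset_card_of_nodup (subset_of_mem_subsetsUpTo hW hA).1, ?_⟩
    have h1 : (listDiff W A).Nodup := hW.filter _
    rw [← List.toFinset_card_of_nodup h1]
    congr 1
    ext u
    simp [listDiff]
  have hdiff : ∀ A : List ℕ, {u | u ∈ listDiff W A} =
      ((W.toFinset \ A.toFinset : Finset ℕ) : Set ℕ) := by
    intro A
    ext u
    simp [listDiff]
  have hset : ∀ A : List ℕ, {u | u ∈ A} = (A.toFinset : Set ℕ) := by
    intro A
    ext u
    simp
  have hne : ((subsetsUpTo K W).flatMap fun A => sepFor k n E W A) ≠ [] := by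
    obtain ⟨A, hA, h1, h2, X, S, hS, h⟩ := hk W.toFinset (fun u hu => hWn u (by simpa using hu))
      (by rw [List.toFinset_card_of_nodup hW, hc])
    obtain ⟨-, A', hA', rfl⟩ := exists_mem_subsetsUpTo (K := K) (by rwa [hc]) hA
    have h3 := hcard A' hA'
    have h4 := subset_of_mem_subsetsUpTo hW hA'
    have h5 : sepFor k n E W A' ≠ [] := by
      rw [sepFor, if_pos ⟨h3.1 ▸ h1, h3.2 ▸ h2⟩]
      refine netCut_ne_nil (X := X) hE h4.1 (hW.filter _) hEn (fun a ha => hWn a (h4.2 ha))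
        (fun b hb => hWn b (List.mem_of_mem_filter hb)) hS ?_
      rw [hdiff, hset]
      exact h
    obtain ⟨x, hx⟩ := List.exists_mem_of_ne_nil _ h5
    exact List.ne_nil_of_mem (List.mem_flatMap.2 ⟨A', hA', hx⟩)
  have hmem : findSep K k n E W ∈ (subsetsUpTo K W).flatMap fun A => sepFor k n E W A := by
    unfold findSep
    obtain ⟨x, l, hl⟩ := List.exists_cons_of_ne_nil hne
    rw [hl]
    exact List.mem_cons_self
  obtain ⟨A, hA, h⟩ := List.mem_flatMap.1 hmem
  unfold sepFor at h
  split_ifs at h with h'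
  swap
  · simp at h
  have h3 := hcard A hA
  have h4 := subset_of_mem_subsetsUpTo hW hA
  obtain ⟨h5, X, h6⟩ := cutOf_sound hEn (fun a ha => hWn a (h4.2 ha))
    (searchTree_searchFrom _ _ _).start_mem h
  refine ⟨h5, A.toFinset, fun u hu => by simpa using h4.2 (by simpa using hu), h3.1 ▸ h'.1,
    h3.2 ▸ h'.2, X, ?_⟩
  rw [hdiff, hset A] at h6
  exact h6

/-! ### The invariant -/

/-- The list `P` is the start of a good elimination order. -/
structure IsGoodOrder (n k : ℕ) (E : List (ℕ × ℕ)) (P : List ℕ) : Prop where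
  nodup : P.Nodup
  lt : ∀ u ∈ P, u < n
  width : WidthLe (fun i j => (i, j) ∈ E) P.toFinset (4 * k + 5)
  width_suffix : ∀ l, l <:+ P → WidthLe (fun i j => (i, j) ∈ E) l.toFinset (5 * k + 6)

theorem WidthLe.mono {r : ℕ → ℕ → Prop} {P : Finset ℕ} {a b : ℕ} (h : WidthLe r P a)
    (hab : a ≤ b) : WidthLe r P b := fun K h1 h2 h3 => (h K h1 h2 h3).trans hab

theorem isGoodOrder_nil (n k : ℕ) (E : List (ℕ × ℕ)) : IsGoodOrder n k E [] := by
  have : WidthLe (fun i j => (i, j) ∈ E) (List.toFinset []) 0 := fun K _ _ _ => by simp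
  refine ⟨List.nodup_nil, by simp, this.mono (by omega), fun l hl => ?_⟩
  rw [List.suffix_nil.1 hl]
  exact this.mono (by omega)

/-- Below the limit, one new vertex raises the number of neighbours by at most one. At the limit,
the cut makes the number drop, so the invariant `4 * k + 5` is restored once the whole cut is
placed. -/
theorem IsGoodOrder.placeComp {K k n : ℕ} {E : List (ℕ × ℕ)} (hE : E.Nodup)
    (hEn : ∀ e ∈ E, e.1 < n ∧ e.2 < n) (hr : ∀ {a b}, (a, b) ∈ E → (b, a) ∈ E)
    (hk : HasSplits n k E) (hK : 2 ^ (4 * k + 5) ≤ K) {P : List ℕ} (h : IsGoodOrder n k E P)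
    {v : ℕ} (hv : v < n) (hvP : v ∉ P) :
    IsGoodOrder n k E (placeComp K k n E P v (compOf n E P v)) ∧
      P.length < (placeComp K k n E P v (compOf n E P v)).length := by
  classical
  have hC := isComponent_compOf hEn hr hv hvP
  have hvC : v ∈ compOf n E P v := (searchTree_searchFrom _ _ _).start_mem
  unfold _root_.placeComp
  set C := compOf n E P v
  set W := nbrsIn E P C with hWdef
  have hW : W.Nodup := h.nodup.filter _
  have hWP : W.toFinset = P.toFinset.filter
      fun u => u ∈ nbrSet (fun i j => (i, j) ∈ E) {u | u ∈ C} := by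
    ext u
    rw [List.mem_toFinset, hWdef, mem_nbrsIn, Finset.mem_filter, List.mem_toFinset]
  have hWc : W.length ≤ 4 * k + 5 := by
    rw [← List.toFinset_card_of_nodup hW, hWP]
    have := h.width _ hC.nonempty hC.preConn hC.notMem
    convert this
  have hcard : ((P.toFinset.filter
      fun u => u ∈ nbrSet (fun i j => (i, j) ∈ E) {u | u ∈ C})).card = W.length := by
    rw [← hWP, List.toFinset_card_of_nodup hW]
  unfold placeIn
  split_ifs with hle
  · have h1 : (v :: P).toFinset = P.toFinset ∪ {v} := by
      rw [List.toFinset_cons, Finset.insert_eq, Finset.union_comm]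
    have h2 : WidthLe (fun i j => (i, j) ∈ E) (v :: P).toFinset (4 * k + 5) := by
      rw [h1]
      refine hC.widthLe_union_of_card hr (by simpa using hvC) h.width ?_
      rw [hcard, Finset.card_singleton]
      omega
    refine ⟨⟨List.nodup_cons.2 ⟨hvP, h.nodup⟩, ?_, h2, fun l hl => ?_⟩, by simp⟩
    · intro u hu
      rcases List.mem_cons.1 hu with rfl | hu
      · exact hv
      · exact h.lt u hu
    · rcases List.suffix_cons_iff.1 hl with rfl | hl
      · exact h2.mono (by omega)
      · exact h.width_suffix l hl
  · have hWl : W.length = 4 * k + 5 := by omega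
    obtain ⟨hS, A, hA, hA1, hA2, X, hX⟩ := findSep_spec hE hEn hk hW
      (fun u hu => h.lt u (List.mem_of_mem_filter hu)) hWl hK
    set S := findSep K k n E W
    set Q := (List.range n).filter fun u => decide (u ∈ C ∧ u ∈ S) with hQdef
    have hCn : ∀ u ∈ C, u < n := fun u hu =>
      (searchTree_searchFrom n (E.filter fun e => decide (e.2 ∉ P)) v).mem_of_closed
        (X := {u | u < n}) hv (fun e he _ _ => (hEn e (List.mem_of_mem_filter he)).2) hu
    have hQ : ∀ u, u ∈ Q ↔ u ∈ C ∧ u ∈ S := by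
      intro u
      rw [hQdef, List.mem_filter, decide_eq_true_eq, List.mem_range]
      exact ⟨And.right, fun h => ⟨hCn u h.1, h⟩⟩
    have hQn : Q.Nodup := List.nodup_range.filter _
    have hQS : Q.length ≤ k + 1 :=
      (hQn.subperm fun u hu => ((hQ u).1 hu).2).length_le.trans hS
    have hSc : S.toFinset.card ≤ k + 1 := (List.toFinset_card_le S).trans hS
    have hlt : ∀ K : Set ℕ, PreConn (fun i j => (i, j) ∈ E) K → K ⊆ {u | u ∈ C} →
        (∀ u ∈ K, u ∉ Q.toFinset) → ((P.toFinset ∪ Q.toFinset).filter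
          fun u => u ∈ nbrSet (fun i j => (i, j) ∈ E) K).card < W.toFinset.card :=
      fun K hK hKC hKQ => hC.card_lt_of_isSeparation hr (S := S.toFinset) (A := A) (X := X)
        (by simpa using hQ) hWP hA (by omega) (by omega) (by
          convert hX using 1
          · ext; simp) hK hKC hKQ
    rw [List.toFinset_card_of_nodup hW, hWl] at hlt
    have hQP : ∀ l, (l ++ P).toFinset = P.toFinset ∪ l.toFinset := fun l => by
      rw [List.toFinset_append, Finset.union_comm]
    -- If nothing of the cut lay in the component, the component itself would have fewer neighbours
    -- than it has.
    have hQne : Q ≠ [] := by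
      intro h0
      have := hlt {u | u ∈ C} hC.preConn subset_rfl (by simp [h0])
      rw [h0, List.toFinset_nil, Finset.union_empty, hcard] at this
      omega
    refine ⟨⟨hQn.append h.nodup fun u hu huP => ?_, ?_, ?_, fun l hl => ?_⟩, ?_⟩
    · exact hC.notMem u ((hQ u).1 hu).1 (List.mem_toFinset.2 huP)
    · intro u hu
      rcases List.mem_append.1 hu with hu | hu
      · exact hCn u ((hQ u).1 hu).1
      · exact h.lt u hu
    · rw [hQP]
      exact hC.widthLe_union hr (fun u hu => ((hQ u).1 (List.mem_toFinset.1 hu)).1) h.width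
        fun K _ hK hKC hKQ => (hlt K hK hKC hKQ).le
    · rcases List.suffix_or_suffix_of_suffix hl (List.suffix_append Q P) with hl | ⟨l', rfl⟩
      · exact h.width_suffix l hl
      · have hl' : l' <:+ Q := by
          obtain ⟨t, ht⟩ := hl
          exact ⟨t, List.append_cancel_right (by rwa [List.append_assoc])⟩
        rw [hQP]
        refine hC.widthLe_union_of_card hr
          (fun u hu => ((hQ u).1 (hl'.subset (List.mem_toFinset.1 hu))).1)
          (h.width.mono (by omega)) ?_
        have h1 := List.toFinset_card_le l'
        have h2 := hl'.length_le
        rw [hcard]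
        omega
    · rw [List.length_append]
      have := List.length_pos_of_ne_nil hQne
      omega

theorem IsGoodOrder.placeStep {K k n : ℕ} {E : List (ℕ × ℕ)} (hE : E.Nodup)
    (hEn : ∀ e ∈ E, e.1 < n ∧ e.2 < n) (hr : ∀ {a b}, (a, b) ∈ E → (b, a) ∈ E)
    (hk : HasSplits n k E) (hK : 2 ^ (4 * k + 5) ≤ K) {P : List ℕ} (h : IsGoodOrder n k E P) :
    IsGoodOrder n k E (placeStep K k n E P) ∧
      ((∀ u < n, u ∈ placeStep K k n E P) ∨ P.length < (placeStep K k n E P).length) := by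
  unfold _root_.placeStep
  cases hl : (List.range n).filter fun u => decide (u ∉ P) with
  | nil =>
    refine ⟨h, Or.inl fun u hu => ?_⟩
    have := List.filter_eq_nil_iff.1 hl u (List.mem_range.2 hu)
    rw [decide_eq_true_eq, not_not] at this
    exact this
  | cons v l =>
    have : v ∈ (List.range n).filter fun u => decide (u ∉ P) := hl ▸ List.mem_cons_self
    rw [List.mem_filter, List.mem_range, decide_eq_true_eq] at this
    obtain ⟨h1, h2⟩ := h.placeComp hE hEn hr hk hK this.1 this.2
    exact ⟨h1, Or.inr h2⟩

/-- Every step places a new vertex or finds all placed, and only `n` vertices are available. -/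
theorem isGoodOrder_elimOrder {K k n : ℕ} {E : List (ℕ × ℕ)} (hE : E.Nodup)
    (hEn : ∀ e ∈ E, e.1 < n ∧ e.2 < n) (hr : ∀ {a b}, (a, b) ∈ E → (b, a) ∈ E)
    (hk : HasSplits n k E) (hK : 2 ^ (4 * k + 5) ≤ K) :
    IsGoodOrder n k E (elimOrder K k n E) ∧ ∀ u < n, u ∈ elimOrder K k n E := by
  have hall : ∀ P, IsGoodOrder n k E P → n ≤ P.length → ∀ u < n, u ∈ P := by
    intro P hP hn u hu
    have h1 : P.Subperm (List.range n) :=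
      hP.nodup.subperm fun u hu => List.mem_range.2 (hP.lt u hu)
    have h2 := (h1.perm_of_length_le (by simpa using hn)).mem_iff (a := u)
    exact h2.2 (List.mem_range.2 hu)
  have key : ∀ j, IsGoodOrder n k E ((List.range j).foldl (fun P _ => placeStep K k n E P) []) ∧
      ((∀ u < n, u ∈ (List.range j).foldl (fun P _ => placeStep K k n E P) []) ∨
        j ≤ ((List.range j).foldl (fun P _ => placeStep K k n E P) []).length) := by
    intro j
    induction j with
    | zero => exact ⟨isGoodOrder_nil _ _ _, Or.inr (Nat.zero_le _)⟩
    | succ j ih =>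
      rw [List.range_succ, List.foldl_append, List.foldl_cons, List.foldl_nil]
      obtain ⟨h1, h2⟩ := ih
      obtain ⟨h3, h4⟩ := h1.placeStep hE hEn hr hk hK
      refine ⟨h3, h4.imp_right fun h5 => ?_⟩
      rcases h2 with h2 | h2
      · exfalso
        have h6 : ((List.range j).foldl (fun P _ => placeStep K k n E P) []).length ≥ n := by
          have : (List.range n).Subperm
            ((List.range j).foldl (fun P _ => placeStep K k n E P) []) :=
            List.nodup_range.subperm fun u hu => h2 u (List.mem_range.1 hu)
          simpa using this.length_le
        have h7 : (_root_.placeStep K k n E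
            ((List.range j).foldl (fun P _ => placeStep K k n E P) [])).Subperm
            (List.range n) := h3.nodup.subperm fun u hu => List.mem_range.2 (h3.lt u hu)
        have := h7.length_le
        rw [List.length_range] at this
        omega
      · omega
  obtain ⟨h1, h2⟩ := key n
  exact ⟨h1, h2.elim id (hall _ h1)⟩

/-! ### Reading the input -/

/-- Capping after each bit gives the same as capping at the end, since a capped value stays capped
when doubled. It is needed because `p` may be exponential in the input length while numbers count
with their value. -/
theorem nat_foldr_bits (p c : ℕ) (hc : 0 < c) :
    (List.range (Nat.bits p).length).foldr
      (fun q r => min (r + r + if (Nat.bits p).getD q false = true then 1 else 0) c) 0 =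
      min p c := by
  induction p using Nat.binaryRec' with
  | zero => simp
  | bit b m hm ih =>
    rw [Nat.bits_append_bit m b hm, List.length_cons, List.range_succ_eq_map, List.foldr_cons,
      List.foldr_map]
    simp only [List.getD_cons_succ, List.getD_cons_zero]
    rw [ih, Nat.bit_val]
    cases b <;> simp <;> omega

namespace ECPInstance

variable (x : ECPInstance)

theorem order_pos : 0 < x.n := Fin.pos_iff_nonempty.2 x.connected.nonempty

theorem length_encode :
    x.encode.length = x.n + 1 + x.n * x.n + (Nat.bits x.p).length := by
  simp [encode]
  omega

open Classical in
theorem encode_getD (i : ℕ) : x.encode.getD i false =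
    if i < x.n then true else if h : i - (x.n + 1) < x.n * x.n then
      (if i = x.n then false else decide (x.G.Adj (Fin.divNat ⟨i - (x.n + 1), h⟩)
        (Fin.modNat ⟨i - (x.n + 1), h⟩)))
      else (Nat.bits x.p).getD (i - (x.n + 1 + x.n * x.n)) false := by
  have hn : 0 < x.n * x.n := Nat.mul_pos x.order_pos x.order_pos
  unfold encode
  split_ifs with h1 h2 h3
  · rw [List.getD_append _ _ _ _ (by simp; omega), List.getD_append _ _ _ _ (by simp; omega),
      List.getD_append _ _ _ _ (by simpa using h1)]
    simp [h1]
  · rw [List.getD_append _ _ _ _ (by simp; omega), List.getD_append _ _ _ _ (by simp; omega),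
      List.getD_append_right _ _ _ _ (by simpa using h1)]
    simp [h3]
  · rw [List.getD_append _ _ _ _ (by simp; omega),
      List.getD_append_right _ _ _ _ (by simp; omega)]
    rw [List.getD_eq_getElem _ _ (by simpa using h2), List.getElem_ofFn]
    simp
  · rw [List.getD_append_right _ _ _ _ (by simp; omega)]
    congr 1
    simp [add_assoc, add_comm 1]

theorem readOrder_encode : readOrder x.encode = x.n := by
  have h : ∀ i, AllOnes x.encode (i + 1) ↔ i < x.n := by
    intro i
    unfold AllOnes
    constructor
    · intro h
      by_contra h'
      have := h x.n (List.mem_range.2 (by omega))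
      rw [encode_getD] at this
      have hn : 0 < x.n * x.n := Nat.mul_pos x.order_pos x.order_pos
      simp [hn] at this
    · intro h j hj
      rw [List.mem_range] at hj
      rw [encode_getD, if_pos (by omega)]
  have hperm : ((List.range x.encode.length).filter
      fun i => decide (AllOnes x.encode (i + 1))).Perm (List.range x.n) := by
    rw [List.perm_ext_iff_of_nodup (List.nodup_range.filter _) List.nodup_range]
    intro i
    rw [List.mem_filter, List.mem_range, List.mem_range, decide_eq_true_eq, h, length_encode]
    omega
  unfold readOrder
  rw [hperm.length_eq, List.length_range]

open Classical in
theorem isArcList_readArcs : IsArcList x.G (readArcs x.encode x.n) := by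
  refine ⟨?_, fun i j => ?_⟩
  · unfold readArcs
    refine List.nodup_flatMap.2 ⟨fun i _ => ?_, ?_⟩
    · exact (List.nodup_range.filter _).map fun a b h => by simpa using h
    · refine List.nodup_range.imp fun {i j} hij => ?_
      intro e h1 h2
      obtain ⟨a, -, rfl⟩ := List.mem_map.1 h1
      obtain ⟨b, -, h⟩ := List.mem_map.1 h2
      exact hij (congrArg Prod.fst h).symm
  · have h1 : (i, j) ∈ readArcs x.encode x.n ↔
        i < x.n ∧ j < x.n ∧ x.encode.getD (x.n + 1 + i * x.n + j) false = true := by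
      simp only [readArcs, List.mem_flatMap, List.mem_map, List.mem_filter, List.mem_range,
        Prod.mk.injEq]
      constructor
      · rintro ⟨i, hi, j, ⟨hj, h⟩, rfl, rfl⟩
        exact ⟨hi, hj, h⟩
      · rintro ⟨hi, hj, h⟩
        exact ⟨i, hi, j, ⟨hj, h⟩, rfl, rfl⟩
    rw [h1]
    have h2 : ∀ (hi : i < x.n) (hj : j < x.n),
        (x.encode.getD (x.n + 1 + i * x.n + j) false = true ↔ x.G.Adj ⟨i, hi⟩ ⟨j, hj⟩) := by
      intro hi hj
      have h3 : i * x.n + j < x.n * x.n := by nlinarith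
      have h4 : x.n + 1 + i * x.n + j - (x.n + 1) = i * x.n + j := by omega
      have hd : (i * x.n + j) / x.n = i := by
        rw [mul_comm, Nat.mul_add_div x.order_pos, Nat.div_eq_of_lt hj, Nat.add_zero]
      have hm : (i * x.n + j) % x.n = j := by
        rw [mul_comm, Nat.mul_add_mod, Nat.mod_eq_of_lt hj]
      rw [encode_getD, if_neg (by omega), dif_pos (by rwa [h4]), if_neg (by omega),
        decide_eq_true_eq]
      simp only [h4, Fin.divNat, Fin.modNat, hd, hm]
    exact ⟨fun ⟨hi, hj, h⟩ => ⟨hi, hj, (h2 hi hj).1 h⟩, fun ⟨hi, hj, h⟩ => ⟨hi, hj, (h2 hi hj).2 h⟩⟩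

theorem readParts_encode : readParts x.encode x.n = min x.p (x.n + 1) := by
  unfold readParts
  rw [length_encode, List.range_add, List.reverse_append, List.foldl_append,
    List.foldl_reverse (l := List.map _ _), List.foldr_map]
  have h1 : ∀ (l : List ℕ) (r : ℕ), (∀ i ∈ l, i < x.n + 1 + x.n * x.n) →
      l.foldl (fun r i => if x.n + 1 + x.n * x.n ≤ i then
        min (r + r + if x.encode.getD i false = true then 1 else 0) (x.n + 1) else r) r = r := by
    intro l
    induction l with
    | nil => exact fun r _ => rfl
    | cons i l ih =>
      intro r h
      have := h i List.mem_cons_self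
      rw [List.foldl_cons, if_neg (by omega)]
      exact ih r fun j hj => h j (List.mem_cons_of_mem _ hj)
  rw [h1 _ _ fun i hi => by simpa only [List.mem_reverse, List.mem_range] using hi, ← nat_foldr_bits x.p (x.n + 1) (by omega)]
  congr 1
  funext q r
  have h2 : x.encode.getD (x.n + 1 + x.n * x.n + q) false = (Nat.bits x.p).getD q false := by
    rw [encode_getD, if_neg (by omega), dif_neg (by omega)]
    congr 1
    omega
  rw [if_pos (by omega), h2]

/-- With more than `n` nonempty parts both answers are no. -/
theorem hasEquitableConnectedPartition_min :
    HasEquitableConnectedPartition x.G (min x.p (x.n + 1)) ↔ x.IsYes := by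
  have h : ∀ q, HasEquitableConnectedPartition x.G q → q ≤ x.n := by
    rintro q ⟨π, rfl, -⟩
    simpa using π.card_parts_le_card
  unfold IsYes
  rcases le_total x.p (x.n + 1) with hp | hp
  · rw [min_eq_left hp]
  · rcases hp.eq_or_lt with hp | hp
    · rw [hp, min_self]
    · rw [min_eq_right hp.le]
      exact ⟨fun h' => absurd (h _ h') (by omega), fun h' => absurd (h _ h') (by omega)⟩

end ECPInstance

/-! ### The decision procedure is correct -/

theorem foldl_first_ne_zero {f : ℕ → ℕ} {l : List ℕ} {r : ℕ} :
    l.foldl (fun r k => if r = 0 then f k else r) r ≠ 0 ↔ r ≠ 0 ∨ ∃ k ∈ l, f k ≠ 0 := by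
  induction l generalizing r with
  | nil => simp
  | cons k l ih =>
    rw [List.foldl_cons, ih]
    by_cases hr : r = 0 <;> simp [hr]

theorem foldl_first_mem {f : ℕ → ℕ} {l : List ℕ} {r : ℕ} :
    l.foldl (fun r k => if r = 0 then f k else r) r = r ∨
      ∃ k ∈ l, l.foldl (fun r k => if r = 0 then f k else r) r = f k := by
  induction l generalizing r with
  | nil => simp
  | cons k l ih =>
    rw [List.foldl_cons]
    by_cases hr : r = 0
    · rw [if_pos hr]
      rcases ih (r := f k) with h | ⟨j, hj, h⟩
      · exact Or.inr ⟨k, List.mem_cons_self, h⟩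
      · exact Or.inr ⟨j, List.mem_cons_of_mem _ hj, h⟩
    · rw [if_neg hr]
      rcases ih (r := r) with h | ⟨j, hj, h⟩
      · exact Or.inl h
      · exact Or.inr ⟨j, List.mem_cons_of_mem _ hj, h⟩

theorem attemptWith_spec {n p K k : ℕ} {G : SimpleGraph (Fin n)} {E : List (ℕ × ℕ)}
    (hE : IsArcList G E) (hn : 0 < n) (hp : 0 < p) (h : attemptWith K n p E k ≠ 0) :
    attemptWith K n p E k = 2 ↔ HasEquitableConnectedPartition G p := by
  unfold attemptWith at h ⊢
  rw [vecSum_spec _ h, mem_allTables_iff_hasPartition hE hn hp]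
  have := (tablesNear_allTables (n := n) (p := p) (E := E) (l := List.range n) (by simp)
    (by simp)).length
  simpa [target, mkVec] using this

theorem attemptAll_spec {n p K : ℕ} {G : SimpleGraph (Fin n)} {E : List (ℕ × ℕ)}
    (hE : IsArcList G E) (hn : 0 < n) (hp : 0 < p) (h : attemptAll K n p E ≠ 0) :
    attemptAll K n p E = 2 ↔ HasEquitableConnectedPartition G p := by
  unfold attemptAll at h ⊢
  rcases foldl_first_mem (f := attemptWith K n p E) (l := List.range (n + 1)) (r := 0) with
    h' | ⟨k, -, h'⟩
  · exact absurd h' h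
  · rw [h'] at h ⊢
    exact attemptWith_spec hE hn hp h

/-- The first bound lets all subsets of a neighbourhood be tried. In the second, `4 * M` is the
number of values up to the target `4 * M - 1`, and the exponent is the width `5 * k + 6` plus one
for the vertex being eliminated. -/
theorem attemptWith_treewidth_ne_zero {n p K : ℕ} {G : SimpleGraph (Fin n)} {E : List (ℕ × ℕ)}
    (hE : IsArcList G E) (hp : 0 < p) (hK₁ : 2 ^ (4 * treewidth G + 5) ≤ K)
    (hK₂ : (4 * (flowVals n p).length) ^ (5 * treewidth G + 7) * (p + 1) ≤ K) :
    attemptWith K n p E (treewidth G) ≠ 0 := by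
  have hEn : ∀ e ∈ E, e.1 < n ∧ e.2 < n := fun e he => by
    obtain ⟨hi, hj, -⟩ := (hE.mem e.1 e.2).1 he
    exact ⟨hi, hj⟩
  have hr : ∀ {a b}, (a, b) ∈ E → (b, a) ∈ E := fun {a b} h => by
    obtain ⟨hi, hj, h⟩ := (hE.mem a b).1 h
    exact (hE.mem b a).2 ⟨hj, hi, h.symm⟩
  obtain ⟨h1, h2⟩ := isGoodOrder_elimOrder hE.nodup hEn hr hE.hasSplits hK₁
  have hM : 0 < (flowVals n p).length := lt_length_flowVals (z := 0) hp (by simp; omega)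
  have H : TableBound n (4 * (flowVals n p).length - 1) p K (5 * treewidth G + 6 + 1)
      (target n p (flowVals n p)) := by
    refine ⟨by simp [target, mkVec], fun u hu => ?_, ?_, ?_⟩
    · unfold target
      rw [entries_mkVec, if_pos (by omega), if_neg (by omega)]
    · unfold target
      rw [entries_mkVec, if_pos (by omega), if_pos rfl]
    · rwa [Nat.sub_add_cancel (by omega)]
  exact H.vecSum_ne_zero hr h1.nodup h1.lt h1.width_suffix (tablesNear_allTables h1.lt h2)

theorem length_flowVals_le {n p D : ℕ} (h : ∀ z ∈ flowVals n p, z ≤ D) :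
    (flowVals n p).length ≤ D + 1 := by
  have h1 : (flowVals n p).Nodup := List.nodup_range.filter _
  have h2 := (h1.subperm (l₂ := List.range (D + 1))
    fun z hz => List.mem_range.2 (Nat.lt_succ_of_le (h z hz))).length_le
  simpa using h2

namespace ECPInstance

variable (x : ECPInstance)

theorem length_flowVals_le_order :
    (flowVals x.n (min x.p (x.n + 1))).length ≤ x.n + 1 :=
  length_flowVals_le fun z hz => by
    have := List.mem_range.1 (List.mem_of_mem_filter hz)
    omega

theorem length_flowVals_le_ceil :
    (flowVals x.n (min x.p (x.n + 1))).length ≤ ⌈(x.n : ℚ) / (x.p : ℚ)⌉₊ + 1 := by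
  have hp := x.p_pos
  have hn := x.order_pos
  have hp' : (0 : ℚ) < x.p := by exact_mod_cast hp
  refine length_flowVals_le fun z hz => ?_
  rw [mem_flowVals (by omega)] at hz
  have hD : x.n ≤ ⌈(x.n : ℚ) / (x.p : ℚ)⌉₊ * x.p := by
    have := Nat.le_ceil ((x.n : ℚ) / (x.p : ℚ))
    rw [div_le_iff₀ hp'] at this
    exact_mod_cast this
  set D := ⌈(x.n : ℚ) / (x.p : ℚ)⌉₊
  have hD1 : 1 ≤ D := Nat.one_le_iff_ne_zero.2 fun h => by
    rw [h] at hD; omega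
  by_contra hz'
  have hz' : D + 1 ≤ z := by omega
  have h1 := (Nat.mul_le_mul_left (min x.p (x.n + 1)) hz').trans_lt hz
  rw [Nat.mul_succ] at h1
  -- Let `q` be the capped number of parts. A value above `D` forces `q * D < n`, which fails for `q
  -- = p` by the choice of `D` and for `q = n + 1` by `1 ≤ D`.
  rcases le_total x.p (x.n + 1) with h | h
  · rw [min_eq_left h, Nat.mul_comm] at h1; omega
  · rw [min_eq_right h] at h1
    have := Nat.mul_le_mul_left (x.n + 1) hD1
    omega

/-- A resource bound that suffices for the instance. -/
noncomputable def bound : ℕ :=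
  2 ^ (4 * treewidth x.G + 5) + (4 * (flowVals x.n (min x.p (x.n + 1))).length) ^
    (5 * treewidth x.G + 7) * (x.n + 2)

theorem solveWith_spec {K : ℕ} (h : solveWith K x.encode ≠ 0) :
    solveWith K x.encode = 2 ↔ x.IsYes := by
  have hp := x.p_pos
  unfold solveWith solveOrder at h ⊢
  rw [readOrder_encode, readParts_encode] at h ⊢
  rw [attemptAll_spec x.isArcList_readArcs x.order_pos (by omega) h,
    hasEquitableConnectedPartition_min]

theorem solveWith_bound_ne_zero : solveWith x.bound x.encode ≠ 0 := by
  have hp := x.p_pos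
  unfold solveWith solveOrder attemptAll
  rw [readOrder_encode, readParts_encode, foldl_first_ne_zero]
  refine Or.inr ⟨treewidth x.G, List.mem_range.2 ?_,
    attemptWith_treewidth_ne_zero x.isArcList_readArcs (by omega) (Nat.le_add_right _ _) ?_⟩
  · have := treewidth_le_card x.G
    rw [Fintype.card_fin] at this
    omega
  · refine le_trans (Nat.mul_le_mul_left _ ?_) (Nat.le_add_left _ _)
    omega

theorem exists_program : ∃ (c : RAM.Cmd) (e : ℕ), ∀ T : ECPInstance → ℕ,
    (∀ x : ECPInstance, (x.bound + x.encode.length + 2) ^ e ≤ T x) →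
      ∀ x : ECPInstance, ∃ (t : ℕ) (τ : RAM.State),
        RAM.Exec c (RAM.start x.encode) t τ ∧ t ≤ T x ∧
          (x.IsYes → τ.reg 0 = 1) ∧ (¬ x.IsYes → τ.reg 0 = 0) := by
  obtain ⟨c, e, h⟩ := RAM.exists_search_program (f := solveWith)
    (PolyTime.solveWith (by fun_prop) (by fun_prop))
  refine ⟨c, e, fun T hT x => ?_⟩
  obtain ⟨K, -, h0, t, τ, h1, h2, h3⟩ := h x.encode x.bound x.solveWith_bound_ne_zero
  have h4 := x.solveWith_spec h0
  refine ⟨t, τ, h1, h2.trans (hT x), fun hx => ?_, fun hx => ?_⟩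
  · rw [h3, if_pos (h4.2 hx)]
  · rw [h3, if_neg fun h => hx (h4.1 h)]

/-! ### Running times -/

theorem order_add_two_le : x.n + 2 ≤ x.encode.length ∧ 4 ≤ x.encode.length := by
  have h1 := x.order_pos
  have h2 : 0 < (Nat.bits x.p).length := List.length_pos_of_ne_nil fun h => by
    have := x.p_pos
    have h' := congrArg List.length h
    rw [Nat.size_eq_bits_len, List.length_nil, Nat.size_eq_zero] at h'
    omega
  have h3 : x.n ≤ x.n * x.n := Nat.le_mul_self _
  rw [length_encode]
  omega

/-- All summands are at most `N ^ (10 * k + 15)`: the factor `4 * M` is at most `N ^ 2`, and `n + 2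
≤ N` supplies the last power. The four summands cost one more factor `N`, as `4 ≤ N`. -/
theorem bound_add_le_pow : x.bound + x.encode.length + 2 ≤
    x.encode.length ^ (16 * (treewidth x.G + 1)) := by
  obtain ⟨h1, h2⟩ := x.order_add_two_le
  have h3 := x.length_flowVals_le_order
  unfold bound
  set N := x.encode.length
  set k := treewidth x.G
  set M := (flowVals x.n (min x.p (x.n + 1))).length
  have ha : 2 ^ (4 * k + 5) ≤ N ^ (10 * k + 15) :=
    (Nat.pow_le_pow_left (by omega) _).trans (Nat.pow_le_pow_right (by omega) (by omega))
  have hb : (4 * M) ^ (5 * k + 7) * (x.n + 2) ≤ N ^ (10 * k + 15) := by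
    have : 4 * M ≤ N ^ 2 := by
      rw [pow_two]; exact Nat.mul_le_mul h2 (by omega)
    calc (4 * M) ^ (5 * k + 7) * (x.n + 2) ≤ (N ^ 2) ^ (5 * k + 7) * N :=
          Nat.mul_le_mul (Nat.pow_le_pow_left this _) h1
      _ = N ^ (10 * k + 15) := by rw [← pow_mul, ← pow_succ]; congr 1; ring
  have hc : N ≤ N ^ (10 * k + 15) := Nat.le_self_pow (by omega) _
  calc 2 ^ (4 * k + 5) + (4 * M) ^ (5 * k + 7) * (x.n + 2) + N + 2
      ≤ 4 * N ^ (10 * k + 15) := by omega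
    _ ≤ N * N ^ (10 * k + 15) := Nat.mul_le_mul_right _ h2
    _ = N ^ (10 * k + 16) := by rw [← pow_succ']
    _ ≤ N ^ (16 * (k + 1)) := Nat.pow_le_pow_right (by omega) (by omega)

/-- Bounding `M` by the ceiling removes `n` from the base of the power; the input length enters only
through the factor `n + 2` of the root counter and the summand `N`. -/
theorem bound_add_le_mul : x.bound + x.encode.length + 2 ≤
    4 * (4 * (treewidth x.G + ⌈(x.n : ℚ) / (x.p : ℚ)⌉₊ + 1)) ^
      (5 * (treewidth x.G + ⌈(x.n : ℚ) / (x.p : ℚ)⌉₊) + 7) * x.encode.length := by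
  obtain ⟨h1, h2⟩ := x.order_add_two_le
  have h3 := x.length_flowVals_le_ceil
  unfold bound
  set N := x.encode.length
  set k := treewidth x.G
  set D := ⌈(x.n : ℚ) / (x.p : ℚ)⌉₊
  set M := (flowVals x.n (min x.p (x.n + 1))).length
  set Z := (4 * (k + D + 1)) ^ (5 * (k + D) + 7) with hZ
  have hZ1 : 1 ≤ Z := Nat.one_le_pow _ _ (by omega)
  have ha : 2 ^ (4 * k + 5) ≤ Z * N :=
    ((Nat.pow_le_pow_left (by omega) _).trans (Nat.pow_le_pow_right (by omega) (by omega))).trans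
      (Nat.le_mul_of_pos_right _ (by omega))
  have hb : (4 * M) ^ (5 * k + 7) * (x.n + 2) ≤ Z * N :=
    Nat.mul_le_mul ((Nat.pow_le_pow_left (by omega) _).trans
      (Nat.pow_le_pow_right (by omega) (by omega))) h1
  have hc : N ≤ Z * N := Nat.le_mul_of_pos_left _ hZ1
  rw [mul_assoc]
  omega

end ECPInstance

theorem Computable.nat_mul_add_one (C : ℕ) : Computable fun k : ℕ => C * (k + 1) :=
  (Primrec.nat_mul.comp (.const C) Primrec.succ).to_comp

theorem computable_fptBound (e : ℕ) :
    Computable fun m : ℕ => (4 * (4 * (m + 1)) ^ (5 * m + 7)) ^ e := by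
  have hpow : Primrec₂ fun a b : ℕ => a ^ b := Primrec₂.unpaired'.1 Nat.Primrec.pow
  refine Primrec.to_comp (hpow.comp (Primrec.nat_mul.comp (.const 4) (hpow.comp
    (Primrec.nat_mul.comp (.const 4) Primrec.succ)
    (Primrec.nat_add.comp (Primrec.nat_mul.comp (.const 5) .id) (.const 7)))) (.const e))

/-- One program serves all three claims; they differ only in how `bound` is estimated before it is
raised to the fixed power `e`. -/
theorem mainTheorem12 :
    (ECP fun x => treewidth x.G).InXP ∧
    (∃ C : ℕ, (ECP fun x => treewidth x.G).SolvableInTime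
      fun x => x.encode.length ^ (C * (treewidth x.G + 1))) ∧
    (ECP fun x => treewidth x.G + ⌈(x.n : ℚ) / (x.p : ℚ)⌉₊).InFPT := by
  obtain ⟨c, e, h⟩ := ECPInstance.exists_program
  have hxp : ∀ x : ECPInstance, (x.bound + x.encode.length + 2) ^ e ≤
      x.encode.length ^ (16 * e * (treewidth x.G + 1)) := fun x => by
    rw [show 16 * e * (treewidth x.G + 1) = 16 * (treewidth x.G + 1) * e by ring, pow_mul]
    exact Nat.pow_le_pow_left x.bound_add_le_pow e
  refine ⟨⟨fun k => 16 * e * (k + 1), Computable.nat_mul_add_one _, c, h _ hxp⟩,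
    ⟨16 * e, c, h _ hxp⟩, _, e, computable_fptBound e, c, h (fun x =>
      (4 * (4 * (treewidth x.G + ⌈(x.n : ℚ) / (x.p : ℚ)⌉₊ + 1)) ^
        (5 * (treewidth x.G + ⌈(x.n : ℚ) / (x.p : ℚ)⌉₊) + 7)) ^ e * x.encode.length ^ e)
      fun x => ?_⟩
  have := Nat.pow_le_pow_left x.bound_add_le_mul e
  rw [mul_pow] at this
  exact this
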